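/- Let $M>0$, $|a|\le M$, $r_\pm=M\pm\sqrt{M^2-a^2}$, and let $\mathcal M=\mathbb R\times[r_+,\infty)\times\mathbb S^2$ be the Kerr exterior (including the event horizon $r=r_+$), with Kerr coordinates $(\bar t,r,\theta,\bar\phi)$, $\Delta=(r-r_+)(r-r_-)$, $\Sigma=r^2+a^2\cos^2\theta$ and metric $$g=-\Big(1-\frac{2Mr}{\Sigma}\Big)d\bar t^2+2\,d\bar t\,dr+\Sigma\,d\theta^2+\frac{(r^2+a^2)^2-\Delta a^2\sin^2\theta}{\Sigma}\sin^2\theta\,d\bar\phi^2-2a\sin^2\theta\,dr\,d\bar\phi-\frac{4aMr}{\Sigma}\sin^2\theta\,d\bar t\,d\bar\phi ,$$ with Levi-Civita connection $\nabla$. Let $$e_3=-\partial_r,\qquad e_4=\Sigma^{-1}\big(2(r^2+a^2)\partial_{\bar t}+\Delta\,\partial_r+2a\,\partial_{\bar\phi}\big)$$ be the algebraically special null vector fields, which satisfy $g(e_3,e_4)=-2$, and let $\mathfrak D=\langle e_3,e_4\rangle^\perp$ be the horizontal distribution. Horizontal one-forms are sections of $\mathfrak D^\star$, identified with the one-forms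 on $\mathcal M$ vanishing on $e_3,e_4$. Capital indices refer to a local orthonormal frame $(e_1,e_2)$ of $\mathfrak D$. Let $\slashed g$ be the induced metric on $\mathfrak D$, $\slashed\varepsilon=\sin\theta\,d\theta\wedge((r^2+a^2)d\bar\phi-a\,d\bar t)$ its volume form, and $\slashed\nabla$ the connection induced on $\mathfrak D$ by orthogonal projection of $\nabla$; write $\slashed\nabla_3=\slashed\nabla_{e_3}$, $\slashed\nabla_4=\slashed\nabla_{e_4}$, $(\slashed\nabla f)_A=e_A(f)$ for a scalar $f$. For horizontal one-forms $\varsigma,\tau$ and a horizontal two-tensor $\vartheta$ put ${}^\star\varsigma_A=\slashed\varepsilon_{AB}\varsigma^B$, $(\varsigma,\tau)=\varsigma^A\tau_A$, $\varsigma\wedge\tau=\slashed\varepsilon^{AB}\varsigma_A\tau_B$, $(\vartheta^{\sharp_2}\cdot\varsigma)_A=\vartheta_{AB}\varsigma^B$, $\mathrm{tr}\,\vartheta=\slashed g^{AB}\vartheta_{AB}$, $\slashed\varepsilon\cdot\vartheta=\slashed\varepsilon^{AB}\vartheta_{AB}$, $\slashed{\mathrm{div}}\,\varsigma=\slashed g^{AB}(\slashed\nabla_A\varsigma)_B$,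 $\slashed{\mathrm{curl}}\,\varsigma=\slashed\varepsilon^{AB}(\slashed\nabla_A\varsigma)_B$, and for a scalar $f$ write $(\slashed\nabla+2\tau)f=\slashed\nabla f+2f\tau$ and ${}^\star(\slashed\nabla+2\tau)f={}^\star(\slashed\nabla f+2f\tau)$. The connection coefficients are $\chi_{AB}=g(\nabla_{e_A}e_4,e_B)$, $\underline\chi_{AB}=g(\nabla_{e_A}e_3,e_B)$, $\eta_A=\frac12g(\nabla_{e_3}e_4,e_A)$, $\underline\eta_A=\frac12g(\nabla_{e_4}e_3,e_A)$, $\hat\omega=\frac12g(\nabla_{e_4}e_3,e_4)$. Let $U\subseteq\mathcal M$ be (relatively) open, for example $U=\mathcal M$, and let $(\alpha,\underline\alpha,\rho,\sigma)$ be a smooth solution on $U$ of the Maxwell system relative to this frame, that is, $\alpha,\underline\alpha$ are smooth horizontal one-forms and $\rho,\sigma$ smooth functions on $U$ with \begin{align*} \slashed\nabla_3\sigma+\mathrm{tr}\underline\chi\,\sigma&=-\slashed{\mathrm{curl}}\,\underline\alpha-(\slashed\varepsilon\cdot\underline\chi)\rho, & \slashed\nabla_3\rho+\mathrm{tr}\underline\chi\,\rho&=-\slashed{\mathrm{div}}\,\underline\alpha+(\slashed\varepsilon\cdot\underline\chi)\sigma,\\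 \slashed\nabla_4\sigma+\mathrm{tr}\chi\,\sigma&=-\slashed{\mathrm{curl}}\,\alpha-(\eta+\underline\eta)\wedge\alpha+(\slashed\varepsilon\cdot\chi)\rho, & \slashed\nabla_4\rho+\mathrm{tr}\chi\,\rho&=\slashed{\mathrm{div}}\,\alpha+(\eta+\underline\eta,\alpha)-(\slashed\varepsilon\cdot\chi)\sigma, \end{align*} \begin{align*} \slashed\nabla_3\alpha+\underline\chi^{\sharp_2}\cdot\alpha&=\slashed\nabla\rho+{}^\star\slashed\nabla\sigma+2\eta\,\rho+2\,{}^\star\eta\,\sigma,\\ \slashed\nabla_4\underline\alpha+\chi^{\sharp_2}\cdot\underline\alpha+\hat\omega\,\underline\alpha&=-\slashed\nabla\rho+{}^\star\slashed\nabla\sigma-2\underline\eta\,\rho+2\,{}^\star\underline\eta\,\sigma . \end{align*} (These are the components $\alpha(e_A)=F(e_A,e_4)$, $\underline\alpha(e_A)=F(e_A,e_3)$, $\rho=\frac12F(e_3,e_4)$, $\sigma=\frac12\slashed\varepsilon^{AB}F(e_A,e_B)$ of a source-free Maxwell field $F$.) Then on $U$ the following hold. Tensorial Teukolsky equations of spin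 $+1$ and $-1$: $$\Sigma\Big(\slashed\nabla_4+\tfrac32\mathrm{tr}\chi-\tfrac12(\slashed\varepsilon\cdot\chi){}^\star\Big)\Big(\slashed\nabla_3+\tfrac12\mathrm{tr}\underline\chi+\tfrac12(\slashed\varepsilon\cdot\underline\chi){}^\star\Big)\alpha-(\slashed\nabla+2\eta)\slashed{\mathrm{div}}(\Sigma\alpha)+{}^\star(\slashed\nabla+2\eta)\slashed{\mathrm{curl}}(\Sigma\alpha)=0,$$ $$\Big(\slashed\nabla_3+\tfrac32\mathrm{tr}\underline\chi-\tfrac12(\slashed\varepsilon\cdot\underline\chi){}^\star\Big)\Big(\slashed\nabla_4+\tfrac12\mathrm{tr}\chi+\tfrac12(\slashed\varepsilon\cdot\chi){}^\star+\hat\omega\Big)\underline\alpha-(\slashed\nabla+2\underline\eta)\slashed{\mathrm{div}}\,\underline\alpha+{}^\star(\slashed\nabla+2\underline\eta)\slashed{\mathrm{curl}}\,\underline\alpha=0.$$ Tensorial Teukolsky–Starobinsky identities: $$\frac1\Sigma\Big(\slashed\nabla_3+\tfrac12\mathrm{tr}\underline\chi+\tfrac32(\slashed\varepsilon\cdot\underline\chi){}^\star\Big)\Big[\Sigma\Big(\slashed\nabla_3+\tfrac12\mathrm{tr}\underline\chi+\tfrac12(\slashed\varepsilon\cdot\underline\chi){}^\star\Big)\alpha\Big]=-(\slashed\nabla+2\eta)\slashed{\mathrm{div}}\,\underline\alpha-{}^\star(\slashed\nabla+2\eta)\slashed{\mathrm{curl}}\,\underline\alpha,$$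 $$\Big(\slashed\nabla_4+\tfrac12\mathrm{tr}\chi+\tfrac32(\slashed\varepsilon\cdot\chi){}^\star\Big)\Big[\Sigma\Big(\slashed\nabla_4+\hat\omega+\tfrac12\mathrm{tr}\chi+\tfrac12(\slashed\varepsilon\cdot\chi){}^\star\Big)\underline\alpha\Big]=-(\slashed\nabla+2\underline\eta)\slashed{\mathrm{div}}(\Sigma\alpha)-{}^\star(\slashed\nabla+2\underline\eta)\slashed{\mathrm{curl}}(\Sigma\alpha).$$ -/

import Mathlib

open scoped ContDiff

/-! # Horizontal tensor calculus on the Kerr exterior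

The Kerr exterior `ℝ × [r₊, ∞) × 𝕊²`, with Kerr coordinates `(t, r, θ, φ)` (ingoing, regular
on the future event horizon `r = r₊`), is realised in one global chart through the diffeomorphism
`(t, r, ω) ↦ (t, r ω)` onto `{(t, x, y, z) : r = |(x, y, z)| ≥ r₊}`. Thus `x = r sin θ cos φ`,
`y = r sin θ sin φ`, `z = r cos θ`; the chart covers the horizon and the rotation axis.
Tensor fields are given by their components in the coordinates `(t, x, y, z)`. -/

namespace KerrMaxwell

/-- Points, with coordinates `(t, x, y, z)`. -/
abbrev Pt := Fin 4 → ℝ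

/-- Component functions of a one-form. -/
abbrev OneForm := Pt → Fin 4 → ℝ

/-- Component functions of a vector field. -/
abbrev VecField := Pt → Fin 4 → ℝ

/-- Component functions of a covariant two-tensor. -/
abbrev TwoTensor := Pt → Fin 4 → Fin 4 → ℝ

noncomputable section

/-! ### The manifold and the metric -/

/-- The radii `r₊` and `r₋`. -/
def rPlus (M a : ℝ) : ℝ := M + √(M ^ 2 - a ^ 2)

def rMinus (M a : ℝ) : ℝ := M - √(M ^ 2 - a ^ 2)

/-- The coordinate `r`. -/
def rad (p : Pt) : ℝ := √(p 1 ^ 2 + p 2 ^ 2 + p 3 ^ 2)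

/-- The function `cos θ`. -/
def cosTheta (p : Pt) : ℝ := p 3 / rad p

/-- The exterior as a manifold with boundary; the boundary `r = r₊` is the event horizon. -/
def exterior (M a : ℝ) : Set Pt := {p | rPlus M a ≤ rad p}

/-- `Δ = (r - r₊)(r - r₋)`. -/
def bigDelta (M a : ℝ) (p : Pt) : ℝ := (rad p - rPlus M a) * (rad p - rMinus M a)

/-- `Σ = r² + a² cos² θ`. -/
def bigSigma (a : ℝ) (p : Pt) : ℝ := rad p ^ 2 + a ^ 2 * cosTheta p ^ 2

/-- The one-form `dt`. -/
def dT : OneForm := fun _ => ![1, 0, 0, 0]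

/-- The one-form `dr`. -/
def dR : OneForm := fun p => ![0, p 1 / rad p, p 2 / rad p, p 3 / rad p]

/-- The one-form `sin² θ dφ = (x dy - y dx) / r²`, smooth across the axis. -/
def sinSqDPhi : OneForm := fun p => ![0, -p 2 / rad p ^ 2, p 1 / rad p ^ 2, 0]

/-- The unit round metric `dθ² + sin² θ dφ² = (dx² + dy² + dz² - dr²) / r²`. -/
def roundMetric : TwoTensor := fun p i j =>
  ((if i = j ∧ i ≠ 0 then 1 else 0) - dR p i * dR p j) / rad p ^ 2

/-- The Kerr metric in Kerr coordinates,
`-(1 - 2Mr/Σ) dt² + 2 dt dr + Σ dθ² + Σ⁻¹ ((r² + a²)² - Δ a² sin² θ) sin² θ dφ²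
  - 2 a sin² θ dr dφ - 4 a M r Σ⁻¹ sin² θ dt dφ`,
where `Σ dθ² + Σ⁻¹ ((r² + a²)² - Δ a² sin² θ) sin² θ dφ²` is rewritten as
`Σ (dθ² + sin² θ dφ²) + a² (1 + 2Mr/Σ) (sin² θ dφ)²` so that it is smooth across the axis. -/
def metric (M a : ℝ) (p : Pt) : Matrix (Fin 4) (Fin 4) ℝ := Matrix.of fun i j =>
  -(1 - 2 * M * rad p / bigSigma a p) * (dT p i * dT p j)
    + (dT p i * dR p j + dR p i * dT p j)
    + bigSigma a p * roundMetric p i j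
    + a ^ 2 * (1 + 2 * M * rad p / bigSigma a p) * (sinSqDPhi p i * sinSqDPhi p j)
    - a * (dR p i * sinSqDPhi p j + sinSqDPhi p i * dR p j)
    - 2 * a * M * rad p / bigSigma a p * (dT p i * sinSqDPhi p j + sinSqDPhi p i * dT p j)

/-- The inverse metric `g^{ij}`. -/
def metricInv (M a : ℝ) (p : Pt) : Matrix (Fin 4) (Fin 4) ℝ := (metric M a p)⁻¹

/-- Coordinate partial derivative `∂ᵢ f` on the exterior (one-sided at the boundary). -/
def pd (M a : ℝ) (i : Fin 4) (f : Pt → ℝ) (p : Pt) : ℝ :=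
  fderivWithin ℝ f (exterior M a) p (Pi.single i 1)

/-! ### The Levi-Civita connection -/

/-- Christoffel symbols `Γ^k_{ij}`. -/
def christoffel (M a : ℝ) (k i j : Fin 4) (p : Pt) : ℝ :=
  (1 / 2) * ∑ l, metricInv M a p k l *
    (pd M a i (fun q => metric M a q j l) p + pd M a j (fun q => metric M a q i l) p
      - pd M a l (fun q => metric M a q i j) p)

/-- `(∇ᵢ V)^k` for a vector field `V`. -/
def covVec (M a : ℝ) (V : VecField) (p : Pt) (i k : Fin 4) : ℝ :=
  pd M a i (fun q => V q k) p + ∑ j, christoffel M a k i j p * V p j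

/-- `(∇ᵢ ς)ⱼ` for a one-form `ς`. -/
def covForm (M a : ℝ) (ς : OneForm) (p : Pt) (i j : Fin 4) : ℝ :=
  pd M a i (fun q => ς q j) p - ∑ k, christoffel M a k i j p * ς p k

/-! ### The algebraically special frame and its horizontal distribution -/

/-- `e₃ = -∂_r`; in Boyer–Lindquist coordinates,
`e₃ = Δ⁻¹ (r² + a²) ∂_t - ∂_r + Δ⁻¹ a ∂_φ`. -/
def e3 : VecField := fun p => ![0, -(p 1 / rad p), -(p 2 / rad p), -(p 3 / rad p)]

/-- `e₄ = Σ⁻¹ (2 (r² + a²) ∂_t + Δ ∂_r + 2 a ∂_φ)`; in Boyer–Lindquist coordinates,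
`e₄ = Σ⁻¹ ((r² + a²) ∂_t + Δ ∂_r + a ∂_φ)`. -/
def e4 (M a : ℝ) : VecField := fun p =>
  (bigSigma a p)⁻¹ •
    ((2 * (rad p ^ 2 + a ^ 2)) • ![1, 0, 0, 0]
      + bigDelta M a p • ![0, p 1 / rad p, p 2 / rad p, p 3 / rad p]
      + (2 * a) • ![0, -p 2, p 1, 0])

/-- The inner product `g(u, v)` at `p`. -/
def inner4 (M a : ℝ) (p : Pt) (u v : Fin 4 → ℝ) : ℝ := ∑ i, ∑ j, metric M a p i j * u i * v j

/-- The one-form `g(V, ·)`. -/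
def flat (M a : ℝ) (V : VecField) : OneForm := fun p j => ∑ i, metric M a p i j * V p i

/-- The matrix `Π^i_j` of the orthogonal projection onto the horizontal distribution
`⟨e₃, e₄⟩^⊥` (recall `g(e₃, e₄) = -2`). -/
def proj (M a : ℝ) (p : Pt) (i j : Fin 4) : ℝ :=
  (if i = j then 1 else 0)
    + (1 / 2) * (e3 p i * flat M a (e4 M a) p j + e4 M a p i * flat M a e3 p j)

/-- Restriction of a one-form to the horizontal distribution. Horizontal tensors are
identified with their canonical extensions, the spacetime tensors which vanish as soon as
one argument is `e₃` or `e₄`. -/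
def horiz (M a : ℝ) (ς : OneForm) : OneForm := fun p j => ∑ k, ς p k * proj M a p k j

/-- `ς` is (the canonical extension of) a horizontal one-form on `U`. -/
def IsHorizontal (M a : ℝ) (U : Set Pt) (ς : OneForm) : Prop :=
  ∀ p ∈ U, ∑ i, ς p i * e3 p i = 0 ∧ ∑ i, ς p i * e4 M a p i = 0

/-- The inverse of the induced metric on the horizontal distribution. -/
def hInv (M a : ℝ) (p : Pt) (i j : Fin 4) : ℝ :=
  metricInv M a p i j + (1 / 2) * (e3 p i * e4 M a p j + e4 M a p i * e3 p j)

/-- The area form `sin θ dθ ∧ dφ` of the unit sphere. -/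
def roundArea : TwoTensor := fun p i j =>
  (!![0, 0, 0, 0;
      0, 0, p 3, -p 2;
      0, -p 3, 0, p 1;
      0, p 2, -p 1, 0] : Matrix (Fin 4) (Fin 4) ℝ) i j / rad p ^ 3

/-- The one-form `d(cos θ)`. -/
def dCosTheta : OneForm := fun p =>
  ![0, -(p 3 * p 1) / rad p ^ 3, -(p 3 * p 2) / rad p ^ 3, 1 / rad p - p 3 ^ 2 / rad p ^ 3]

/-- The horizontal volume form
`sin θ dθ ∧ ((r² + a²) dφ - a dt) = (r² + a²) sin θ dθ ∧ dφ + a d(cos θ) ∧ dt`.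
It vanishes on `e₃`, `e₄`, and equals `1` on the oriented orthonormal horizontal frame
`e₁ = Σ⁻¹ (a² sin θ cos θ ∂_t + r ∂_θ + a cot θ ∂_φ)`,
`e₂ = Σ⁻¹ (a r sin θ ∂_t - a cos θ ∂_θ + r (sin θ)⁻¹ ∂_φ)` away from the axis. -/
def eps (a : ℝ) : TwoTensor := fun p i j =>
  (rad p ^ 2 + a ^ 2) * roundArea p i j + a * (dCosTheta p i * dT p j - dT p i * dCosTheta p j)

/-! ### Horizontal algebra -/

/-- `(ς, τ) = g^{AB} ς_A τ_B`. -/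
def hDot (M a : ℝ) (ς τ : OneForm) (p : Pt) : ℝ := ∑ i, ∑ j, hInv M a p i j * ς p i * τ p j

/-- `ε^{AB}`. -/
def epsUp (M a : ℝ) (p : Pt) (i j : Fin 4) : ℝ :=
  ∑ k, ∑ l, hInv M a p i k * hInv M a p j l * eps a p k l

/-- `ς ∧ τ = ε^{AB} ς_A τ_B`. -/
def hWedge (M a : ℝ) (ς τ : OneForm) (p : Pt) : ℝ := ∑ i, ∑ j, epsUp M a p i j * ς p i * τ p j

/-- Horizontal Hodge dual `(⋆ς)_A = g^{BC} ε_{AC} ς_B`. -/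
def hStar (M a : ℝ) (ς : OneForm) : OneForm := fun p i =>
  ∑ j, ∑ k, eps a p i k * hInv M a p j k * ς p j

/-- `(θ^{♯₂} · ς)_A = g^{BC} θ_{AC} ς_B`. -/
def sharpDot (M a : ℝ) (θ : TwoTensor) (ς : OneForm) : OneForm := fun p i =>
  ∑ j, ∑ k, hInv M a p j k * θ p i k * ς p j

/-- The trace `g^{AB} θ_{AB}`. -/
def hTr (M a : ℝ) (θ : TwoTensor) (p : Pt) : ℝ := ∑ i, ∑ j, hInv M a p i j * θ p i j

/-- The antitrace `ε · θ = ε^{AB} θ_{AB}`. -/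
def epsDot (M a : ℝ) (θ : TwoTensor) (p : Pt) : ℝ := ∑ i, ∑ j, epsUp M a p i j * θ p i j

/-! ### Connection coefficients -/

/-- `∇_X V`. -/
def covAlong (M a : ℝ) (X V : VecField) : VecField := fun p k =>
  ∑ i, X p i * covVec M a V p i k

/-- `(A, B) ↦ g(∇_A V, e_B)` on the horizontal distribution. -/
def secondFund (M a : ℝ) (V : VecField) : TwoTensor := fun p i j =>
  ∑ k, ∑ l, ∑ m, proj M a p k i * proj M a p l j * metric M a p m l * covVec M a V p k m

/-- `χ_{AB} = g(∇_A e₄, e_B)`. -/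
def chi (M a : ℝ) : TwoTensor := secondFund M a (e4 M a)

/-- `χ̲_{AB} = g(∇_A e₃, e_B)`. -/
def chiBar (M a : ℝ) : TwoTensor := secondFund M a e3

def trChi (M a : ℝ) : Pt → ℝ := hTr M a (chi M a)

def trChiBar (M a : ℝ) : Pt → ℝ := hTr M a (chiBar M a)

def epsChi (M a : ℝ) : Pt → ℝ := epsDot M a (chi M a)

def epsChiBar (M a : ℝ) : Pt → ℝ := epsDot M a (chiBar M a)

/-- `η_A = ½ g(∇_{e₃} e₄, e_A)`. -/
def eta (M a : ℝ) : OneForm := fun p j =>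
  (1 / 2) * horiz M a (flat M a (covAlong M a e3 (e4 M a))) p j

/-- `η̲_A = ½ g(∇_{e₄} e₃, e_A)`. -/
def etaBar (M a : ℝ) : OneForm := fun p j =>
  (1 / 2) * horiz M a (flat M a (covAlong M a (e4 M a) e3)) p j

/-- `ω̂ = ½ g(∇_{e₄} e₃, e₄)`, so that `∇_{e₄} e₄ = ω̂ e₄`. -/
def omegaHat (M a : ℝ) (p : Pt) : ℝ :=
  (1 / 2) * inner4 M a p (covAlong M a (e4 M a) e3 p) (e4 M a p)

/-! ### Horizontal differential operators -/

/-- Derivative `X(f)` of a scalar. -/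
def dirDeriv (M a : ℝ) (X : VecField) (f : Pt → ℝ) (p : Pt) : ℝ := ∑ i, X p i * pd M a i f p

/-- Induced connection on horizontal one-forms:
`(∇̸_X ς)(Y) = X(ς(Y)) - ς(Π ∇_X Y)` for horizontal `Y`, that is `∇̸_X ς = (∇_X ς) ∘ Π`. -/
def nab (M a : ℝ) (X : VecField) (ς : OneForm) : OneForm :=
  horiz M a fun p j => ∑ i, X p i * covForm M a ς p i j

/-- Horizontal gradient `(∇̸ f)_A = e_A(f)`. -/
def grad (M a : ℝ) (f : Pt → ℝ) : OneForm := horiz M a fun p i => pd M a i f p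

/-- The horizontal two-tensor `(∇̸_A ς)_B`. -/
def nabTensor (M a : ℝ) (ς : OneForm) : TwoTensor := fun p i j =>
  ∑ k, ∑ l, proj M a p k i * proj M a p l j * covForm M a ς p k l

/-- `div ς = g^{AB} (∇̸_A ς)_B`. -/
def hDiv (M a : ℝ) (ς : OneForm) : Pt → ℝ := hTr M a (nabTensor M a ς)

/-- `curl ς = ε^{AB} (∇̸_A ς)_B`. -/
def hCurl (M a : ℝ) (ς : OneForm) : Pt → ℝ := epsDot M a (nabTensor M a ς)

/-- Multiplication of a one-form by a scalar function. -/
def scal (f : Pt → ℝ) (ς : OneForm) : OneForm := fun p => f p • ς p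

/-- `(∇̸₃ + c tr χ̲ + d (ε·χ̲) ⋆) ς`. -/
def op3 (M a c d : ℝ) (ς : OneForm) : OneForm := fun p =>
  nab M a e3 ς p + (c * trChiBar M a p) • ς p + (d * epsChiBar M a p) • hStar M a ς p

/-- `(∇̸₄ + c tr χ + d (ε·χ) ⋆) ς`. -/
def op4 (M a c d : ℝ) (ς : OneForm) : OneForm := fun p =>
  nab M a (e4 M a) ς p + (c * trChi M a p) • ς p + (d * epsChi M a p) • hStar M a ς p

/-- `(∇̸ + 2τ) f = ∇̸f + 2 f τ` for a scalar `f` and a horizontal one-form `τ`. -/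
def gradShift (M a : ℝ) (τ : OneForm) (f : Pt → ℝ) : OneForm := fun p =>
  grad M a f p + (2 * f p) • τ p

/-! ### The Maxwell equations -/

/-- `(α, α̲, ρ, σ)` is a smooth solution on `U` of the source-free Maxwell system relative to the
algebraically special frame. -/
structure IsMaxwellSolution (M a : ℝ) (U : Set Pt) (α αb : OneForm) (ρ σ : Pt → ℝ) : Prop where
  smooth_alpha : ContDiffOn ℝ ∞ α U
  smooth_alphaBar : ContDiffOn ℝ ∞ αb U
  smooth_rho : ContDiffOn ℝ ∞ ρ U
  smooth_sigma : ContDiffOn ℝ ∞ σ U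
  horizontal_alpha : IsHorizontal M a U α
  horizontal_alphaBar : IsHorizontal M a U αb
  e3_sigma : ∀ p ∈ U, dirDeriv M a e3 σ p + trChiBar M a p * σ p
    = -hCurl M a αb p - epsChiBar M a p * ρ p
  e3_rho : ∀ p ∈ U, dirDeriv M a e3 ρ p + trChiBar M a p * ρ p
    = -hDiv M a αb p + epsChiBar M a p * σ p
  e4_sigma : ∀ p ∈ U, dirDeriv M a (e4 M a) σ p + trChi M a p * σ p
    = -hCurl M a α p - hWedge M a (eta M a + etaBar M a) α p + epsChi M a p * ρ p
  e4_rho : ∀ p ∈ U, dirDeriv M a (e4 M a) ρ p + trChi M a p * ρ p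
    = hDiv M a α p + hDot M a (eta M a + etaBar M a) α p - epsChi M a p * σ p
  e3_alpha : ∀ p ∈ U, nab M a e3 α p + sharpDot M a (chiBar M a) α p
    = grad M a ρ p + hStar M a (grad M a σ) p
      + (2 * ρ p) • eta M a p + (2 * σ p) • hStar M a (eta M a) p
  e4_alphaBar : ∀ p ∈ U, nab M a (e4 M a) αb p + sharpDot M a (chi M a) αb p
      + omegaHat M a p • αb p
    = -grad M a ρ p + hStar M a (grad M a σ) p
      - (2 * ρ p) • etaBar M a p + (2 * σ p) • hStar M a (etaBar M a) p

end

end KerrMaxwell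

open KerrMaxwell

/-! On a dense open set, the fields `K₀ = sin θ ∂_θ` and `K₁ = a sin² θ ∂_t + ∂_φ` span the
horizontal distribution, and they commute with `e₃ = -∂_r` and with `Σ e₄`. So does
`L = K₀ + i K₁`, which differentiates functions into spin components `ς(K₀) + i ς(K₁)` of horizontal
one-forms. With `ζ = r + i a cos θ`, the trace and the antisymmetric part of the second fundamental
forms combine into logarithmic derivatives, `tr χ̲ + i ε·χ̲` of `ζ²` along `e₃` and `tr χ + i ε·χ`
of `ζ̄²` along `e₄`, while the spin components of `2η` and `2η̲` are the logarithmic derivatives of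
`ζ̄²` and `ζ²` along `L`. Hence `ζ̄²` and `ζ²` are integrating factors for all the operators
involved: the equations for `α` and `α̲` express their weighted transport along `e₃` and `Σ e₄` as
`L(ζ̄² (ρ - iσ))` and `-L(ζ² (ρ + iσ))`, and those for `ρ, σ` express the derivatives of
`ζ̄² (ρ - iσ)` and `ζ² (ρ + iσ)` along `e₃` and `Σ e₄` as weighted divergences and curls.
Differentiating the first two once more along `Σ e₄` or `e₃` and commuting with `L` gives the four
identities on the dense set; both sides being smooth, they extend to the axis and the horizon. -/

namespace KerrMaxwell

noncomputable section

open scoped Matrix ComplexConjugate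
open VectorField Topology

variable {M a : ℝ} {p : Pt}

/-! ### Spheroidal frame fields -/

theorem rad_sq (p : Pt) : rad p ^ 2 = p 1 ^ 2 + p 2 ^ 2 + p 3 ^ 2 :=
  Real.sq_sqrt (by positivity)

theorem bigSigma_pos (a : ℝ) (hr : 0 < rad p) : 0 < bigSigma a p := by
  unfold bigSigma; positivity

theorem bigDelta_eq (ha : |a| ≤ M) (p : Pt) :
    bigDelta M a p = rad p ^ 2 - 2 * M * rad p + a ^ 2 := by
  have h : √(M ^ 2 - a ^ 2) ^ 2 = M ^ 2 - a ^ 2 :=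
    Real.sq_sqrt (by nlinarith [abs_le.1 ha, sq_abs a, abs_nonneg a])
  unfold bigDelta rPlus rMinus
  linear_combination -h

/-- The function `sin² θ`. -/
def sinSq (p : Pt) : ℝ := 1 - cosTheta p ^ 2

theorem sinSq_mul_rad_sq (hr : 0 < rad p) : sinSq p * rad p ^ 2 = p 1 ^ 2 + p 2 ^ 2 := by
  unfold sinSq cosTheta
  field_simp
  linarith [rad_sq p]

theorem cosTheta_mul_rad (hr : 0 < rad p) : cosTheta p * rad p = p 3 :=
  div_mul_cancel₀ _ hr.ne'

/-- The vector `u⁰ ∂_t + u¹ ∂_r + u² sin θ ∂_θ + u³ ∂_φ` at `p`. The factor `sin θ` makes the four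
commuting fields smooth across the axis. -/
def sph (p : Pt) (u : Fin 4 → ℝ) : Fin 4 → ℝ :=
  let f := u 1 / rad p + u 2 * cosTheta p
  ![u 0, f * p 1 - u 3 * p 2, f * p 2 + u 3 * p 1, f * p 3 - u 2 * rad p]

theorem dT_sph (p : Pt) (u : Fin 4 → ℝ) : dT p ⬝ᵥ sph p u = u 0 := by
  simp [dT, sph, dotProduct, Fin.sum_univ_four]

theorem dR_sph (hr : 0 < rad p) (u : Fin 4 → ℝ) : dR p ⬝ᵥ sph p u = u 1 := by
  have hradSq := rad_sq p
  have hcos := cosTheta_mul_rad hr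
  simp only [dR, sph, dotProduct, Fin.sum_univ_four, Matrix.cons_val]
  field_simp
  grind

theorem sinSqDPhi_sph (hr : 0 < rad p) (u : Fin 4 → ℝ) :
    sinSqDPhi p ⬝ᵥ sph p u = sinSq p * u 3 := by
  have hsin := sinSq_mul_rad_sq hr
  simp only [sinSqDPhi, sph, dotProduct, Fin.sum_univ_four, Matrix.cons_val]
  field_simp
  grind

theorem dCosTheta_sph (hr : 0 < rad p) (u : Fin 4 → ℝ) :
    dCosTheta p ⬝ᵥ sph p u = -(sinSq p * u 2) := by
  have hradSq := rad_sq p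
  have hsin := sinSq_mul_rad_sq hr
  simp only [dCosTheta, sph, dotProduct, Fin.sum_univ_four, Matrix.cons_val]
  field_simp
  grind

theorem sph_spatial (hr : 0 < rad p) (u v : Fin 4 → ℝ) :
    sph p u 1 * sph p v 1 + sph p u 2 * sph p v 2 + sph p u 3 * sph p v 3 =
      u 1 * v 1 + rad p ^ 2 * sinSq p * (u 2 * v 2 + u 3 * v 3) := by
  have hradSq := rad_sq p
  have hsin := sinSq_mul_rad_sq hr
  have hcos := cosTheta_mul_rad hr
  simp only [sph, Matrix.cons_val]
  field_simp
  grind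

theorem contDiffAt_coord {n : WithTop ℕ∞} (i : Fin 4) : ContDiffAt ℝ n (fun q : Pt => q i) p :=
  contDiffAt_apply (𝕜 := ℝ) (E := ℝ) i p

theorem contDiffAt_rad {n : WithTop ℕ∞} (hr : 0 < rad p) : ContDiffAt ℝ n rad p := by
  have h : p 1 ^ 2 + p 2 ^ 2 + p 3 ^ 2 ≠ 0 := by rw [← rad_sq]; positivity
  exact ((((contDiffAt_coord 1).pow 2).add ((contDiffAt_coord 2).pow 2)).add
    ((contDiffAt_coord 3).pow 2)).sqrt h

theorem contDiffAt_cosTheta {n : WithTop ℕ∞} (hr : 0 < rad p) : ContDiffAt ℝ n cosTheta p :=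
  (contDiffAt_coord 3).div (contDiffAt_rad hr) hr.ne'

theorem differentiableAt_rad (hr : 0 < rad p) : DifferentiableAt ℝ rad p :=
  (contDiffAt_rad (n := 1) hr).differentiableAt one_ne_zero

theorem differentiableAt_cosTheta (hr : 0 < rad p) : DifferentiableAt ℝ cosTheta p :=
  (contDiffAt_cosTheta (n := 1) hr).differentiableAt one_ne_zero

theorem fderiv_rad (hr : 0 < rad p) (v : Fin 4 → ℝ) : fderiv ℝ rad p v = dR p ⬝ᵥ v := by
  have h : p 1 ^ 2 + p 2 ^ 2 + p 3 ^ 2 ≠ 0 := by rw [← rad_sq]; positivity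
  have hx (i : Fin 4) := hasFDerivAt_apply (𝕜 := ℝ) (F' := fun _ : Fin 4 => ℝ) i p
  have hrad : HasFDerivAt rad _ p := ((((hx 1).pow 2).add ((hx 2).pow 2)).add ((hx 3).pow 2)).sqrt h
  have hs : √(p 1 ^ 2 + p 2 ^ 2 + p 3 ^ 2) = rad p := rfl
  simp only [hrad.fderiv, Pi.add_apply, hs, one_div, mul_inv_rev, Nat.add_one_sub_one, pow_one,
    nsmul_eq_mul, Nat.cast_ofNat, smul_add, add_apply, smul_apply, ContinuousLinearMap.proj_apply,
    smul_eq_mul, dotProduct, dR, Fin.sum_univ_four, zero_mul, zero_add, Matrix.cons_val]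
  field_simp

theorem fderiv_cosTheta (hr : 0 < rad p) (v : Fin 4 → ℝ) :
    fderiv ℝ cosTheta p v = dCosTheta p ⬝ᵥ v := by
  have h : HasFDerivAt cosTheta _ p := (hasFDerivAt_apply 3 p).mul
    ((hasDerivAt_inv hr.ne').comp_hasFDerivAt p (differentiableAt_rad hr).hasFDerivAt)
  simp only [h.fderiv, neg_smul, smul_neg, add_apply, neg_apply, smul_apply, fderiv_rad hr,
    dotProduct, dR, Fin.sum_univ_four, zero_mul, zero_add, Matrix.cons_val, smul_eq_mul,
    ContinuousLinearMap.proj_apply, dCosTheta, one_div]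
  field_simp
  ring

theorem fderiv_rad_sph (hr : 0 < rad p) (u : Fin 4 → ℝ) : fderiv ℝ rad p (sph p u) = u 1 := by
  rw [fderiv_rad hr, dR_sph hr]

theorem fderiv_cosTheta_sph (hr : 0 < rad p) (u : Fin 4 → ℝ) :
    fderiv ℝ cosTheta p (sph p u) = -(sinSq p * u 2) := by
  rw [fderiv_cosTheta hr, dCosTheta_sph hr]

theorem contDiffAt_sph {n : WithTop ℕ∞} {u : Pt → Fin 4 → ℝ} (hr : 0 < rad p)
    (hu : ContDiffAt ℝ n u p) : ContDiffAt ℝ n (fun q => sph q (u q)) p := by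
  have hx (i : Fin 4) := contDiffAt_coord (p := p) (n := n) i
  have hu' := contDiffAt_pi.1 hu
  have hf := ((hu' 1).div (contDiffAt_rad hr) hr.ne').add ((hu' 2).mul (contDiffAt_cosTheta hr))
  refine contDiffAt_pi.2 fun i => ?_
  fin_cases i
  exacts [hu' 0, (hf.mul (hx 1)).sub ((hu' 3).mul (hx 2)),
    (hf.mul (hx 2)).add ((hu' 3).mul (hx 1)), (hf.mul (hx 3)).sub ((hu' 2).mul (contDiffAt_rad hr))]

theorem fderiv_sph (hr : 0 < rad p) {u : Pt → Fin 4 → ℝ} (hu : DifferentiableAt ℝ u p)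
    (v : Fin 4 → ℝ) :
    fderiv ℝ (fun q => sph q (u q)) p v = sph p (fderiv ℝ u p v)
      + (u p 2 * (dCosTheta p ⬝ᵥ v) - u p 1 * (dR p ⬝ᵥ v) / rad p ^ 2) • ![0, p 1, p 2, p 3]
      + (u p 1 / rad p + u p 2 * cosTheta p) • ![0, v 1, v 2, v 3]
      + ![0, -(u p 3 * v 2), u p 3 * v 1, -(u p 2 * (dR p ⬝ᵥ v))] := by
  have hrad := (differentiableAt_rad hr).hasFDerivAt
  have hx (i : Fin 4) := hasFDerivAt_apply (𝕜 := ℝ) (F' := fun _ : Fin 4 => ℝ) i p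
  have hu' := hasFDerivAt_pi'.1 hu.hasFDerivAt
  have hf := ((hu' 1).mul ((hasDerivAt_inv hr.ne').comp_hasFDerivAt p hrad)).add
    ((hu' 2).mul (differentiableAt_cosTheta hr).hasFDerivAt)
  have h1 : HasFDerivAt (fun q => sph q (u q) 1) _ p := (hf.mul (hx 1)).sub ((hu' 3).mul (hx 2))
  have h2 : HasFDerivAt (fun q => sph q (u q) 2) _ p := (hf.mul (hx 2)).add ((hu' 3).mul (hx 1))
  have h3 : HasFDerivAt (fun q => sph q (u q) 3) _ p := (hf.mul (hx 3)).sub ((hu' 2).mul hrad)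
  have h : DifferentiableAt ℝ (fun q => sph q (u q)) p :=
    differentiableAt_pi.2 (Fin.forall_fin_succ.2 ⟨(hu' 0).differentiableAt, Fin.forall_fin_succ.2
      ⟨h1.differentiableAt, Fin.forall_fin_two.2 ⟨h2.differentiableAt, h3.differentiableAt⟩⟩⟩)
  ext i
  refine (DFunLike.congr_fun (fderiv_apply h i) v).symm.trans ?_
  fin_cases i
  · exact (DFunLike.congr_fun (hu' 0).fderiv v).trans (by simp [sph])
  · refine (DFunLike.congr_fun h1.fderiv v).trans ?_
    simp [sph, fderiv_rad hr, fderiv_cosTheta hr]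
    ring
  · refine (DFunLike.congr_fun h2.fderiv v).trans ?_
    simp [sph, fderiv_rad hr, fderiv_cosTheta hr]
    ring
  · refine (DFunLike.congr_fun h3.fderiv v).trans ?_
    simp [sph, fderiv_rad hr, fderiv_cosTheta hr]
    ring

theorem lieBracket_sph (hr : 0 < rad p) {u v : Pt → Fin 4 → ℝ} (hu : DifferentiableAt ℝ u p)
    (hv : DifferentiableAt ℝ v p) :
    lieBracket ℝ (fun q => sph q (u q)) (fun q => sph q (v q)) p
      = sph p (fderiv ℝ v p (sph p (u p)) - fderiv ℝ u p (sph p (v p))) := by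
  rw [lieBracket, fderiv_sph hr hu, fderiv_sph hr hv]
  simp only [dR_sph hr, dCosTheta_sph hr]
  ext i
  fin_cases i <;> simp [sph, sinSq] <;> field_simp <;> ring

/-! ### The metric in the frame -/

/-- The value `θ(u, v)` of a bilinear form given by its components. -/
def bilin (θ : Fin 4 → Fin 4 → ℝ) (u v : Fin 4 → ℝ) : ℝ := ∑ i, ∑ j, θ i j * u i * v j

/-- Carter's form `dt - a sin² θ dφ`, evaluated on `sph p u`. -/
def carterT (a : ℝ) (p : Pt) (u : Fin 4 → ℝ) : ℝ := u 0 - a * sinSq p * u 3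

/-- Carter's form `(r² + a²) dφ - a dt`, evaluated on `sph p u`. -/
def carterPhi (a : ℝ) (p : Pt) (u : Fin 4 → ℝ) : ℝ := (rad p ^ 2 + a ^ 2) * u 3 - a * u 0

theorem inner4_eq_dotProduct (M a : ℝ) (p : Pt) (u v : Fin 4 → ℝ) :
    inner4 M a p u v =
      -(1 - 2 * M * rad p / bigSigma a p) * ((dT p ⬝ᵥ u) * (dT p ⬝ᵥ v))
      + ((dT p ⬝ᵥ u) * (dR p ⬝ᵥ v) + (dR p ⬝ᵥ u) * (dT p ⬝ᵥ v))
      + bigSigma a p * ((u 1 * v 1 + u 2 * v 2 + u 3 * v 3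
          - (dR p ⬝ᵥ u) * (dR p ⬝ᵥ v)) / rad p ^ 2)
      + a ^ 2 * (1 + 2 * M * rad p / bigSigma a p)
          * ((sinSqDPhi p ⬝ᵥ u) * (sinSqDPhi p ⬝ᵥ v))
      - a * ((dR p ⬝ᵥ u) * (sinSqDPhi p ⬝ᵥ v) + (sinSqDPhi p ⬝ᵥ u) * (dR p ⬝ᵥ v))
      - 2 * a * M * rad p / bigSigma a p
          * ((dT p ⬝ᵥ u) * (sinSqDPhi p ⬝ᵥ v) + (sinSqDPhi p ⬝ᵥ u) * (dT p ⬝ᵥ v)) := by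
  simp only [inner4, metric, neg_sub, roundMetric, Fin.isValue, ne_eq, Matrix.of_apply,
    Fin.sum_univ_four, and_not_self, ↓reduceIte, zero_sub, zero_ne_one, not_true_eq_false,
    and_self, Fin.reduceEq, one_ne_zero, not_false_eq_true, and_true, dotProduct]
  ring

theorem inner4_sph (ha : |a| ≤ M) (hr : 0 < rad p) (u v : Fin 4 → ℝ) :
    inner4 M a p (sph p u) (sph p v) =
      carterT a p u * v 1 + u 1 * carterT a p v
      - bigDelta M a p / bigSigma a p * carterT a p u * carterT a p v
      + sinSq p * bigSigma a p * (u 2 * v 2)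
      + sinSq p / bigSigma a p * carterPhi a p u * carterPhi a p v := by
  have hS := bigSigma_pos a hr
  have hs : bigSigma a p = rad p ^ 2 + a ^ 2 * (1 - sinSq p) := by unfold bigSigma sinSq; ring
  rw [inner4_eq_dotProduct, sph_spatial hr, dR_sph hr, dR_sph hr, sinSqDPhi_sph hr,
    sinSqDPhi_sph hr, dT_sph, dT_sph, bigDelta_eq ha, carterT, carterT, carterPhi, carterPhi]
  field_simp
  grind

theorem bilin_eps_sph (hr : 0 < rad p) (u v : Fin 4 → ℝ) :
    bilin (eps a p) (sph p u) (sph p v) =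
      sinSq p * (u 2 * carterPhi a p v - carterPhi a p u * v 2) := by
  have hround : bilin (roundArea p) (sph p u) (sph p v)
      = sinSq p * (u 2 * v 3 - u 3 * v 2) := by
    have hradSq := rad_sq p
    have hsin := sinSq_mul_rad_sq hr
    simp only [bilin, roundArea, Matrix.of_apply, Matrix.cons_val', Matrix.cons_val_fin_one, sph,
      Fin.sum_univ_four, Matrix.cons_val, zero_div, zero_mul, add_zero, zero_add]
    field_simp
    grind
  have hsplit : bilin (eps a p) (sph p u) (sph p v)
      = (rad p ^ 2 + a ^ 2) * bilin (roundArea p) (sph p u) (sph p v)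
        + a * ((dCosTheta p ⬝ᵥ sph p u) * (dT p ⬝ᵥ sph p v)
          - (dT p ⬝ᵥ sph p u) * (dCosTheta p ⬝ᵥ sph p v)) := by
    simp only [bilin, eps, dotProduct, Fin.sum_univ_four]
    ring
  rw [hsplit, hround, dCosTheta_sph hr, dCosTheta_sph hr, dT_sph, dT_sph, carterPhi, carterPhi]
  ring

/-- The horizontal fields `sin θ ∂_θ` and `a sin² θ ∂_t + ∂_φ`: orthogonal, of common squared
length `frameNorm`, and commuting with `e₃` and `Σ e₄`. -/
def horField (a : ℝ) (A : Fin 2) : VecField := fun p =>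
  sph p ((![![0, 0, 1, 0], ![a * sinSq p, 0, 0, 1]] : Fin 2 → Fin 4 → ℝ) A)

/-- The common squared length `Σ sin² θ` of the two fields `horField`. -/
def frameNorm (a : ℝ) (p : Pt) : ℝ := bigSigma a p * sinSq p

theorem e3_eq_sph (p : Pt) : e3 p = sph p ![0, -1, 0, 0] := by
  ext i
  fin_cases i <;> simp [e3, sph] <;> ring

theorem e4_eq_sph (M a : ℝ) (p : Pt) : e4 M a p =
    sph p ((bigSigma a p)⁻¹ • ![2 * (rad p ^ 2 + a ^ 2), bigDelta M a p, 0, 2 * a]) := by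
  ext i
  fin_cases i <;> simp [e4, sph] <;> ring

theorem inner4_horField (ha : |a| ≤ M) (hr : 0 < rad p) (A B : Fin 2) :
    inner4 M a p (horField a A p) (horField a B p) = if A = B then frameNorm a p else 0 := by
  have hS := bigSigma_pos a hr
  have hs : bigSigma a p = rad p ^ 2 + a ^ 2 * (1 - sinSq p) := by unfold bigSigma sinSq; ring
  rw [horField, horField, inner4_sph ha hr]
  fin_cases A <;> fin_cases B <;> simp [carterT, carterPhi, frameNorm]
  · ring
  · field_simp
    rw [hs]
    ring

theorem inner4_e3_sph (ha : |a| ≤ M) (hr : 0 < rad p) (u : Fin 4 → ℝ) :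
    inner4 M a p (e3 p) (sph p u) = -carterT a p u := by
  rw [e3_eq_sph, inner4_sph ha hr]
  simp [carterT, carterPhi]

theorem inner4_e4_sph (ha : |a| ≤ M) (hr : 0 < rad p) (u : Fin 4 → ℝ) :
    inner4 M a p (e4 M a p) (sph p u)
      = 2 * u 1 - bigDelta M a p / bigSigma a p * carterT a p u := by
  have hS := bigSigma_pos a hr
  have hs : bigSigma a p = rad p ^ 2 + a ^ 2 * (1 - sinSq p) := by unfold bigSigma sinSq; ring
  rw [e4_eq_sph, inner4_sph ha hr]
  simp [carterT, carterPhi]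
  grind

theorem inner4_e3_horField (ha : |a| ≤ M) (hr : 0 < rad p) (A : Fin 2) :
    inner4 M a p (e3 p) (horField a A p) = 0 := by
  rw [horField, inner4_e3_sph ha hr]
  fin_cases A <;> simp [carterT]

theorem inner4_e4_horField (ha : |a| ≤ M) (hr : 0 < rad p) (A : Fin 2) :
    inner4 M a p (e4 M a p) (horField a A p) = 0 := by
  rw [horField, inner4_e4_sph ha hr]
  fin_cases A <;> simp [carterT]

/-- The inverse metric of the horizontal distribution, written so as to be smooth across the
axis: `Σ⁻¹ (∂_θ² + sin⁻² θ ∂_φ² + a (∂_t ∂_φ + ∂_φ ∂_t) + a² sin² θ ∂_t²)`. -/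
def horInv (a : ℝ) (p : Pt) : Matrix (Fin 4) (Fin 4) ℝ := Matrix.of fun i j =>
  (rad p ^ 2 * ((if i = j ∧ i ≠ 0 then 1 else 0) - dR p i * dR p j)
    + a * (dT p i * sph p ![0, 0, 0, 1] j + sph p ![0, 0, 0, 1] i * dT p j)
    + a ^ 2 * sinSq p * (dT p i * dT p j)) / bigSigma a p

theorem metric_mul_horInv_sub (ha : |a| ≤ M) (hr : 0 < rad p) :
    metric M a p * Matrix.of (fun i j =>
      horInv a p i j - (1 / 2) * (e3 p i * e4 M a p j + e4 M a p i * e3 p j)) = 1 := by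
  have hradSq := rad_sq p
  have hcos := cosTheta_mul_rad hr
  have hS := bigSigma_pos a hr
  have hSr : bigSigma a p = rad p ^ 2 + a ^ 2 * cosTheta p ^ 2 := rfl
  ext i j
  simp only [Matrix.mul_apply, Fin.sum_univ_four, metric, roundMetric, horInv, e3, e4,
    Matrix.of_apply, bigDelta_eq ha, sinSq]
  fin_cases i <;> fin_cases j <;> simp only [neg_sub, dT, Fin.zero_eta, Fin.isValue,
    Matrix.cons_val_zero, mul_one, dR, mul_zero, add_zero, ne_eq, not_true_eq_false, and_false,
    ↓reduceIte, sub_self, zero_div, sinSqDPhi, sub_zero, sph, Matrix.cons_val_one,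
    Matrix.cons_val, zero_mul, one_mul, zero_sub, zero_add, one_div, Nat.succ_eq_add_one,
    Nat.reduceAdd, Matrix.smul_cons, smul_eq_mul, Matrix.smul_empty, Matrix.add_cons,
    Matrix.head_cons, Matrix.tail_cons, Matrix.empty_add_empty, mul_neg, Pi.smul_apply,
    zero_ne_one, and_self, one_ne_zero, not_false_eq_true, and_true, neg_mul, sub_neg_eq_add,
    Fin.reduceEq, Matrix.one_apply_eq, Fin.mk_one, neg_zero, Matrix.one_apply_ne, Fin.reduceFinMk]
  all_goals (field_simp; try grind)

theorem metricInv_eq (ha : |a| ≤ M) (hr : 0 < rad p) (i j : Fin 4) :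
    metricInv M a p i j
      = horInv a p i j - (1 / 2) * (e3 p i * e4 M a p j + e4 M a p i * e3 p j) := by
  rw [metricInv, Matrix.inv_eq_right_inv (metric_mul_horInv_sub ha hr), Matrix.of_apply]

theorem metric_mul_metricInv (ha : |a| ≤ M) (hr : 0 < rad p) :
    metric M a p * metricInv M a p = 1 :=
  Matrix.mul_nonsing_inv _ (Matrix.isUnit_det_of_right_inverse (metric_mul_horInv_sub ha hr))

theorem hInv_eq_horInv (ha : |a| ≤ M) (hr : 0 < rad p) (i j : Fin 4) :
    hInv M a p i j = horInv a p i j := by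
  rw [hInv, metricInv_eq ha hr]
  ring

theorem frameNorm_mul_hInv (ha : |a| ≤ M) (hr : 0 < rad p) (i j : Fin 4) :
    frameNorm a p * hInv M a p i j = ∑ A, horField a A p i * horField a A p j := by
  have hradSq := rad_sq p
  have hcos := cosTheta_mul_rad hr
  have hS := bigSigma_pos a hr
  rw [hInv_eq_horInv ha hr]
  simp only [Fin.sum_univ_two, horField, horInv, frameNorm, sinSq, Matrix.of_apply]
  fin_cases i <;> fin_cases j <;> simp only [Fin.zero_eta, Fin.isValue, ne_eq, not_true_eq_false,
    and_false, ↓reduceIte, dR, Matrix.cons_val_zero, mul_zero, sub_self, dT, sph,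
    Matrix.cons_val_one, zero_div, Matrix.cons_val, zero_mul, add_zero, one_mul, zero_sub,
    zero_add, mul_one, Matrix.cons_val', Matrix.cons_val_fin_one, sub_zero, Fin.mk_one,
    zero_ne_one, and_self, mul_neg, Fin.reduceFinMk, Fin.reduceEq, one_ne_zero, not_false_eq_true,
    and_true, neg_mul, neg_zero, neg_neg]
  all_goals (field_simp; try grind)

/-! ### The Levi-Civita connection -/

theorem contDiffAt_bigSigma {n : WithTop ℕ∞} (a : ℝ) (hr : 0 < rad p) :
    ContDiffAt ℝ n (bigSigma a) p :=
  ((contDiffAt_rad hr).pow 2).add (contDiffAt_const.mul ((contDiffAt_cosTheta hr).pow 2))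

theorem contDiffAt_bigDelta {n : WithTop ℕ∞} (M a : ℝ) (hr : 0 < rad p) :
    ContDiffAt ℝ n (bigDelta M a) p :=
  ((contDiffAt_rad hr).sub contDiffAt_const).mul ((contDiffAt_rad hr).sub contDiffAt_const)

theorem contDiffAt_dR {n : WithTop ℕ∞} (hr : 0 < rad p) (i : Fin 4) :
    ContDiffAt ℝ n (fun q => dR q i) p := by
  fin_cases i
  · exact contDiffAt_const
  all_goals exact (contDiffAt_coord _).div (contDiffAt_rad hr) hr.ne'

theorem contDiffAt_sinSqDPhi {n : WithTop ℕ∞} (hr : 0 < rad p) (i : Fin 4) :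
    ContDiffAt ℝ n (fun q => sinSqDPhi q i) p := by
  have h2 : rad p ^ 2 ≠ 0 := by positivity
  fin_cases i
  · exact contDiffAt_const
  · exact (contDiffAt_coord _).neg.div ((contDiffAt_rad hr).pow 2) h2
  · exact (contDiffAt_coord _).div ((contDiffAt_rad hr).pow 2) h2
  · exact contDiffAt_const

theorem contDiffAt_metric {n : WithTop ℕ∞} (M a : ℝ) (hr : 0 < rad p) (i j : Fin 4) :
    ContDiffAt ℝ n (fun q => metric M a q i j) p := by
  have hrad := contDiffAt_rad (n := n) hr
  have hS := contDiffAt_bigSigma (n := n) a hr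
  have hS0 := (bigSigma_pos a hr).ne'
  have hT (i : Fin 4) : ContDiffAt ℝ n (fun q => dT q i) p := contDiffAt_const
  have hR := contDiffAt_dR (n := n) hr
  have hF := contDiffAt_sinSqDPhi (n := n) hr
  have h3 : ContDiffAt ℝ n (fun q => 2 * M * rad q / bigSigma a q) p :=
    (contDiffAt_const.mul hrad).div hS hS0
  have h4 : ContDiffAt ℝ n (fun q => 2 * a * M * rad q / bigSigma a q) p :=
    (contDiffAt_const.mul hrad).div hS hS0
  have hround : ContDiffAt ℝ n (fun q => roundMetric q i j) p :=
    (contDiffAt_const.sub ((hR i).mul (hR j))).div (hrad.pow 2) (by positivity)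
  exact ((((((contDiffAt_const.sub h3).neg.mul ((hT i).mul (hT j))).add
    (((hT i).mul (hR j)).add ((hR i).mul (hT j)))).add (hS.mul hround)).add
    ((contDiffAt_const.mul (contDiffAt_const.add h3)).mul ((hF i).mul (hF j)))).sub
    (contDiffAt_const.mul (((hR i).mul (hF j)).add ((hF i).mul (hR j))))).sub
    (h4.mul (((hT i).mul (hF j)).add ((hF i).mul (hT j))))

/-- The part of the exterior off the horizon and off the rotation axis. -/
def region (M a : ℝ) : Set Pt := {p | rPlus M a < rad p ∧ 0 < p 1 ^ 2 + p 2 ^ 2}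

theorem continuous_rad : Continuous rad := by unfold rad; fun_prop

theorem isOpen_region (M a : ℝ) : IsOpen (region M a) :=
  (isOpen_lt continuous_const continuous_rad).inter
    (isOpen_lt continuous_const (by fun_prop : Continuous fun p : Pt => p 1 ^ 2 + p 2 ^ 2))

theorem region_subset_exterior (M a : ℝ) : region M a ⊆ exterior M a := fun _ h => h.1.le

theorem rad_pos_of_mem_region (hp : p ∈ region M a) : 0 < rad p :=
  Real.sqrt_pos.2 (by nlinarith [hp.2, sq_nonneg (p 3)])

theorem sinSq_pos_of_mem_region (hp : p ∈ region M a) : 0 < sinSq p := by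
  have hr := rad_pos_of_mem_region hp
  have h := sinSq_mul_rad_sq hr ▸ hp.2
  exact pos_of_mul_pos_left h (by positivity)

theorem frameNorm_pos (hp : p ∈ region M a) : 0 < frameNorm a p :=
  mul_pos (bigSigma_pos a (rad_pos_of_mem_region hp)) (sinSq_pos_of_mem_region hp)

theorem sum_mul_pd (hp : p ∈ region M a) (v : Fin 4 → ℝ) (f : Pt → ℝ) :
    ∑ i, v i * pd M a i f p = fderiv ℝ f p v := by
  have hpd : fderivWithin ℝ f (exterior M a) p = fderiv ℝ f p :=
    fderivWithin_of_mem_nhds (Filter.mem_of_superset ((isOpen_region M a).mem_nhds hp)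
      (region_subset_exterior M a))
  conv_rhs => rw [pi_eq_sum_univ' v]
  simp only [pd, hpd, map_sum, map_smul, smul_eq_mul]

theorem fderiv_comp_apply {Y : Pt → Fin 4 → ℝ} (hY : DifferentiableAt ℝ Y p) (v : Fin 4 → ℝ)
    (k : Fin 4) : fderiv ℝ (fun q => Y q k) p v = fderiv ℝ Y p v k := by
  rw [fderiv_apply hY]
  rfl

theorem differentiableAt_dotProduct {u v : Pt → Fin 4 → ℝ} (hu : DifferentiableAt ℝ u p)
    (hv : DifferentiableAt ℝ v p) : DifferentiableAt ℝ (fun q => u q ⬝ᵥ v q) p :=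
  .fun_sum fun i _ => (differentiableAt_pi.1 hu i).mul (differentiableAt_pi.1 hv i)

theorem fderiv_dotProduct {u v : Pt → Fin 4 → ℝ} (hu : DifferentiableAt ℝ u p)
    (hv : DifferentiableAt ℝ v p) (w : Fin 4 → ℝ) :
    fderiv ℝ (fun q => u q ⬝ᵥ v q) p w = fderiv ℝ u p w ⬝ᵥ v p + u p ⬝ᵥ fderiv ℝ v p w := by
  have hu' := hasFDerivAt_pi'.1 hu.hasFDerivAt
  have hv' := hasFDerivAt_pi'.1 hv.hasFDerivAt
  have h := HasFDerivAt.fun_sum (u := Finset.univ) fun i _ => (hu' i).mul (hv' i)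
  refine (DFunLike.congr_fun h.fderiv w).trans ?_
  simp only [dotProduct, ← Finset.sum_add_distrib, sum_apply]
  refine Finset.sum_congr rfl fun i _ => ?_
  simp only [add_apply, smul_apply, ContinuousLinearMap.comp_apply, ContinuousLinearMap.proj_apply,
    smul_eq_mul]
  ring

theorem bilin_eq_dotProduct (θ : Fin 4 → Fin 4 → ℝ) (u v : Fin 4 → ℝ) :
    bilin θ u v = u ⬝ᵥ (Matrix.of θ *ᵥ v) := by
  simp only [bilin, dotProduct, Matrix.mulVec, Matrix.of_apply, Finset.mul_sum]
  exact Finset.sum_congr rfl fun _ _ => Finset.sum_congr rfl fun _ _ => by ring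

theorem inner4_eq_mulVec (M a : ℝ) (p : Pt) (u v : Fin 4 → ℝ) :
    inner4 M a p u v = u ⬝ᵥ (metric M a p *ᵥ v) :=
  bilin_eq_dotProduct (metric M a p) u v

theorem metric_comm (M a : ℝ) (p : Pt) (i j : Fin 4) : metric M a p i j = metric M a p j i := by
  simp only [metric, Matrix.of_apply, roundMetric, eq_comm (a := i) (b := j)]
  by_cases h : j = i
  · subst h; ring
  · simp only [h, false_and, if_false]; ring

theorem inner4_comm (M a : ℝ) (p : Pt) (u v : Fin 4 → ℝ) :
    inner4 M a p u v = inner4 M a p v u := by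
  rw [inner4, inner4, Finset.sum_comm]
  exact Finset.sum_congr rfl fun i _ => Finset.sum_congr rfl fun j _ => by
    rw [metric_comm]; ring

theorem inner4_add_left (M a : ℝ) (p : Pt) (u v w : Fin 4 → ℝ) :
    inner4 M a p (u + v) w = inner4 M a p u w + inner4 M a p v w := by
  simp only [inner4_eq_mulVec, add_dotProduct]

theorem inner4_sub_left (M a : ℝ) (p : Pt) (u v w : Fin 4 → ℝ) :
    inner4 M a p (u - v) w = inner4 M a p u w - inner4 M a p v w := by
  simp only [inner4_eq_mulVec, sub_dotProduct]

theorem inner4_smul_left (M a : ℝ) (p : Pt) (c : ℝ) (u v : Fin 4 → ℝ) :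
    inner4 M a p (c • u) v = c * inner4 M a p u v := by
  simp only [inner4_eq_mulVec, smul_dotProduct, smul_eq_mul]

theorem inner4_zero_left (M a : ℝ) (p : Pt) (v : Fin 4 → ℝ) : inner4 M a p 0 v = 0 := by
  rw [inner4_eq_mulVec, zero_dotProduct]

/-- The matrix `vⁱ Γᵏᵢⱼ` of the Levi-Civita connection in the direction `v`. -/
def connMatrix (M a : ℝ) (p : Pt) (v : Fin 4 → ℝ) : Matrix (Fin 4) (Fin 4) ℝ :=
  Matrix.of fun k j => ∑ i, v i * christoffel M a k i j p

theorem covAlong_eq (hp : p ∈ region M a) (X : VecField) {Y : VecField}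
    (hY : DifferentiableAt ℝ Y p) :
    covAlong M a X Y p = fderiv ℝ Y p (X p) + connMatrix M a p (X p) *ᵥ Y p := by
  ext k
  simp only [covAlong, covVec, mul_add, Finset.sum_add_distrib, sum_mul_pd hp,
    fderiv_comp_apply hY, Pi.add_apply, Matrix.mulVec, dotProduct, connMatrix, Matrix.of_apply,
    Finset.mul_sum, Finset.sum_mul]
  rw [Finset.sum_comm]
  simp only [mul_assoc]

theorem christoffel_comm (M a : ℝ) (k i j : Fin 4) (p : Pt) :
    christoffel M a k i j p = christoffel M a k j i p := by
  have h : (fun q => metric M a q i j) = fun q => metric M a q j i :=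
    funext fun q => metric_comm M a q i j
  simp only [christoffel, h]
  exact congrArg _ (Finset.sum_congr rfl fun l _ => by ring)

theorem connMatrix_mulVec_comm (M a : ℝ) (p : Pt) (u v : Fin 4 → ℝ) :
    connMatrix M a p u *ᵥ v = connMatrix M a p v *ᵥ u := by
  ext k
  simp only [Matrix.mulVec, dotProduct, connMatrix, Matrix.of_apply, Finset.sum_mul]
  rw [Finset.sum_comm]
  refine Finset.sum_congr rfl fun i _ => Finset.sum_congr rfl fun j _ => ?_
  rw [christoffel_comm]
  ring

theorem covAlong_sub_covAlong (hp : p ∈ region M a) {X Y : VecField}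
    (hX : DifferentiableAt ℝ X p) (hY : DifferentiableAt ℝ Y p) :
    covAlong M a X Y p - covAlong M a Y X p = lieBracket ℝ X Y p := by
  rw [covAlong_eq hp X hY, covAlong_eq hp Y hX, connMatrix_mulVec_comm M a p (Y p), lieBracket]
  abel

theorem metric_mul_christoffel (ha : |a| ≤ M) (hr : 0 < rad p) (l i j : Fin 4) :
    ∑ k, metric M a p l k * christoffel M a k i j p =
      (1 / 2) * (pd M a i (fun q => metric M a q j l) p + pd M a j (fun q => metric M a q i l) p
        - pd M a l (fun q => metric M a q i j) p) := by
  set w : Fin 4 → ℝ := fun l => pd M a i (fun q => metric M a q j l) p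
    + pd M a j (fun q => metric M a q i l) p - pd M a l (fun q => metric M a q i j) p
  have hchr : (fun k => christoffel M a k i j p) = metricInv M a p *ᵥ ((1 / 2 : ℝ) • w) := by
    rw [Matrix.mulVec_smul]
    rfl
  have h : metric M a p *ᵥ (fun k => christoffel M a k i j p) = (1 / 2 : ℝ) • w := by
    rw [hchr, Matrix.mulVec_mulVec, metric_mul_metricInv ha hr, Matrix.one_mulVec]
  exact congrFun h l

theorem pd_metric (ha : |a| ≤ M) (hr : 0 < rad p) (i j l : Fin 4) :
    pd M a i (fun q => metric M a q j l) p
      = ∑ k, metric M a p j k * christoffel M a k i l p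
        + ∑ k, metric M a p l k * christoffel M a k i j p := by
  have hsym (i j : Fin 4) : (fun q => metric M a q i j) = fun q => metric M a q j i :=
    funext fun q => metric_comm M a q i j
  rw [metric_mul_christoffel ha hr, metric_mul_christoffel ha hr, hsym l j, hsym i j, hsym i l]
  ring

theorem fderiv_metric (ha : |a| ≤ M) (hp : p ∈ region M a) (v : Fin 4 → ℝ) (j l : Fin 4) :
    fderiv ℝ (fun q => metric M a q j l) p v
      = (metric M a p * connMatrix M a p v) j l + (metric M a p * connMatrix M a p v) l j := by
  have h (j l : Fin 4) : (metric M a p * connMatrix M a p v) j l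
      = ∑ i, v i * ∑ k, metric M a p j k * christoffel M a k i l p := by
    simp only [Matrix.mul_apply, connMatrix, Matrix.of_apply, Finset.mul_sum]
    rw [Finset.sum_comm]
    exact Finset.sum_congr rfl fun _ _ => Finset.sum_congr rfl fun _ _ => by ring
  rw [← sum_mul_pd hp, h, h, ← Finset.sum_add_distrib]
  simp only [pd_metric ha (rad_pos_of_mem_region hp), mul_add]

theorem fderiv_inner4 (ha : |a| ≤ M) (hp : p ∈ region M a) (X : VecField) {Y Z : VecField}
    (hY : DifferentiableAt ℝ Y p) (hZ : DifferentiableAt ℝ Z p) :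
    fderiv ℝ (fun q => inner4 M a q (Y q) (Z q)) p (X p)
      = inner4 M a p (covAlong M a X Y p) (Z p) + inner4 M a p (Y p) (covAlong M a X Z p) := by
  set Γ := connMatrix M a p (X p)
  have hg (i j : Fin 4) : DifferentiableAt ℝ (fun q => metric M a q i j) p :=
    (contDiffAt_metric (n := 1) M a (rad_pos_of_mem_region hp) i j).differentiableAt one_ne_zero
  have hgZ (i : Fin 4) : fderiv ℝ (fun q => (metric M a q *ᵥ Z q) i) p (X p)
      = ((metric M a p * Γ) *ᵥ Z p + (metric M a p * Γ)ᵀ *ᵥ Z p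
        + metric M a p *ᵥ fderiv ℝ Z p (X p)) i := by
    rw [show (fun q => (metric M a q *ᵥ Z q) i) = fun q => metric M a q i ⬝ᵥ Z q from rfl,
      fderiv_dotProduct (differentiableAt_pi.2 (hg i)) hZ, ← Matrix.add_mulVec]
    congr 2
    ext j
    rw [← fderiv_comp_apply (differentiableAt_pi.2 (hg i)), fderiv_metric ha hp]
    rfl
  have hgZd : DifferentiableAt ℝ (fun q => metric M a q *ᵥ Z q) p := differentiableAt_pi.2 fun i =>
    show DifferentiableAt ℝ (fun q => ∑ j, metric M a q i j * Z q j) p from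
      .fun_sum fun j _ => (hg i j).mul (differentiableAt_pi.1 hZ j)
  have hsym : (metric M a p)ᵀ = metric M a p := Matrix.ext fun i j => metric_comm M a p j i
  have hgZ' : fderiv ℝ (fun q => metric M a q *ᵥ Z q) p (X p) = _ :=
    funext fun i => (fderiv_comp_apply hgZd _ i).symm.trans (hgZ i)
  simp only [inner4_eq_mulVec]
  rw [fderiv_dotProduct hY hgZd, hgZ', covAlong_eq hp X hY, covAlong_eq hp X hZ]
  have hadj : Y p ⬝ᵥ ((metric M a p * Γ)ᵀ *ᵥ Z p) = (Γ *ᵥ Y p) ⬝ᵥ (metric M a p *ᵥ Z p) := by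
    rw [Matrix.transpose_mul, hsym, ← Matrix.mulVec_mulVec, Matrix.dotProduct_mulVec,
      Matrix.vecMul_transpose]
  simp only [dotProduct_add, add_dotProduct, Matrix.mulVec_add, hadj, Matrix.mulVec_mulVec]
  ring

theorem sum_covForm_eq (hp : p ∈ region M a) (X : VecField) {ς : OneForm} {Y : VecField}
    (hς : DifferentiableAt ℝ ς p) (hY : DifferentiableAt ℝ Y p) :
    (fun j => ∑ i, X p i * covForm M a ς p i j) ⬝ᵥ Y p
      = fderiv ℝ (fun q => ς q ⬝ᵥ Y q) p (X p) - ς p ⬝ᵥ covAlong M a X Y p := by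
  have h : (fun j => ∑ i, X p i * covForm M a ς p i j)
      = fderiv ℝ ς p (X p) - ς p ᵥ* connMatrix M a p (X p) := by
    ext j
    simp only [covForm, mul_sub, Finset.sum_sub_distrib, sum_mul_pd hp, fderiv_comp_apply hς,
      Pi.sub_apply, Matrix.vecMul, dotProduct, connMatrix, Matrix.of_apply, Finset.mul_sum]
    rw [Finset.sum_comm]
    exact congrArg _ (Finset.sum_congr rfl fun _ _ => Finset.sum_congr rfl fun _ _ => by ring)
  rw [h, fderiv_dotProduct hς hY, covAlong_eq hp X hY, sub_dotProduct, dotProduct_add,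
    Matrix.dotProduct_mulVec]
  ring

/-! ### Horizontal tensors in the frame -/

theorem inner4_e3_e3 (ha : |a| ≤ M) (hr : 0 < rad p) : inner4 M a p (e3 p) (e3 p) = 0 := by
  simpa [← e3_eq_sph, carterT] using inner4_e3_sph ha hr ![0, -1, 0, 0]

theorem inner4_e3_e4 (ha : |a| ≤ M) (hr : 0 < rad p) :
    inner4 M a p (e3 p) (e4 M a p) = -2 := by
  rw [inner4_comm, e3_eq_sph, inner4_e4_sph ha hr]
  simp [carterT]

theorem inner4_e4_e4 (ha : |a| ≤ M) (hr : 0 < rad p) :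
    inner4 M a p (e4 M a p) (e4 M a p) = 0 := by
  have hS := (bigSigma_pos a hr).ne'
  have hs : bigSigma a p = rad p ^ 2 + a ^ 2 * (1 - sinSq p) := by unfold bigSigma sinSq; ring
  conv_lhs => arg 5; rw [e4_eq_sph]
  rw [inner4_e4_sph ha hr]
  simp only [carterT, Matrix.smul_cons, smul_eq_mul, Matrix.cons_val]
  field_simp
  rw [hs]
  ring

theorem proj_mulVec (M a : ℝ) (p : Pt) (u : Fin 4 → ℝ) :
    Matrix.of (proj M a p) *ᵥ u
      = u + (1 / 2 : ℝ) •
        (inner4 M a p (e4 M a p) u • e3 p + inner4 M a p (e3 p) u • e4 M a p) := by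
  have hflat (V : VecField) : flat M a V p ⬝ᵥ u = inner4 M a p (V p) u := by
    simp only [inner4, flat, dotProduct, Finset.sum_mul]
    exact Finset.sum_comm
  ext i
  simp only [← hflat, Matrix.mulVec, proj, dotProduct, Matrix.of_apply, add_mul, ite_mul, one_mul,
    zero_mul, mul_add, Finset.sum_add_distrib, Finset.sum_ite_eq, Finset.mem_univ, if_true,
    Pi.add_apply, Pi.smul_apply, smul_eq_mul, Finset.sum_mul, Finset.mul_sum]
  congr 1
  congr 1 <;> exact Finset.sum_congr rfl fun _ _ => by ring

theorem proj_mulVec_horField (ha : |a| ≤ M) (hr : 0 < rad p) (A : Fin 2) :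
    Matrix.of (proj M a p) *ᵥ horField a A p = horField a A p := by
  rw [proj_mulVec, inner4_e3_horField ha hr, inner4_e4_horField ha hr]
  simp only [zero_smul, add_zero, smul_zero]

theorem proj_mulVec_e3 (ha : |a| ≤ M) (hr : 0 < rad p) : Matrix.of (proj M a p) *ᵥ e3 p = 0 := by
  rw [proj_mulVec, inner4_comm M a p (e4 M a p), inner4_e3_e4 ha hr, inner4_e3_e3 ha hr]
  module

theorem proj_mulVec_e4 (ha : |a| ≤ M) (hr : 0 < rad p) :
    Matrix.of (proj M a p) *ᵥ e4 M a p = 0 := by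
  rw [proj_mulVec, inner4_e3_e4 ha hr, inner4_e4_e4 ha hr]
  module

theorem proj_mulVec_eq_hInv_mulVec (ha : |a| ≤ M) (hr : 0 < rad p) (u : Fin 4 → ℝ) :
    Matrix.of (proj M a p) *ᵥ u = Matrix.of (hInv M a p) *ᵥ (metric M a p *ᵥ u) := by
  have h : metricInv M a p *ᵥ (metric M a p *ᵥ u) = u := by
    rw [Matrix.mulVec_mulVec, mul_eq_one_comm.1 (metric_mul_metricInv ha hr), Matrix.one_mulVec]
  rw [proj_mulVec, inner4_eq_mulVec, inner4_eq_mulVec]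
  nth_rw 1 [← h]
  ext i
  simp only [Matrix.mulVec, hInv, dotProduct, Matrix.of_apply, add_mul, Finset.sum_add_distrib,
    Pi.add_apply, Pi.smul_apply, smul_eq_mul, mul_add]
  congr 1
  simp only [Finset.sum_mul, Finset.mul_sum]
  congr 1 <;> exact Finset.sum_congr rfl fun _ _ => Finset.sum_congr rfl fun _ _ => by ring

theorem frameNorm_mul_sum_hInv (ha : |a| ≤ M) (hr : 0 < rad p) (θ : Fin 4 → Fin 4 → ℝ) :
    frameNorm a p * ∑ i, ∑ j, hInv M a p i j * θ i j
      = ∑ A, bilin θ (horField a A p) (horField a A p) := by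
  simp only [Finset.mul_sum, ← mul_assoc, frameNorm_mul_hInv ha hr, Finset.sum_mul, bilin]
  rw [Finset.sum_comm (s := .univ (α := Fin 2))]
  refine Finset.sum_congr rfl fun i _ => ?_
  rw [Finset.sum_comm]
  exact Finset.sum_congr rfl fun _ _ => Finset.sum_congr rfl fun _ _ => by ring

theorem frameNorm_mul_hTr (ha : |a| ≤ M) (hr : 0 < rad p) (θ : TwoTensor) :
    frameNorm a p * hTr M a θ p = ∑ A, bilin (θ p) (horField a A p) (horField a A p) :=
  frameNorm_mul_sum_hInv ha hr (θ p)

theorem bilin_mul_mul (v w x y : Fin 4 → ℝ) :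
    bilin (fun i j => v i * w j) x y = (v ⬝ᵥ x) * (w ⬝ᵥ y) := by
  simp only [bilin, dotProduct, Finset.sum_mul_sum]
  exact Finset.sum_congr rfl fun _ _ => Finset.sum_congr rfl fun _ _ => by ring

theorem frameNorm_mul_hDot (ha : |a| ≤ M) (hr : 0 < rad p) (ς τ : OneForm) :
    frameNorm a p * hDot M a ς τ p
      = ∑ A, (ς p ⬝ᵥ horField a A p) * (τ p ⬝ᵥ horField a A p) := by
  simp only [← bilin_mul_mul, ← frameNorm_mul_sum_hInv ha hr, hDot, mul_assoc]

theorem frameNorm_mul_sharpDot (ha : |a| ≤ M) (hr : 0 < rad p) (θ : TwoTensor) (ς : OneForm)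
    (v : Fin 4 → ℝ) :
    frameNorm a p * (sharpDot M a θ ς p ⬝ᵥ v)
      = ∑ A, bilin (θ p) v (horField a A p) * (ς p ⬝ᵥ horField a A p) := by
  have h (A : Fin 2) : bilin (θ p) v (horField a A p) * (ς p ⬝ᵥ horField a A p)
      = bilin (fun j k => ς p j * (v ᵥ* Matrix.of (θ p)) k) (horField a A p) (horField a A p) := by
    rw [bilin_mul_mul, bilin_eq_dotProduct, Matrix.dotProduct_mulVec, mul_comm]
  simp only [h, ← frameNorm_mul_sum_hInv ha hr]
  congr 1
  simp only [sharpDot, dotProduct, Matrix.vecMul, Matrix.of_apply, Finset.sum_mul, Finset.mul_sum]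
  rw [Finset.sum_comm]
  refine Finset.sum_congr rfl fun j _ => ?_
  rw [Finset.sum_comm]
  exact Finset.sum_congr rfl fun _ _ => Finset.sum_congr rfl fun _ _ => by ring

theorem hStar_eq_sharpDot (M a : ℝ) (ς : OneForm) : hStar M a ς = sharpDot M a (eps a) ς := by
  ext p i
  simp only [hStar, sharpDot, mul_comm (eps a p _ _)]

theorem bilin_eps_horField (a : ℝ) (hr : 0 < rad p) (A B : Fin 2) :
    bilin (eps a p) (horField a A p) (horField a B p)
      = frameNorm a p * !![0, 1; -1, 0] A B := by
  have hs : bigSigma a p = rad p ^ 2 + a ^ 2 * (1 - sinSq p) := by unfold bigSigma sinSq; ring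
  rw [horField, horField, bilin_eps_sph hr, frameNorm, hs]
  fin_cases A <;> fin_cases B <;> simp [carterPhi] <;> ring

theorem frameNorm_mul_epsUp (ha : |a| ≤ M) (hp : p ∈ region M a) (i j : Fin 4) :
    frameNorm a p * epsUp M a p i j
      = horField a 0 p i * horField a 1 p j - horField a 1 p i * horField a 0 p j := by
  have hr := rad_pos_of_mem_region hp
  have hN := (frameNorm_pos hp).ne'
  have h : frameNorm a p * (frameNorm a p * epsUp M a p i j)
      = ∑ A, ∑ B, horField a A p i * horField a B p j
        * bilin (eps a p) (horField a A p) (horField a B p) := by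
    have h' (k l : Fin 4) : frameNorm a p * (frameNorm a p
        * (hInv M a p i k * hInv M a p j l * eps a p k l))
        = (∑ A, horField a A p i * horField a A p k) * (∑ B, horField a B p j * horField a B p l)
          * eps a p k l := by
      rw [← frameNorm_mul_hInv ha hr, ← frameNorm_mul_hInv ha hr]
      ring
    simp only [epsUp, Finset.mul_sum, h', bilin, Fin.sum_univ_two, ← Finset.sum_add_distrib]
    exact Finset.sum_congr rfl fun _ _ => Finset.sum_congr rfl fun _ _ => by ring
  refine mul_left_cancel₀ hN (h.trans ?_)
  simp only [bilin_eps_horField a hr, Fin.sum_univ_two, Matrix.of_apply, Matrix.cons_val]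
  ring

theorem frameNorm_mul_epsDot (ha : |a| ≤ M) (hp : p ∈ region M a) (θ : TwoTensor) :
    frameNorm a p * epsDot M a θ p = bilin (θ p) (horField a 0 p) (horField a 1 p)
      - bilin (θ p) (horField a 1 p) (horField a 0 p) := by
  simp only [epsDot, Finset.mul_sum, ← mul_assoc, frameNorm_mul_epsUp ha hp, bilin,
    ← Finset.sum_sub_distrib]
  exact Finset.sum_congr rfl fun _ _ => Finset.sum_congr rfl fun _ _ => by ring

theorem frameNorm_mul_hWedge (ha : |a| ≤ M) (hp : p ∈ region M a) (ς τ : OneForm) :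
    frameNorm a p * hWedge M a ς τ p
      = (ς p ⬝ᵥ horField a 0 p) * (τ p ⬝ᵥ horField a 1 p)
        - (ς p ⬝ᵥ horField a 1 p) * (τ p ⬝ᵥ horField a 0 p) := by
  have h := frameNorm_mul_epsDot ha hp fun q i j => ς q i * τ q j
  simpa only [bilin_mul_mul, epsDot, hWedge, mul_assoc] using h

theorem bilin_proj (ha : |a| ≤ M) (hr : 0 < rad p) (θ : Fin 4 → Fin 4 → ℝ) (A B : Fin 2) :
    bilin (fun i j => ∑ k, ∑ l, proj M a p k i * proj M a p l j * θ k l)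
      (horField a A p) (horField a B p) = bilin θ (horField a A p) (horField a B p) := by
  have h : Matrix.of (fun i j => ∑ k, ∑ l, proj M a p k i * proj M a p l j * θ k l)
      = (Matrix.of (proj M a p))ᵀ * Matrix.of θ * Matrix.of (proj M a p) := by
    ext i j
    simp only [Matrix.mul_apply, Matrix.transpose_apply, Matrix.of_apply, Finset.sum_mul]
    rw [Finset.sum_comm]
    exact Finset.sum_congr rfl fun _ _ => Finset.sum_congr rfl fun _ _ => by ring
  rw [bilin_eq_dotProduct, bilin_eq_dotProduct, h, ← Matrix.mulVec_mulVec, ← Matrix.mulVec_mulVec,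
    proj_mulVec_horField ha hr, Matrix.dotProduct_mulVec, Matrix.vecMul_transpose,
    proj_mulVec_horField ha hr]

theorem bilin_nabTensor (ha : |a| ≤ M) (hr : 0 < rad p) (ς : OneForm) (A B : Fin 2) :
    bilin (nabTensor M a ς p) (horField a A p) (horField a B p)
      = bilin (covForm M a ς p) (horField a A p) (horField a B p) :=
  bilin_proj ha hr _ A B

theorem bilin_secondFund (ha : |a| ≤ M) (hr : 0 < rad p) (V : VecField) (A B : Fin 2) :
    bilin (secondFund M a V p) (horField a A p) (horField a B p)
      = inner4 M a p (covAlong M a (horField a A) V p) (horField a B p) := by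
  have h : secondFund M a V p = fun i j => ∑ k, ∑ l, proj M a p k i * proj M a p l j
      * ∑ m, metric M a p m l * covVec M a V p k m := by
    ext i j
    simp only [secondFund, Finset.mul_sum, mul_assoc]
  rw [h, bilin_proj ha hr]
  simp only [bilin, inner4, covAlong, Finset.sum_mul, Finset.mul_sum]
  rw [Finset.sum_comm, Finset.sum_congr rfl fun _ _ => Finset.sum_comm, Finset.sum_comm]
  refine Finset.sum_congr rfl fun _ _ => Finset.sum_congr rfl fun _ _ =>
    Finset.sum_congr rfl fun _ _ => by ring

theorem horiz_dotProduct_horField (ha : |a| ≤ M) (hr : 0 < rad p) (ς : OneForm) (A : Fin 2) :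
    horiz M a ς p ⬝ᵥ horField a A p = ς p ⬝ᵥ horField a A p := by
  rw [show horiz M a ς p = ς p ᵥ* Matrix.of (proj M a p) from rfl, ← Matrix.dotProduct_mulVec,
    proj_mulVec_horField ha hr]

theorem isHorizontal_horiz (ha : |a| ≤ M) (ς : OneForm) :
    IsHorizontal M a (region M a) (horiz M a ς) := fun p hp => by
  have h (u : Fin 4 → ℝ) : ∑ i, horiz M a ς p i * u i = ς p ⬝ᵥ (Matrix.of (proj M a p) *ᵥ u) :=
    (Matrix.dotProduct_mulVec _ _ _).symm
  have hr := rad_pos_of_mem_region hp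
  rw [h, h, proj_mulVec_e3 ha hr, proj_mulVec_e4 ha hr, dotProduct_zero]
  exact ⟨rfl, rfl⟩

theorem isHorizontal_hStar (ha : |a| ≤ M) (ς : OneForm) :
    IsHorizontal M a (region M a) (hStar M a ς) := fun p hp => by
  have hr := rad_pos_of_mem_region hp
  have hN := (frameNorm_pos hp).ne'
  have h {u : Fin 4 → ℝ} (h2 : u 2 = 0) (hφ : carterPhi a p u = 0) :
      ∑ i, hStar M a ς p i * sph p u i = 0 := by
    refine mul_left_cancel₀ hN ?_
    rw [hStar_eq_sharpDot]
    refine (frameNorm_mul_sharpDot ha hr (eps a) ς _).trans ?_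
    simp [horField, bilin_eps_sph hr, h2, hφ]
  rw [e3_eq_sph, e4_eq_sph]
  refine ⟨h rfl (by simp [carterPhi]), h (by simp) ?_⟩
  simp only [carterPhi, Fin.isValue, Pi.smul_apply, Matrix.cons_val, smul_eq_mul]
  ring

theorem IsHorizontal.frameNorm_mul_dotProduct (ha : |a| ≤ M) {U : Set Pt} {ς : OneForm}
    (hς : IsHorizontal M a U ς) (hp : p ∈ U) (hr : 0 < rad p) (v : Fin 4 → ℝ) :
    frameNorm a p * (ς p ⬝ᵥ v)
      = ∑ A, (ς p ⬝ᵥ horField a A p) * inner4 M a p v (horField a A p) := by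
  have h3 : ς p ⬝ᵥ e3 p = 0 := (hς p hp).1
  have h4 : ς p ⬝ᵥ e4 M a p = 0 := (hς p hp).2
  have hproj : ς p ⬝ᵥ v = ς p ⬝ᵥ (Matrix.of (proj M a p) *ᵥ v) := by
    simp [proj_mulVec, dotProduct_add, h3, h4]
  have hA (A : Fin 2) : inner4 M a p v (horField a A p)
      = (metric M a p *ᵥ v) ⬝ᵥ horField a A p := by
    rw [inner4_comm, inner4_eq_mulVec, dotProduct_comm]
  simp only [hproj, proj_mulVec_eq_hInv_mulVec ha hr, hA]
  refine Eq.trans ?_ (frameNorm_mul_hDot ha hr ς fun _ => metric M a p *ᵥ v)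
  rw [← bilin_eq_dotProduct]
  simp only [bilin, hDot]

theorem IsHorizontal.eq_zero (ha : |a| ≤ M) {U : Set Pt} {ς : OneForm}
    (hς : IsHorizontal M a U ς) (hpU : p ∈ U) (hp : p ∈ region M a)
    (h : ∀ A, ς p ⬝ᵥ horField a A p = 0) : ς p = 0 := by
  refine dotProduct_eq_zero _ fun v => mul_left_cancel₀ (frameNorm_pos hp).ne' ?_
  simp only [hς.frameNorm_mul_dotProduct ha hpU (rad_pos_of_mem_region hp), h, zero_mul,
    Finset.sum_const_zero, mul_zero]

/-! ### Transverse derivatives -/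

/-- The field `Σ e₄`, which commutes with both fields `horField`. -/
def scaledE4 (M a : ℝ) : VecField := fun p =>
  sph p ![2 * (rad p ^ 2 + a ^ 2), bigDelta M a p, 0, 2 * a]

theorem sph_smul (p : Pt) (c : ℝ) (u : Fin 4 → ℝ) : sph p (c • u) = c • sph p u := by
  ext i
  fin_cases i <;> simp [sph] <;> ring

theorem e4_eq_smul_scaledE4 (M a : ℝ) : e4 M a = fun q => (bigSigma a q)⁻¹ • scaledE4 M a q :=
  funext fun q => (e4_eq_sph M a q).trans (sph_smul q _ _)

theorem contDiffAt_e3 {n : WithTop ℕ∞} (hr : 0 < rad p) : ContDiffAt ℝ n e3 p := by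
  simpa only [← e3_eq_sph] using contDiffAt_sph hr (u := fun _ => ![0, -1, 0, 0]) contDiffAt_const

theorem contDiffAt_scaledE4 {n : WithTop ℕ∞} (M a : ℝ) (hr : 0 < rad p) :
    ContDiffAt ℝ n (scaledE4 M a) p := by
  refine contDiffAt_sph hr (contDiffAt_pi.2 fun i => ?_)
  fin_cases i
  exacts [contDiffAt_const.mul (((contDiffAt_rad hr).pow 2).add contDiffAt_const),
    contDiffAt_bigDelta M a hr, contDiffAt_const, contDiffAt_const]

theorem contDiffAt_e4 {n : WithTop ℕ∞} (M a : ℝ) (hr : 0 < rad p) :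
    ContDiffAt ℝ n (e4 M a) p := by
  rw [e4_eq_smul_scaledE4]
  exact ((contDiffAt_bigSigma a hr).inv (bigSigma_pos a hr).ne').smul (contDiffAt_scaledE4 M a hr)

theorem contDiffAt_horField {n : WithTop ℕ∞} (a : ℝ) (hr : 0 < rad p) (A : Fin 2) :
    ContDiffAt ℝ n (horField a A) p := by
  refine contDiffAt_sph hr (contDiffAt_pi.2 fun i => ?_)
  have hs : ContDiffAt ℝ n sinSq p := contDiffAt_const.sub ((contDiffAt_cosTheta hr).pow 2)
  fin_cases A <;> fin_cases i
  pick_goal 5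
  · exact contDiffAt_const.mul hs
  all_goals exact contDiffAt_const

theorem differentiableAt_horField (a : ℝ) (hr : 0 < rad p) (A : Fin 2) :
    DifferentiableAt ℝ (horField a A) p :=
  (contDiffAt_horField (n := 1) a hr A).differentiableAt one_ne_zero

theorem lieBracket_radial_polar (hr : 0 < rad p) {u v : ℝ → Fin 4 → ℝ}
    (hu : DifferentiableAt ℝ u (rad p)) (hv : DifferentiableAt ℝ v (cosTheta p))
    (hu2 : u (rad p) 2 = 0) (hv1 : v (cosTheta p) 1 = 0) :
    lieBracket ℝ (fun q => sph q (u (rad q))) (fun q => sph q (v (cosTheta q))) p = 0 := by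
  have hu' := hu.hasFDerivAt.comp p (differentiableAt_rad hr).hasFDerivAt
  have hv' := hv.hasFDerivAt.comp p (differentiableAt_cosTheta hr).hasFDerivAt
  have h := lieBracket_sph hr hu'.differentiableAt hv'.differentiableAt
  refine h.trans ?_
  rw [hu'.fderiv, hv'.fderiv]
  simp only [ContinuousLinearMap.comp_apply, Function.comp_apply, fderiv_rad_sph hr,
    fderiv_cosTheta_sph hr, hu2, hv1, mul_zero, neg_zero, map_zero, sub_zero]
  simpa using sph_smul p 0 0

theorem lieBracket_radial_horField (hr : 0 < rad p) (a : ℝ) (A : Fin 2) {u : ℝ → Fin 4 → ℝ}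
    (hu : DifferentiableAt ℝ u (rad p)) (hu2 : u (rad p) 2 = 0) :
    lieBracket ℝ (fun q => sph q (u (rad q))) (horField a A) p = 0 := by
  refine lieBracket_radial_polar hr
    (v := fun c => (![![0, 0, 1, 0], ![a * (1 - c ^ 2), 0, 0, 1]] : Fin 2 → Fin 4 → ℝ) A)
    hu (differentiableAt_pi.2 fun i => ?_) hu2 ?_
  · fin_cases A <;> fin_cases i <;> simp
  · fin_cases A <;> rfl

theorem lieBracket_e3_horField (hr : 0 < rad p) (a : ℝ) (A : Fin 2) :
    lieBracket ℝ e3 (horField a A) p = 0 := by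
  simpa only [← e3_eq_sph] using
    lieBracket_radial_horField hr a A (u := fun _ => ![0, -1, 0, 0]) (differentiableAt_const _) rfl

theorem lieBracket_scaledE4_horField (M : ℝ) (hr : 0 < rad p) (a : ℝ) (A : Fin 2) :
    lieBracket ℝ (scaledE4 M a) (horField a A) p = 0 :=
  lieBracket_radial_horField hr a A
    (u := fun s => ![2 * (s ^ 2 + a ^ 2), (s - rPlus M a) * (s - rMinus M a), 0, 2 * a])
    (differentiableAt_pi.2 fun i => by fin_cases i <;> simp) rfl

theorem differentiableAt_sinSq (hr : 0 < rad p) : DifferentiableAt ℝ sinSq p :=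
  (differentiableAt_const 1).sub ((differentiableAt_cosTheta hr).pow 2)

theorem fderiv_sinSq_sph (hr : 0 < rad p) (u : Fin 4 → ℝ) :
    fderiv ℝ sinSq p (sph p u) = 2 * cosTheta p * sinSq p * u 2 := by
  have h : HasFDerivAt sinSq _ p := ((differentiableAt_cosTheta hr).hasFDerivAt.pow 2).const_sub 1
  simp only [h.fderiv, Nat.add_one_sub_one, pow_one, nsmul_eq_mul, Nat.cast_ofNat, neg_apply,
    smul_apply, fderiv_cosTheta_sph hr, smul_eq_mul, mul_neg, neg_neg]
  ring

theorem lieBracket_horField (hr : 0 < rad p) (a : ℝ) :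
    lieBracket ℝ (horField a 0) (horField a 1) p
      = sph p ![2 * a * cosTheta p * sinSq p, 0, 0, 0] := by
  have hs := (differentiableAt_sinSq hr).hasFDerivAt.const_mul a
  have hv : DifferentiableAt ℝ (fun q => (![a * sinSq q, 0, 0, 1] : Fin 4 → ℝ)) p :=
    differentiableAt_pi.2 fun i => by fin_cases i <;> simp [hs.differentiableAt]
  refine (lieBracket_sph hr (u := fun _ => ![0, 0, 1, 0]) (differentiableAt_const _) hv).trans ?_
  congr 1
  ext k
  rw [fderiv_fun_const, Pi.sub_apply, ← fderiv_comp_apply hv]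
  fin_cases k
  · simp [hs.fderiv, fderiv_sinSq_sph hr]
    ring
  all_goals simp

theorem fderiv_bigSigma_sph (a : ℝ) (hr : 0 < rad p) (u : Fin 4 → ℝ) :
    fderiv ℝ (bigSigma a) p (sph p u)
      = 2 * rad p * u 1 - 2 * a ^ 2 * cosTheta p * sinSq p * u 2 := by
  have h : HasFDerivAt (bigSigma a) _ p := ((differentiableAt_rad hr).hasFDerivAt.pow 2).add
    (((differentiableAt_cosTheta hr).hasFDerivAt.pow 2).const_mul (a ^ 2))
  simp only [h.fderiv, Nat.add_one_sub_one, pow_one, nsmul_eq_mul, Nat.cast_ofNat, add_apply,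
    smul_apply, fderiv_rad_sph hr, smul_eq_mul, fderiv_cosTheta_sph hr, mul_neg]
  ring

theorem differentiableAt_bigSigma (a : ℝ) (hr : 0 < rad p) : DifferentiableAt ℝ (bigSigma a) p :=
  (contDiffAt_bigSigma (n := 1) a hr).differentiableAt one_ne_zero

theorem lieBracket_e4_horField (M : ℝ) (hr : 0 < rad p) (a : ℝ) (A : Fin 2) :
    lieBracket ℝ (e4 M a) (horField a A) p
      = (fderiv ℝ (bigSigma a) p (horField a A p) / bigSigma a p) • e4 M a p := by
  have hinv := (hasDerivAt_inv (bigSigma_pos a hr).ne').comp_hasFDerivAt p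
    (differentiableAt_bigSigma a hr).hasFDerivAt
  rw [e4_eq_smul_scaledE4]
  refine (lieBracket_smul_left hinv.differentiableAt
    ((contDiffAt_scaledE4 (n := 1) M a hr).differentiableAt one_ne_zero)).trans ?_
  rw [lieBracket_scaledE4_horField M hr, hinv.fderiv]
  simp only [smul_zero, add_zero, smul_apply, smul_eq_mul]
  match_scalars
  ring

theorem inner4_sph_horField (ha : |a| ≤ M) (hr : 0 < rad p) (u : Fin 4 → ℝ) (A : Fin 2) :
    inner4 M a p (sph p u) (horField a A p)
      = ![frameNorm a p * u 2, sinSq p * carterPhi a p u] A := by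
  have hS := (bigSigma_pos a hr).ne'
  have hs : bigSigma a p = rad p ^ 2 + a ^ 2 * (1 - sinSq p) := by unfold bigSigma sinSq; ring
  rw [horField, inner4_sph ha hr, frameNorm]
  fin_cases A <;> simp [carterT, carterPhi] <;> field_simp
  · exact .inl trivial
  · rw [hs]
    ring

theorem lieBracket_e3_scaledE4 (M a : ℝ) (hr : 0 < rad p) :
    lieBracket ℝ e3 (scaledE4 M a) p
      = sph p ![-(4 * rad p), -(2 * rad p - rPlus M a - rMinus M a), 0, 0] := by
  have hrad := (differentiableAt_rad hr).hasFDerivAt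
  have h0 : HasFDerivAt (fun q => 2 * (rad q ^ 2 + a ^ 2)) _ p :=
    ((hrad.pow 2).add_const (a ^ 2)).const_mul 2
  have h1 : HasFDerivAt (bigDelta M a) _ p :=
    (hrad.sub_const (rPlus M a)).mul (hrad.sub_const (rMinus M a))
  have hv : DifferentiableAt ℝ (fun q =>
      (![2 * (rad q ^ 2 + a ^ 2), bigDelta M a q, 0, 2 * a] : Fin 4 → ℝ)) p :=
    differentiableAt_pi.2 fun i => by
      fin_cases i <;> simp only [Fin.reduceFinMk, Fin.zero_eta, Fin.mk_one, Matrix.cons_val]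
      exacts [h0.differentiableAt, h1.differentiableAt, differentiableAt_const _,
        differentiableAt_const _]
  have h := lieBracket_sph hr (u := fun _ => ![0, -1, 0, 0]) (differentiableAt_const _) hv
  simp only [← e3_eq_sph] at h
  refine h.trans ?_
  congr 1
  ext k
  rw [fderiv_fun_const, Pi.sub_apply, ← fderiv_comp_apply hv, e3_eq_sph]
  fin_cases k
  · simp [h0.fderiv, fderiv_rad_sph hr]
    ring
  · simp [h1.fderiv, fderiv_rad_sph hr]
    ring
  all_goals simp

theorem inner4_lieBracket_e3_e4_horField (ha : |a| ≤ M) (hr : 0 < rad p) (A : Fin 2) :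
    inner4 M a p (lieBracket ℝ e3 (e4 M a) p) (horField a A p)
      = ![0, 4 * a * rad p * sinSq p / bigSigma a p] A := by
  have hS := (bigSigma_pos a hr).ne'
  have hX : inner4 M a p (scaledE4 M a p) (horField a A p) = 0 := by
    rw [scaledE4, inner4_sph_horField ha hr, carterPhi]
    match A with
    | 0 => simp
    | 1 =>
      simp only [Fin.isValue, Matrix.cons_val, Matrix.cons_val_zero, Matrix.cons_val_one]
      ring
  have hinv := (hasDerivAt_inv hS).comp_hasFDerivAt p (differentiableAt_bigSigma a hr).hasFDerivAt
  have h : lieBracket ℝ e3 (e4 M a) p = fderiv ℝ (fun q => (bigSigma a q)⁻¹) p (e3 p)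
      • scaledE4 M a p + (bigSigma a p)⁻¹ • lieBracket ℝ e3 (scaledE4 M a) p := by
    rw [e4_eq_smul_scaledE4]
    exact lieBracket_smul_right hinv.differentiableAt
      ((contDiffAt_scaledE4 (n := 1) M a hr).differentiableAt one_ne_zero)
  rw [h, inner4_add_left, inner4_smul_left, inner4_smul_left, hX, lieBracket_e3_scaledE4 M a hr,
    inner4_sph_horField ha hr, carterPhi]
  fin_cases A <;> simp
  ring

/-- A null field whose flow preserves the horizontal distribution: `X` is orthogonal to the fields
`horField`, and so are its Lie brackets with them. -/
structure IsTransverse (M a : ℝ) (X : VecField) : Prop where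
  differentiableAt : ∀ p ∈ region M a, DifferentiableAt ℝ X p
  orthogonal : ∀ p ∈ region M a, ∀ A, inner4 M a p (X p) (horField a A p) = 0
  lieBracket_orthogonal : ∀ p ∈ region M a, ∀ A B,
    inner4 M a p (lieBracket ℝ X (horField a A) p) (horField a B p) = 0

theorem isTransverse_e3 (ha : |a| ≤ M) : IsTransverse M a e3 where
  differentiableAt p hp :=
    (contDiffAt_e3 (n := 1) (rad_pos_of_mem_region hp)).differentiableAt one_ne_zero
  orthogonal p hp := inner4_e3_horField ha (rad_pos_of_mem_region hp)
  lieBracket_orthogonal p hp A B := by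
    rw [lieBracket_e3_horField (rad_pos_of_mem_region hp), inner4_zero_left]

theorem isTransverse_e4 (ha : |a| ≤ M) : IsTransverse M a (e4 M a) where
  differentiableAt p hp :=
    (contDiffAt_e4 (n := 1) M a (rad_pos_of_mem_region hp)).differentiableAt one_ne_zero
  orthogonal p hp := inner4_e4_horField ha (rad_pos_of_mem_region hp)
  lieBracket_orthogonal p hp A B := by
    have hr := rad_pos_of_mem_region hp
    rw [lieBracket_e4_horField M hr, inner4_smul_left, inner4_e4_horField ha hr, mul_zero]

namespace IsTransverse

variable {X : VecField}

theorem bilin_secondFund_eq (hX : IsTransverse M a X) (ha : |a| ≤ M) (hp : p ∈ region M a)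
    (A B : Fin 2) :
    bilin (secondFund M a X p) (horField a A p) (horField a B p)
      = inner4 M a p (covAlong M a X (horField a A) p) (horField a B p) := by
  have hr := rad_pos_of_mem_region hp
  have h := hX.lieBracket_orthogonal p hp A B
  rw [← covAlong_sub_covAlong hp (hX.differentiableAt p hp) (differentiableAt_horField a hr A),
    inner4_sub_left] at h
  rw [bilin_secondFund ha hr]
  linarith

theorem bilin_secondFund_add (hX : IsTransverse M a X) (ha : |a| ≤ M) (hp : p ∈ region M a)
    (A B : Fin 2) :
    bilin (secondFund M a X p) (horField a A p) (horField a B p)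
      + bilin (secondFund M a X p) (horField a B p) (horField a A p)
      = if A = B then fderiv ℝ (frameNorm a) p (X p) else 0 := by
  have hr := rad_pos_of_mem_region hp
  have hK := differentiableAt_horField a hr
  have hN : (fun q => inner4 M a q (horField a A q) (horField a B q))
      =ᶠ[𝓝 p] fun q => if A = B then frameNorm a q else 0 := by
    filter_upwards [(isOpen_region M a).mem_nhds hp] with q hq
    exact inner4_horField ha (rad_pos_of_mem_region hq) A B
  rw [hX.bilin_secondFund_eq ha hp, hX.bilin_secondFund_eq ha hp,
    inner4_comm M a p (covAlong M a X (horField a B) p), ← fderiv_inner4 ha hp X (hK A) (hK B),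
    hN.fderiv_eq]
  split_ifs
  · rfl
  · simp

theorem bilin_secondFund_sub (hX : IsTransverse M a X) (ha : |a| ≤ M) (hp : p ∈ region M a)
    (A B : Fin 2) :
    bilin (secondFund M a X p) (horField a A p) (horField a B p)
      - bilin (secondFund M a X p) (horField a B p) (horField a A p)
      = -inner4 M a p (X p) (lieBracket ℝ (horField a A) (horField a B) p) := by
  have hr := rad_pos_of_mem_region hp
  have hK := differentiableAt_horField a hr
  have h (A B : Fin 2) : inner4 M a p (covAlong M a (horField a A) X p) (horField a B p)
      = -inner4 M a p (X p) (covAlong M a (horField a A) (horField a B) p) := by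
    have h0 : (fun q => inner4 M a q (X q) (horField a B q)) =ᶠ[𝓝 p] fun _ => 0 := by
      filter_upwards [(isOpen_region M a).mem_nhds hp] with q hq
      exact hX.orthogonal q hq B
    have hd := fderiv_inner4 ha hp (horField a A) (hX.differentiableAt p hp) (hK B)
    rw [h0.fderiv_eq, fderiv_fun_const] at hd
    exact eq_neg_of_add_eq_zero_left hd.symm
  rw [bilin_secondFund ha hr, bilin_secondFund ha hr, h, h,
    ← covAlong_sub_covAlong hp (hK A) (hK B), inner4_comm M a p (X p) (_ - _), inner4_sub_left,
    inner4_comm M a p (X p), inner4_comm M a p (X p)]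
  ring

theorem frameNorm_mul_hTr_secondFund (hX : IsTransverse M a X) (ha : |a| ≤ M)
    (hp : p ∈ region M a) :
    frameNorm a p * hTr M a (secondFund M a X) p = fderiv ℝ (frameNorm a) p (X p) := by
  have h0 := hX.bilin_secondFund_add ha hp 0 0
  have h1 := hX.bilin_secondFund_add ha hp 1 1
  rw [if_pos rfl] at h0 h1
  rw [frameNorm_mul_hTr ha (rad_pos_of_mem_region hp), Fin.sum_univ_two]
  linarith

theorem frameNorm_mul_epsDot_secondFund (hX : IsTransverse M a X) (ha : |a| ≤ M)
    (hp : p ∈ region M a) :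
    frameNorm a p * epsDot M a (secondFund M a X) p
      = -inner4 M a p (X p) (sph p ![2 * a * cosTheta p * sinSq p, 0, 0, 0]) := by
  rw [frameNorm_mul_epsDot ha hp, hX.bilin_secondFund_sub ha hp,
    lieBracket_horField (rad_pos_of_mem_region hp)]

theorem bilin_secondFund_eq_matrix (hX : IsTransverse M a X) (ha : |a| ≤ M) (hp : p ∈ region M a)
    (A B : Fin 2) :
    bilin (secondFund M a X p) (horField a A p) (horField a B p) = frameNorm a p *
      !![hTr M a (secondFund M a X) p / 2, epsDot M a (secondFund M a X) p / 2;
        -(epsDot M a (secondFund M a X) p / 2), hTr M a (secondFund M a X) p / 2] A B := by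
  have hsym := hX.bilin_secondFund_add ha hp
  have htr := hX.frameNorm_mul_hTr_secondFund ha hp
  have heps := frameNorm_mul_epsDot ha hp (secondFund M a X)
  have h00 := hsym 0 0
  have h01 := hsym 0 1
  have h11 := hsym 1 1
  simp only [if_true, Fin.isValue, zero_ne_one, if_false] at h00 h01 h11
  fin_cases A <;> fin_cases B <;> simp only [Fin.zero_eta, Fin.mk_one, Fin.isValue,
    Matrix.of_apply, Matrix.cons_val', Matrix.cons_val] <;> linarith

end IsTransverse

/-! ### Spin components -/

/-- The spin component `w(K₀) + i w(K₁)` of a covector `w`, where `K₀, K₁` are the fields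
`horField`. -/
def spinComp (a : ℝ) (p : Pt) : (Fin 4 → ℝ) →ₗ[ℝ] ℂ where
  toFun w := ⟨w ⬝ᵥ horField a 0 p, w ⬝ᵥ horField a 1 p⟩
  map_add' v w := by simp only [add_dotProduct]; rfl
  map_smul' c w := by simp [Complex.ext_iff]

theorem fderiv_complex_mk {f g : Pt → ℝ} (hf : DifferentiableAt ℝ f p)
    (hg : DifferentiableAt ℝ g p) (v : Fin 4 → ℝ) :
    fderiv ℝ (fun q => (⟨f q, g q⟩ : ℂ)) p v = ⟨fderiv ℝ f p v, fderiv ℝ g p v⟩ := by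
  have h := Complex.equivRealProdCLM.symm.hasFDerivAt.comp p
    (hf.hasFDerivAt.prodMk hg.hasFDerivAt)
  exact congrArg (· v) h.fderiv

theorem fderiv_scaledE4_eq (M : ℝ) (hr : 0 < rad p) (a : ℝ) (F : Pt → ℂ) :
    fderiv ℝ F p (scaledE4 M a p) = bigSigma a p * fderiv ℝ F p (e4 M a p) := by
  rw [e4_eq_smul_scaledE4, map_smul, Complex.real_smul, Complex.ofReal_inv,
    mul_inv_cancel_left₀ (Complex.ofReal_ne_zero.2 (bigSigma_pos a hr).ne')]

theorem contDiffAt_complex_mk {n : WithTop ℕ∞} {f g : Pt → ℝ} (hf : ContDiffAt ℝ n f p)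
    (hg : ContDiffAt ℝ n g p) : ContDiffAt ℝ n (fun q => (⟨f q, g q⟩ : ℂ)) p :=
  Complex.equivRealProdCLM.symm.contDiff.contDiffAt.comp p (hf.prodMk hg)

theorem contDiffAt_spinComp {n : WithTop ℕ∞} {ς : OneForm} (a : ℝ) (hr : 0 < rad p)
    (hς : ContDiffAt ℝ n ς p) : ContDiffAt ℝ n (fun q => spinComp a q (ς q)) p := by
  have h (A : Fin 2) : ContDiffAt ℝ n (fun q => ς q ⬝ᵥ horField a A q) p :=
    ContDiffAt.sum fun i _ => (contDiffAt_pi.1 hς i).mul (contDiffAt_pi.1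
      (contDiffAt_horField a hr A) i)
  exact contDiffAt_complex_mk (h 0) (h 1)

theorem spinComp_eq_of_forall (hp : p ∈ region M a) {v w : Fin 4 → ℝ} {x y : ℝ}
    (h : ∀ A, frameNorm a p * (w ⬝ᵥ horField a A p)
      = ∑ B, frameNorm a p * !![x, y; -y, x] A B * (v ⬝ᵥ horField a B p)) :
    spinComp a p w = (x - y * Complex.I) * spinComp a p v := by
  have h' (A : Fin 2) : w ⬝ᵥ horField a A p = ∑ B, !![x, y; -y, x] A B * (v ⬝ᵥ horField a B p) := by
    refine mul_left_cancel₀ (frameNorm_pos hp).ne' ((h A).trans ?_)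
    simp only [Finset.mul_sum, mul_assoc]
  apply Complex.ext <;> simp [spinComp, h']
  ring

theorem spinComp_hStar (ha : |a| ≤ M) (hp : p ∈ region M a) (ς : OneForm) :
    spinComp a p (hStar M a ς p) = -Complex.I * spinComp a p (ς p) := by
  have hr := rad_pos_of_mem_region hp
  rw [spinComp_eq_of_forall hp (v := ς p) (x := 0) (y := 1) fun A => by
    simp only [hStar_eq_sharpDot, frameNorm_mul_sharpDot ha hr, bilin_eps_horField a hr]]
  simp

namespace IsTransverse

variable {X : VecField} {ς : OneForm} {U : Set Pt}

theorem spinComp_sharpDot (hX : IsTransverse M a X) (ha : |a| ≤ M) (hp : p ∈ region M a)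
    (ς : OneForm) :
    spinComp a p (sharpDot M a (secondFund M a X) ς p)
      = (hTr M a (secondFund M a X) p - epsDot M a (secondFund M a X) p * Complex.I) / 2
        * spinComp a p (ς p) := by
  rw [spinComp_eq_of_forall hp (v := ς p) (x := hTr M a (secondFund M a X) p / 2)
    (y := epsDot M a (secondFund M a X) p / 2) fun A => by
    rw [frameNorm_mul_sharpDot ha (rad_pos_of_mem_region hp)]
    simp only [hX.bilin_secondFund_eq_matrix ha hp]]
  push_cast
  ring

theorem spinComp_shift_half (hX : IsTransverse M a X) (ha : |a| ≤ M) (hp : p ∈ region M a)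
    (ς : OneForm) :
    spinComp a p (nab M a X ς p + (1 / 2 * hTr M a (secondFund M a X) p) • ς p
        + (1 / 2 * epsDot M a (secondFund M a X) p) • hStar M a ς p)
      = spinComp a p (nab M a X ς p + sharpDot M a (secondFund M a X) ς p) := by
  simp only [map_add, map_smul, hX.spinComp_sharpDot ha hp, spinComp_hStar ha hp,
    Complex.real_smul]
  push_cast
  ring

theorem nab_add_sharpDot_dotProduct (hX : IsTransverse M a X) (ha : |a| ≤ M)
    (hp : p ∈ region M a) (hpU : p ∈ U) (hς : IsHorizontal M a U ς) (hd : DifferentiableAt ℝ ς p)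
    (A : Fin 2) :
    (nab M a X ς p + sharpDot M a (secondFund M a X) ς p) ⬝ᵥ horField a A p
      = fderiv ℝ (fun q => ς q ⬝ᵥ horField a A q) p (X p) := by
  have hr := rad_pos_of_mem_region hp
  have h : sharpDot M a (secondFund M a X) ς p ⬝ᵥ horField a A p
      = ς p ⬝ᵥ covAlong M a X (horField a A) p := by
    refine mul_left_cancel₀ (frameNorm_pos hp).ne' ?_
    simp only [frameNorm_mul_sharpDot ha hr, hς.frameNorm_mul_dotProduct ha hpU hr,
      hX.bilin_secondFund_eq ha hp, mul_comm]
  rw [add_dotProduct, h, nab, horiz_dotProduct_horField ha hr,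
    sum_covForm_eq hp X hd (differentiableAt_horField a hr A), sub_add_cancel]

theorem spinComp_nab_add_sharpDot (hX : IsTransverse M a X) (ha : |a| ≤ M)
    (hp : p ∈ region M a) (hpU : p ∈ U) (hς : IsHorizontal M a U ς)
    (hd : DifferentiableAt ℝ ς p) :
    spinComp a p (nab M a X ς p + sharpDot M a (secondFund M a X) ς p)
      = fderiv ℝ (fun q => spinComp a q (ς q)) p (X p) := by
  have hK (A : Fin 2) : DifferentiableAt ℝ (fun q => ς q ⬝ᵥ horField a A q) p :=
    differentiableAt_dotProduct hd (differentiableAt_horField a (rad_pos_of_mem_region hp) A)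
  refine Eq.trans ?_ (fderiv_complex_mk (hK 0) (hK 1) (X p)).symm
  simp only [← hX.nab_add_sharpDot_dotProduct ha hp hpU hς hd]
  rfl

theorem spinComp_shift (hX : IsTransverse M a X) (ha : |a| ≤ M)
    (hp : p ∈ region M a) (hpU : p ∈ U) (hς : IsHorizontal M a U ς)
    (hd : DifferentiableAt ℝ ς p) (k l : ℝ) :
    spinComp a p (nab M a X ς p + (k * hTr M a (secondFund M a X) p) • ς p
        + (l * epsDot M a (secondFund M a X) p) • hStar M a ς p)
      = fderiv ℝ (fun q => spinComp a q (ς q)) p (X p)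
        + ((k - 1 / 2) * hTr M a (secondFund M a X) p
          - (l - 1 / 2) * epsDot M a (secondFund M a X) p * Complex.I) * spinComp a p (ς p) := by
  rw [← hX.spinComp_nab_add_sharpDot ha hp hpU hς hd]
  simp only [map_add, map_smul, hX.spinComp_sharpDot ha hp, spinComp_hStar ha hp,
    Complex.real_smul]
  push_cast
  ring

end IsTransverse

/-- The derivative `K₀F + i K₁F` along the complex combination of the fields `horField`. -/
def spinDeriv (a : ℝ) (F : Pt → ℂ) (p : Pt) : ℂ :=
  fderiv ℝ F p (horField a 0 p) + fderiv ℝ F p (horField a 1 p) * Complex.I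

theorem hasFDerivAt_ofReal {f : Pt → ℝ} (hf : DifferentiableAt ℝ f p) :
    HasFDerivAt (fun q => (f q : ℂ)) (Complex.ofRealCLM.comp (fderiv ℝ f p)) p :=
  Complex.ofRealCLM.hasFDerivAt.comp p hf.hasFDerivAt

theorem spinComp_grad (ha : |a| ≤ M) (hp : p ∈ region M a) {f : Pt → ℝ}
    (hf : DifferentiableAt ℝ f p) :
    spinComp a p (grad M a f p) = spinDeriv a (fun q => (f q : ℂ)) p := by
  have h (A : Fin 2) : grad M a f p ⬝ᵥ horField a A p = fderiv ℝ f p (horField a A p) := by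
    rw [grad, horiz_dotProduct_horField ha (rad_pos_of_mem_region hp), dotProduct_comm]
    exact sum_mul_pd hp _ f
  have hc (v : Fin 4 → ℝ) : fderiv ℝ (fun q => (f q : ℂ)) p v = fderiv ℝ f p v :=
    congrArg (· v) (hasFDerivAt_ofReal hf).fderiv
  simp only [spinDeriv, hc, ← h]
  exact Complex.mk_eq_add_mul_I _ _

theorem spinDeriv_add_mul {F G : Pt → ℂ} (hF : DifferentiableAt ℝ F p)
    (hG : DifferentiableAt ℝ G p) (z : ℂ) :
    spinDeriv a (fun q => F q + z * G q) p = spinDeriv a F p + z * spinDeriv a G p := by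
  simp only [spinDeriv, fderiv_fun_add hF (hG.const_mul z), fderiv_const_mul hG, add_apply,
    smul_apply, smul_eq_mul]
  ring

theorem spinDeriv_congr {F G : Pt → ℂ} (h : F =ᶠ[𝓝 p] G) : spinDeriv a F p = spinDeriv a G p := by
  simp only [spinDeriv, h.fderiv_eq]

theorem spinDeriv_neg (F : Pt → ℂ) : spinDeriv a (fun q => -F q) p = -spinDeriv a F p := by
  simp only [spinDeriv, fderiv_fun_neg, neg_apply]
  ring

theorem fderiv_sq_mul {w F : Pt → ℂ} (hw : DifferentiableAt ℝ w p) (hF : DifferentiableAt ℝ F p)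
    (v : Fin 4 → ℝ) :
    fderiv ℝ (fun q => w q ^ 2 * F q) p v
      = w p ^ 2 * fderiv ℝ F p v + 2 * w p * fderiv ℝ w p v * F p := by
  have h := (hw.hasFDerivAt.pow 2).mul hF.hasFDerivAt
  refine (congrArg (· v) h.fderiv).trans ?_
  simp only [Nat.add_one_sub_one, pow_one, nsmul_eq_mul, Nat.cast_ofNat, add_apply, smul_apply,
    smul_eq_mul]
  ring

theorem spinDeriv_sq_mul {w F : Pt → ℂ} (hw : DifferentiableAt ℝ w p)
    (hF : DifferentiableAt ℝ F p) :
    spinDeriv a (fun q => w q ^ 2 * F q) p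
      = w p ^ 2 * spinDeriv a F p + 2 * w p * spinDeriv a w p * F p := by
  simp only [spinDeriv, fderiv_sq_mul hw hF]
  ring

/-- The function `w² (f + z g)`. For `w = ζ̄`, `z = -i` and `(f, g) = (ρ, σ)` it is the middle
Newman–Penrose component of the Maxwell field, rescaled by `ζ̄²`. -/
def weightedPair (w : Pt → ℂ) (z : ℂ) (f g : Pt → ℝ) (p : Pt) : ℂ :=
  w p ^ 2 * (f p + z * g p)

theorem sq_mul_spinComp_gradShift (ha : |a| ≤ M) (hp : p ∈ region M a) {w : Pt → ℂ} {τ : OneForm}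
    (hw : DifferentiableAt ℝ w p) (hτ : spinDeriv a w p = w p * spinComp a p (τ p)) {f g : Pt → ℝ}
    (hf : DifferentiableAt ℝ f p) (hg : DifferentiableAt ℝ g p) (z : ℂ) :
    w p ^ 2 * (spinComp a p (gradShift M a τ f p) + z * spinComp a p (gradShift M a τ g p))
      = spinDeriv a (weightedPair w z f g) p := by
  have hf' := (hasFDerivAt_ofReal hf).differentiableAt
  have hg' := (hasFDerivAt_ofReal hg).differentiableAt
  refine Eq.trans ?_ (spinDeriv_sq_mul hw (hf'.fun_add (hg'.const_mul z))).symm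
  rw [spinDeriv_add_mul hf' hg', hτ]
  simp only [gradShift, map_add, map_smul, spinComp_grad ha hp hf, spinComp_grad ha hp hg,
    Complex.real_smul]
  push_cast
  ring

/-! ### Connection coefficients -/

/-- The Kerr spin coefficient function `ζ = r + i a cos θ`, a factor of `Σ = ζ ζ̄`. -/
def zeta (a : ℝ) (p : Pt) : ℂ := ⟨rad p, a * cosTheta p⟩

theorem zeta_mul_conj (a : ℝ) (p : Pt) : zeta a p * conj (zeta a p) = bigSigma a p := by
  rw [Complex.mul_conj, zeta, Complex.normSq_mk, bigSigma]
  simp only [sq, mul_mul_mul_comm]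

theorem conj_zeta (a : ℝ) (p : Pt) : conj (zeta a p) = rad p - a * cosTheta p * Complex.I := by
  apply Complex.ext <;> simp [zeta]

theorem zeta_ne_zero (a : ℝ) (hr : 0 < rad p) : zeta a p ≠ 0 :=
  fun h => hr.ne' (congrArg Complex.re h)

theorem contDiffAt_zeta {n : WithTop ℕ∞} (a : ℝ) (hr : 0 < rad p) : ContDiffAt ℝ n (zeta a) p :=
  contDiffAt_complex_mk (contDiffAt_rad hr) (contDiffAt_const.mul (contDiffAt_cosTheta hr))

theorem contDiffAt_conj_zeta {n : WithTop ℕ∞} (a : ℝ) (hr : 0 < rad p) :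
    ContDiffAt ℝ n (fun q => conj (zeta a q)) p :=
  Complex.conjCLE.contDiff.contDiffAt.comp p (contDiffAt_zeta a hr)

theorem differentiableAt_zeta (a : ℝ) (hr : 0 < rad p) : DifferentiableAt ℝ (zeta a) p :=
  (contDiffAt_zeta (n := 1) a hr).differentiableAt one_ne_zero

theorem fderiv_zeta_sph (a : ℝ) (hr : 0 < rad p) (u : Fin 4 → ℝ) :
    fderiv ℝ (zeta a) p (sph p u) = ⟨u 1, -(a * sinSq p * u 2)⟩ := by
  refine (fderiv_complex_mk (differentiableAt_rad hr)
    ((differentiableAt_cosTheta hr).const_mul a) _).trans ?_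
  rw [fderiv_rad_sph hr, fderiv_const_mul (differentiableAt_cosTheta hr), smul_apply,
    fderiv_cosTheta_sph hr, smul_eq_mul]
  congr 1
  ring

theorem fderiv_conj (F : Pt → ℂ) (v : Fin 4 → ℝ) :
    fderiv ℝ (fun q => conj (F q)) p v = conj (fderiv ℝ F p v) :=
  congrArg (· v) (fderiv_star (𝕜 := ℝ) (f := F) (x := p))

theorem fderiv_frameNorm_sph (a : ℝ) (hr : 0 < rad p) {u : Fin 4 → ℝ} (hu : u 2 = 0) :
    fderiv ℝ (frameNorm a) p (sph p u) = 2 * rad p * sinSq p * u 1 := by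
  have h : HasFDerivAt (frameNorm a) _ p :=
    (differentiableAt_bigSigma a hr).hasFDerivAt.mul (differentiableAt_sinSq hr).hasFDerivAt
  rw [h.fderiv]
  simp only [add_apply, smul_apply, fderiv_sinSq_sph hr, fderiv_bigSigma_sph a hr, hu, smul_eq_mul]
  ring

theorem bigSigma_mul_trChiBar (ha : |a| ≤ M) (hp : p ∈ region M a) :
    bigSigma a p * trChiBar M a p = -(2 * rad p) := by
  have h := (isTransverse_e3 ha).frameNorm_mul_hTr_secondFund ha hp
  rw [e3_eq_sph, fderiv_frameNorm_sph a (rad_pos_of_mem_region hp) rfl, frameNorm] at h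
  refine mul_right_cancel₀ (sinSq_pos_of_mem_region hp).ne' ?_
  simp only [Matrix.cons_val] at h
  rw [trChiBar, chiBar]
  linear_combination h

theorem bigSigma_mul_epsChiBar (ha : |a| ≤ M) (hp : p ∈ region M a) :
    bigSigma a p * epsChiBar M a p = 2 * a * cosTheta p := by
  have h := (isTransverse_e3 ha).frameNorm_mul_epsDot_secondFund ha hp
  rw [inner4_e3_sph ha (rad_pos_of_mem_region hp), carterT, frameNorm] at h
  refine mul_right_cancel₀ (sinSq_pos_of_mem_region hp).ne' ?_
  simp only [Matrix.cons_val] at h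
  rw [epsChiBar, chiBar]
  linear_combination h

theorem bigSigma_sq_mul_trChi (ha : |a| ≤ M) (hp : p ∈ region M a) :
    bigSigma a p ^ 2 * trChi M a p = 2 * rad p * bigDelta M a p := by
  have hr := rad_pos_of_mem_region hp
  have h := (isTransverse_e4 ha).frameNorm_mul_hTr_secondFund ha hp
  have he : e4 M a p = (bigSigma a p)⁻¹ • scaledE4 M a p := congrFun (e4_eq_smul_scaledE4 M a) p
  rw [he, map_smul, scaledE4, fderiv_frameNorm_sph a hr rfl, frameNorm, smul_eq_mul,
    eq_inv_mul_iff_mul_eq₀ (bigSigma_pos a hr).ne'] at h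
  refine mul_right_cancel₀ (sinSq_pos_of_mem_region hp).ne' ?_
  simp only [Matrix.cons_val] at h
  rw [trChi, chi]
  linear_combination h

theorem bigSigma_sq_mul_epsChi (ha : |a| ≤ M) (hp : p ∈ region M a) :
    bigSigma a p ^ 2 * epsChi M a p = 2 * a * cosTheta p * bigDelta M a p := by
  have hr := rad_pos_of_mem_region hp
  have hS := (bigSigma_pos a hr).ne'
  have h := (isTransverse_e4 ha).frameNorm_mul_epsDot_secondFund ha hp
  rw [inner4_e4_sph ha hr, carterT, frameNorm] at h
  refine mul_right_cancel₀ (sinSq_pos_of_mem_region hp).ne' ?_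
  simp only [Matrix.cons_val] at h
  field_simp at h
  rw [epsChi, chi]
  linear_combination h

theorem zeta_mul_chiBar (ha : |a| ≤ M) (hp : p ∈ region M a) :
    zeta a p * (trChiBar M a p + epsChiBar M a p * Complex.I)
      = 2 * fderiv ℝ (zeta a) p (e3 p) := by
  have hr := rad_pos_of_mem_region hp
  have htr := congrArg ((↑) : ℝ → ℂ) (bigSigma_mul_trChiBar ha hp)
  have heps := congrArg ((↑) : ℝ → ℂ) (bigSigma_mul_epsChiBar ha hp)
  have hd : fderiv ℝ (zeta a) p (e3 p) = -1 := by
    rw [e3_eq_sph, fderiv_zeta_sph a hr]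
    apply Complex.ext <;> simp
  refine mul_left_cancel₀ ((map_ne_zero conj).2 (zeta_ne_zero a hr)) ?_
  rw [← mul_assoc, mul_comm (conj _), zeta_mul_conj, hd, conj_zeta]
  push_cast at htr heps
  linear_combination htr + heps * Complex.I

theorem zeta_mul_chi (ha : |a| ≤ M) (hp : p ∈ region M a) :
    zeta a p * (trChi M a p - epsChi M a p * Complex.I)
      = 2 * fderiv ℝ (zeta a) p (e4 M a p) := by
  have hr := rad_pos_of_mem_region hp
  have hS : (bigSigma a p : ℂ) ≠ 0 := Complex.ofReal_ne_zero.2 (bigSigma_pos a hr).ne'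
  have htr := congrArg ((↑) : ℝ → ℂ) (bigSigma_sq_mul_trChi ha hp)
  have heps := congrArg ((↑) : ℝ → ℂ) (bigSigma_sq_mul_epsChi ha hp)
  have hd : bigSigma a p * fderiv ℝ (zeta a) p (e4 M a p) = bigDelta M a p := by
    rw [e4_eq_smul_scaledE4, map_smul, Complex.real_smul, Complex.ofReal_inv,
      mul_inv_cancel_left₀ hS, scaledE4, fderiv_zeta_sph a hr]
    apply Complex.ext <;> simp
  refine mul_left_cancel₀ (mul_ne_zero hS ((map_ne_zero conj).2 (zeta_ne_zero a hr))) ?_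
  push_cast at htr heps
  linear_combination bigSigma a p * (trChi M a p - epsChi M a p * Complex.I) * zeta_mul_conj a p
    + htr - heps * Complex.I - 2 * conj (zeta a p) * hd - 2 * bigDelta M a p * conj_zeta a p

theorem conj_zeta_mul_chiBar (ha : |a| ≤ M) (hp : p ∈ region M a) :
    conj (zeta a p) * (trChiBar M a p - epsChiBar M a p * Complex.I)
      = 2 * fderiv ℝ (fun q => conj (zeta a q)) p (e3 p) := by
  simpa only [fderiv_conj, map_mul, map_add, Complex.conj_ofReal, Complex.conj_I, mul_neg,
    ← sub_eq_add_neg, map_ofNat] using congrArg conj (zeta_mul_chiBar ha hp)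

theorem conj_zeta_mul_chi (ha : |a| ≤ M) (hp : p ∈ region M a) :
    conj (zeta a p) * (trChi M a p + epsChi M a p * Complex.I)
      = 2 * fderiv ℝ (fun q => conj (zeta a q)) p (e4 M a p) := by
  simpa only [fderiv_conj, map_mul, map_sub, Complex.conj_ofReal, Complex.conj_I, mul_neg,
    sub_neg_eq_add, map_ofNat] using congrArg conj (zeta_mul_chi ha hp)

theorem inner4_covAlong_sub (ha : |a| ≤ M) (hp : p ∈ region M a) (A : Fin 2) :
    inner4 M a p (covAlong M a e3 (e4 M a) p) (horField a A p)
      - inner4 M a p (covAlong M a (e4 M a) e3 p) (horField a A p)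
      = ![0, 4 * a * rad p * sinSq p / bigSigma a p] A := by
  rw [← inner4_sub_left, covAlong_sub_covAlong hp ((isTransverse_e3 ha).differentiableAt p hp)
    ((isTransverse_e4 ha).differentiableAt p hp),
    inner4_lieBracket_e3_e4_horField ha (rad_pos_of_mem_region hp)]

theorem IsTransverse.inner4_covAlong_horField {X Y : VecField} (ha : |a| ≤ M)
    (hp : p ∈ region M a) (hX : DifferentiableAt ℝ X p) (hY : IsTransverse M a Y) (A : Fin 2) :
    inner4 M a p (covAlong M a (horField a A) X p) (Y p)
      = -inner4 M a p (covAlong M a X Y p) (horField a A p)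
        - inner4 M a p (lieBracket ℝ X (horField a A) p) (Y p) := by
  have hK := differentiableAt_horField a (rad_pos_of_mem_region hp) A
  have h0 : (fun q => inner4 M a q (Y q) (horField a A q)) =ᶠ[𝓝 p] fun _ => 0 := by
    filter_upwards [(isOpen_region M a).mem_nhds hp] with q hq
    exact hY.orthogonal q hq A
  have h := fderiv_inner4 ha hp X (hY.differentiableAt p hp) hK
  rw [h0.fderiv_eq, fderiv_fun_const, Pi.zero_apply, zero_apply] at h
  rw [← covAlong_sub_covAlong hp hX hK, inner4_sub_left,
    inner4_comm M a p (covAlong M a X (horField a A) p) (Y p)]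
  linear_combination -h

theorem inner4_covAlong_add (ha : |a| ≤ M) (hp : p ∈ region M a) (A : Fin 2) :
    inner4 M a p (covAlong M a e3 (e4 M a) p) (horField a A p)
      + inner4 M a p (covAlong M a (e4 M a) e3 p) (horField a A p)
      = 2 * (fderiv ℝ (bigSigma a) p (horField a A p) / bigSigma a p) := by
  have hr := rad_pos_of_mem_region hp
  have h3 := isTransverse_e3 (M := M) ha
  have h4 := isTransverse_e4 (M := M) ha
  have h0 : (fun q => inner4 M a q (e3 q) (e4 M a q)) =ᶠ[𝓝 p] fun _ => -2 := by
    filter_upwards [(isOpen_region M a).mem_nhds hp] with q hq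
    exact inner4_e3_e4 ha (rad_pos_of_mem_region hq)
  have h := fderiv_inner4 ha hp (horField a A) (h3.differentiableAt p hp)
    (h4.differentiableAt p hp)
  rw [h0.fderiv_eq, fderiv_fun_const, Pi.zero_apply, zero_apply,
    inner4_comm M a p (e3 p) (covAlong _ _ _ _ _),
    h4.inner4_covAlong_horField ha hp (h3.differentiableAt p hp),
    h3.inner4_covAlong_horField ha hp (h4.differentiableAt p hp),
    lieBracket_e3_horField hr, lieBracket_e4_horField M hr, inner4_smul_left,
    inner4_comm M a p (e4 M a p), inner4_e3_e4 ha hr, inner4_zero_left] at h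
  linear_combination h

theorem horiz_flat_dotProduct_horField (ha : |a| ≤ M) (hr : 0 < rad p) (V : VecField) (A : Fin 2) :
    horiz M a (flat M a V) p ⬝ᵥ horField a A p = inner4 M a p (V p) (horField a A p) := by
  rw [horiz_dotProduct_horField ha hr, inner4_eq_mulVec, Matrix.dotProduct_mulVec]
  congr 1
  ext j
  simp only [flat, Matrix.vecMul, dotProduct, mul_comm]

theorem eta_dotProduct_horField (ha : |a| ≤ M) (hr : 0 < rad p) (A : Fin 2) :
    eta M a p ⬝ᵥ horField a A p
      = inner4 M a p (covAlong M a e3 (e4 M a) p) (horField a A p) / 2 := by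
  rw [← horiz_flat_dotProduct_horField ha hr]
  exact (smul_dotProduct (1 / 2 : ℝ) _ _).trans (one_div_mul_eq_div _ _)

theorem etaBar_dotProduct_horField (ha : |a| ≤ M) (hr : 0 < rad p) (A : Fin 2) :
    etaBar M a p ⬝ᵥ horField a A p
      = inner4 M a p (covAlong M a (e4 M a) e3 p) (horField a A p) / 2 := by
  rw [← horiz_flat_dotProduct_horField ha hr]
  exact (smul_dotProduct (1 / 2 : ℝ) _ _).trans (one_div_mul_eq_div _ _)

theorem eta_sub_etaBar_dotProduct_horField (ha : |a| ≤ M) (hp : p ∈ region M a) (A : Fin 2) :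
    eta M a p ⬝ᵥ horField a A p - etaBar M a p ⬝ᵥ horField a A p
      = ![0, 2 * a * rad p * sinSq p / bigSigma a p] A := by
  have hr := rad_pos_of_mem_region hp
  rw [eta_dotProduct_horField ha hr, etaBar_dotProduct_horField ha hr, ← sub_div,
    inner4_covAlong_sub ha hp]
  fin_cases A <;> simp only [Fin.zero_eta, Fin.mk_one, Matrix.cons_val] <;> ring

theorem eta_add_etaBar_dotProduct_horField (ha : |a| ≤ M) (hp : p ∈ region M a) (A : Fin 2) :
    bigSigma a p * ((eta M a + etaBar M a) p ⬝ᵥ horField a A p)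
      = fderiv ℝ (bigSigma a) p (horField a A p) := by
  have hr := rad_pos_of_mem_region hp
  rw [Pi.add_apply, add_dotProduct, eta_dotProduct_horField ha hr,
    etaBar_dotProduct_horField ha hr, ← add_div, inner4_covAlong_add ha hp]
  field_simp [(bigSigma_pos a hr).ne']

theorem bigSigma_mul_spinComp_eta (ha : |a| ≤ M) (hp : p ∈ region M a) :
    bigSigma a p * spinComp a p (eta M a p) = a * sinSq p * Complex.I * zeta a p
      ∧ bigSigma a p * spinComp a p (etaBar M a p)
        = -(a * sinSq p * Complex.I) * conj (zeta a p) := by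
  have hr := rad_pos_of_mem_region hp
  have hS := (bigSigma_pos a hr).ne'
  have hsub (A : Fin 2) := congrArg (bigSigma a p * ·) (eta_sub_etaBar_dotProduct_horField ha hp A)
  have hadd (A : Fin 2) := eta_add_etaBar_dotProduct_horField ha hp A
  have h0 := hsub 0
  have h1 := hsub 1
  have g0 := hadd 0
  have g1 := hadd 1
  simp only [Pi.add_apply, add_dotProduct, horField, fderiv_bigSigma_sph a hr, Matrix.cons_val,
    mul_div_cancel₀ _ hS] at h0 h1 g0 g1
  constructor <;> apply Complex.ext <;> simp [spinComp, zeta, horField] <;> linarith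

theorem spinDeriv_conj_zeta (ha : |a| ≤ M) (hp : p ∈ region M a) :
    spinDeriv a (fun q => conj (zeta a q)) p = conj (zeta a p) * spinComp a p (eta M a p) := by
  have hr := rad_pos_of_mem_region hp
  refine mul_left_cancel₀ (zeta_ne_zero a hr) ?_
  rw [← mul_assoc, zeta_mul_conj, (bigSigma_mul_spinComp_eta ha hp).1, mul_comm]
  congr 1
  apply Complex.ext <;> simp [spinDeriv, fderiv_conj, horField, fderiv_zeta_sph a hr]

theorem spinDeriv_zeta (ha : |a| ≤ M) (hp : p ∈ region M a) :
    spinDeriv a (zeta a) p = zeta a p * spinComp a p (etaBar M a p) := by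
  have hr := rad_pos_of_mem_region hp
  refine mul_left_cancel₀ ((map_ne_zero conj).2 (zeta_ne_zero a hr)) ?_
  rw [← mul_assoc, mul_comm (conj _) (zeta a p), zeta_mul_conj, (bigSigma_mul_spinComp_eta ha hp).2,
    mul_comm]
  congr 1
  apply Complex.ext <;> simp [spinDeriv, horField, fderiv_zeta_sph a hr]

theorem bilin_covForm (hp : p ∈ region M a) (X Y : VecField) {ς : OneForm}
    (hς : DifferentiableAt ℝ ς p) (hY : DifferentiableAt ℝ Y p) :
    bilin (covForm M a ς p) (X p) (Y p)
      = fderiv ℝ (fun q => ς q ⬝ᵥ Y q) p (X p) - ς p ⬝ᵥ covAlong M a X Y p := by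
  rw [← sum_covForm_eq hp X hς hY, bilin_eq_dotProduct, Matrix.dotProduct_mulVec]
  rfl

theorem bilin_covForm_scal (hp : p ∈ region M a) (X Y : VecField) {f : Pt → ℝ} {ς : OneForm}
    (hf : DifferentiableAt ℝ f p) (hς : DifferentiableAt ℝ ς p) (hY : DifferentiableAt ℝ Y p) :
    bilin (covForm M a (scal f ς) p) (X p) (Y p)
      = f p * bilin (covForm M a ς p) (X p) (Y p) + fderiv ℝ f p (X p) * (ς p ⬝ᵥ Y p) := by
  have hd := differentiableAt_dotProduct hς hY
  have h := congrArg (· (X p)) (hf.hasFDerivAt.mul hd.hasFDerivAt).fderiv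
  simp only [add_apply, smul_apply, smul_eq_mul] at h
  have h' : (fun q => scal f ς q ⬝ᵥ Y q) = f * fun q => ς q ⬝ᵥ Y q :=
    funext fun q => smul_dotProduct _ _ _
  rw [bilin_covForm hp X Y (ς := scal f ς) (hf.smul hς) hY, bilin_covForm hp X Y hς hY, h', h, scal,
    smul_dotProduct, smul_eq_mul]
  ring

theorem hDiv_scal_bigSigma (ha : |a| ≤ M) (hp : p ∈ region M a) {ς : OneForm}
    (hς : DifferentiableAt ℝ ς p) :
    hDiv M a (scal (bigSigma a) ς) p
      = bigSigma a p * (hDiv M a ς p + hDot M a (eta M a + etaBar M a) ς p) := by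
  have hr := rad_pos_of_mem_region hp
  refine mul_left_cancel₀ (frameNorm_pos hp).ne' ?_
  rw [mul_left_comm, mul_add (frameNorm a p), frameNorm_mul_hDot ha hr, hDiv, hDiv,
    frameNorm_mul_hTr ha hr, frameNorm_mul_hTr ha hr, mul_add]
  simp only [Finset.mul_sum, ← Finset.sum_add_distrib]
  refine Finset.sum_congr rfl fun A _ => ?_
  rw [bilin_nabTensor ha hr, bilin_nabTensor ha hr, bilin_covForm_scal hp _ _
    (differentiableAt_bigSigma a hr) hς (differentiableAt_horField a hr A),
    ← eta_add_etaBar_dotProduct_horField ha hp, mul_assoc]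

theorem hCurl_scal_bigSigma (ha : |a| ≤ M) (hp : p ∈ region M a) {ς : OneForm}
    (hς : DifferentiableAt ℝ ς p) :
    hCurl M a (scal (bigSigma a) ς) p
      = bigSigma a p * (hCurl M a ς p + hWedge M a (eta M a + etaBar M a) ς p) := by
  have hr := rad_pos_of_mem_region hp
  have h (A B : Fin 2) := bilin_covForm_scal hp (horField a A) (horField a B)
    (differentiableAt_bigSigma a hr) hς (differentiableAt_horField a hr B)
  refine mul_left_cancel₀ (frameNorm_pos hp).ne' ?_
  rw [mul_left_comm, mul_add (frameNorm a p), frameNorm_mul_hWedge ha hp, hCurl, hCurl,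
    frameNorm_mul_epsDot ha hp, frameNorm_mul_epsDot ha hp]
  simp only [bilin_nabTensor ha hr, h, ← eta_add_etaBar_dotProduct_horField ha hp]
  ring

/-! ### Smoothness up to the horizon and across the axis -/

section Smoothness

variable {U : Set Pt}

theorem rad_pos_of_mem_exterior (hM : 0 < M) (hp : p ∈ exterior M a) : 0 < rad p :=
  (add_pos_of_pos_of_nonneg hM (Real.sqrt_nonneg _)).trans_le hp

theorem dR_dotProduct (p q : Pt) :
    dR p ⬝ᵥ q = (p 1 * q 1 + p 2 * q 2 + p 3 * q 3) / rad p := by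
  simp only [dR, dotProduct, Fin.sum_univ_four, Matrix.cons_val]
  ring

theorem dR_dotProduct_self (hr : 0 < rad p) : dR p ⬝ᵥ p = rad p := by
  rw [dR_dotProduct, div_eq_iff hr.ne']
  linarith [rad_sq p]

theorem dR_dotProduct_le_rad (hr : 0 < rad p) (q : Pt) : dR p ⬝ᵥ q ≤ rad q := by
  rw [dR_dotProduct, div_le_iff₀ hr]
  refine le_of_sq_le_sq ?_ (by unfold rad; positivity)
  rw [mul_pow, rad_sq, rad_sq]
  nlinarith [sq_nonneg (p 1 * q 2 - p 2 * q 1), sq_nonneg (p 1 * q 3 - p 3 * q 1),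
    sq_nonneg (p 2 * q 3 - p 3 * q 2)]

/- The exterior is the complement of a convex set; the half-space tangent to it through `p`
already determines derivatives at `p`. -/
theorem uniqueDiffOn_exterior (hM : 0 < M) : UniqueDiffOn ℝ (exterior M a) := by
  intro p hp
  have hr := rad_pos_of_mem_exterior hM hp
  have hsub : {q | rPlus M a ≤ dR p ⬝ᵥ q} ⊆ exterior M a := fun q hq =>
    le_trans hq (dR_dotProduct_le_rad hr q)
  have hconv : Convex ℝ {q | rPlus M a ≤ dR p ⬝ᵥ q} :=
    convex_halfSpace_ge ⟨dotProduct_add _, fun c q => dotProduct_smul c _ q⟩ _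
  have hint : (interior {q | rPlus M a ≤ dR p ⬝ᵥ q}).Nonempty := by
    have hopen : IsOpen {q | rPlus M a < dR p ⬝ᵥ q} :=
      isOpen_lt continuous_const (continuous_const.dotProduct continuous_id)
    have hlt : {q | rPlus M a < dR p ⬝ᵥ q} ⊆ {q | rPlus M a ≤ dR p ⬝ᵥ q} :=
      Set.ofPred_subset_ofPred.2 fun _ => le_of_lt
    refine ⟨(2 : ℝ) • p, interior_maximal hlt hopen ?_⟩
    have : rPlus M a ≤ rad p := hp
    change rPlus M a < dR p ⬝ᵥ ((2 : ℝ) • p)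
    rw [dotProduct_smul, dR_dotProduct_self hr, smul_eq_mul]
    linarith
  exact (uniqueDiffOn_convex hconv hint p (hp.trans_eq (dR_dotProduct_self hr).symm)).mono hsub

/-- Relatively open subsets of the exterior. -/
def IsRelOpen (M a : ℝ) (U : Set Pt) : Prop := ∃ V : Set Pt, IsOpen V ∧ U = V ∩ exterior M a

theorem IsRelOpen.of_isOpen (hU : IsOpen U) (h : U ⊆ region M a) : IsRelOpen M a U :=
  ⟨U, hU, (Set.inter_eq_left.2 (h.trans (region_subset_exterior M a))).symm⟩

theorem IsRelOpen.subset (hU : IsRelOpen M a U) : U ⊆ exterior M a := by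
  obtain ⟨V, -, rfl⟩ := hU
  exact Set.inter_subset_right

theorem IsRelOpen.isOpen_inter_region (hU : IsRelOpen M a U) : IsOpen (U ∩ region M a) := by
  obtain ⟨V, hV, rfl⟩ := hU
  rw [Set.inter_assoc, Set.inter_eq_right.2 (region_subset_exterior M a)]
  exact hV.inter (isOpen_region M a)

theorem exists_forall_add_smul_mem_region (hp : p ∈ exterior M a) :
    ∃ v : Pt, ∀ t : ℝ, 0 < t → p + t • v ∈ region M a := by
  obtain ⟨s, hs, hps⟩ : ∃ s : ℝ, s ^ 2 = 1 ∧ 0 ≤ p 1 * s := by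
    rcases le_total 0 (p 1) with h | h
    exacts [⟨1, by norm_num, by linarith⟩, ⟨-1, by norm_num, by linarith⟩]
  have hlt (t : ℝ) (ht : 0 < t) : p 1 ^ 2 < (p 1 + t * s) ^ 2 := by
    nlinarith [mul_nonneg ht.le hps, mul_pos ht ht]
  refine ⟨![0, s, 0, 0], fun t ht => ⟨lt_of_le_of_lt hp ?_, ?_⟩⟩
  · refine Real.sqrt_lt_sqrt (by positivity) ?_
    simpa using hlt t ht
  · simpa using add_pos_of_pos_of_nonneg ((sq_nonneg _).trans_lt (hlt t ht)) (sq_nonneg (p 2))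

theorem IsRelOpen.subset_closure_inter_region (hU : IsRelOpen M a U) :
    U ⊆ closure (U ∩ region M a) := by
  obtain ⟨V, hV, rfl⟩ := hU
  intro p hp
  obtain ⟨v, hv⟩ := exists_forall_add_smul_mem_region hp.2
  have hlim : Filter.Tendsto (fun t : ℝ => p + t • v) (𝓝[>] 0) (𝓝 p) := by
    have h : Continuous fun t : ℝ => p + t • v := by fun_prop
    simpa using (h.tendsto 0).mono_left nhdsWithin_le_nhds
  refine mem_closure_of_tendsto hlim ?_
  filter_upwards [hlim (hV.mem_nhds hp.1), self_mem_nhdsWithin] with t htV ht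
  exact ⟨⟨htV, region_subset_exterior M a (hv t ht)⟩, hv t ht⟩

theorem IsRelOpen.eqOn_of_eqOn_region (hU : IsRelOpen M a U) {ς τ : OneForm}
    (hς : ContDiffOn ℝ ∞ ς U) (hτ : ContDiffOn ℝ ∞ τ U) (h : Set.EqOn ς τ (U ∩ region M a)) :
    Set.EqOn ς τ U :=
  h.of_subset_closure hς.continuousOn hτ.continuousOn Set.inter_subset_left
    hU.subset_closure_inter_region

theorem contDiffAt_dCosTheta {n : WithTop ℕ∞} (hr : 0 < rad p) (i : Fin 4) :
    ContDiffAt ℝ n (fun q => dCosTheta q i) p := by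
  have h1 := contDiffAt_rad (n := n) hr
  have h3 := h1.pow 3
  have h3' : rad p ^ 3 ≠ 0 := by positivity
  fin_cases i
  · exact contDiffAt_const
  · exact ((contDiffAt_coord _).mul (contDiffAt_coord _)).neg.div h3 h3'
  · exact ((contDiffAt_coord _).mul (contDiffAt_coord _)).neg.div h3 h3'
  · exact (contDiffAt_const.div h1 hr.ne').sub (((contDiffAt_coord _).pow 2).div h3 h3')

theorem contDiffAt_roundArea {n : WithTop ℕ∞} (hr : 0 < rad p) (i j : Fin 4) :
    ContDiffAt ℝ n (fun q => roundArea q i j) p := by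
  refine ContDiffAt.div ?_ ((contDiffAt_rad hr).pow 3) (by positivity)
  fin_cases i <;> fin_cases j <;>
    first
    | exact contDiffAt_const
    | exact contDiffAt_coord _
    | exact (contDiffAt_coord _).neg

theorem contDiffAt_eps {n : WithTop ℕ∞} (a : ℝ) (hr : 0 < rad p) : ContDiffAt ℝ n (eps a) p :=
  contDiffAt_pi.2 fun i => contDiffAt_pi.2 fun j =>
    ((((contDiffAt_rad hr).pow 2).add contDiffAt_const).mul (contDiffAt_roundArea hr i j)).add
      (contDiffAt_const.mul (((contDiffAt_dCosTheta hr i).mul contDiffAt_const).sub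
        (contDiffAt_const.mul (contDiffAt_dCosTheta hr j))))

theorem contDiffAt_horInv {n : WithTop ℕ∞} (a : ℝ) (hr : 0 < rad p) (i j : Fin 4) :
    ContDiffAt ℝ n (fun q => horInv a q i j) p := by
  have hR := contDiffAt_dR (n := n) hr
  have hsph := contDiffAt_pi.1 (contDiffAt_sph hr (n := n) (contDiffAt_const (c := ![0, 0, 0, 1])))
  have hT (i : Fin 4) : ContDiffAt ℝ n (fun q => dT q i) p := contDiffAt_const
  have hsin : ContDiffAt ℝ n sinSq p := contDiffAt_const.sub ((contDiffAt_cosTheta hr).pow 2)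
  exact ((((contDiffAt_rad hr).pow 2).mul (contDiffAt_const.sub ((hR i).mul (hR j)))).add
    (contDiffAt_const.mul (((hT i).mul (hsph j)).add ((hsph i).mul (hT j))))
    |>.add ((contDiffAt_const.mul hsin).mul ((hT i).mul (hT j)))).div (contDiffAt_bigSigma a hr)
    (bigSigma_pos a hr).ne'

theorem contDiffOn_tensor {θ : TwoTensor} :
    ContDiffOn ℝ ∞ θ U ↔ ∀ i j, ContDiffOn ℝ ∞ (fun p => θ p i j) U := by
  simp only [contDiffOn_pi]

theorem contDiffOn_scal {f : Pt → ℝ} {ς : OneForm} (hf : ContDiffOn ℝ ∞ f U)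
    (hς : ContDiffOn ℝ ∞ ς U) : ContDiffOn ℝ ∞ (scal f ς) U :=
  hf.smul hς

variable (hM : 0 < M) (hU : IsRelOpen M a U)

include hM hU

theorem contDiffOn_pd {f : Pt → ℝ} (hf : ContDiffOn ℝ ∞ f U) (i : Fin 4) :
    ContDiffOn ℝ ∞ (pd M a i f) U := by
  obtain ⟨V, hV, rfl⟩ := hU
  have hdiff : UniqueDiffOn ℝ (V ∩ exterior M a) :=
    Set.inter_comm V _ ▸ (uniqueDiffOn_exterior hM).inter hV
  refine ((hf.fderivWithin (m := ∞) hdiff (by simp)).clm_apply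
    (contDiffOn_const (c := Pi.single i 1))).congr fun p hp => ?_
  rw [pd, Set.inter_comm, fderivWithin_inter (hV.mem_nhds hp.1)]

theorem contDiffOn_of_rad_pos {E : Type*} [NormedAddCommGroup E] [NormedSpace ℝ E] {f : Pt → E}
    (hf : ∀ p, 0 < rad p → ContDiffAt ℝ ∞ f p) : ContDiffOn ℝ ∞ f U := fun p hp =>
  (hf p (rad_pos_of_mem_exterior hM (hU.subset hp))).contDiffWithinAt

theorem contDiffOn_metric (i j : Fin 4) : ContDiffOn ℝ ∞ (fun p => metric M a p i j) U :=
  contDiffOn_of_rad_pos hM hU fun _ hr => contDiffAt_metric M a hr i j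

theorem contDiffOn_e3 : ContDiffOn ℝ ∞ e3 U :=
  contDiffOn_of_rad_pos hM hU fun _ hr => contDiffAt_e3 hr

theorem contDiffOn_e4 : ContDiffOn ℝ ∞ (e4 M a) U :=
  contDiffOn_of_rad_pos hM hU fun _ hr => contDiffAt_e4 M a hr

theorem contDiffOn_eps : ContDiffOn ℝ ∞ (eps a) U :=
  contDiffOn_of_rad_pos hM hU fun _ hr => contDiffAt_eps a hr

theorem contDiffOn_bigSigma : ContDiffOn ℝ ∞ (bigSigma a) U :=
  contDiffOn_of_rad_pos hM hU fun _ hr => contDiffAt_bigSigma a hr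

theorem contDiffOn_one_div_bigSigma : ContDiffOn ℝ ∞ (fun p => 1 / bigSigma a p) U :=
  contDiffOn_const.div (contDiffOn_bigSigma hM hU)
    fun _ hp => (bigSigma_pos a (rad_pos_of_mem_exterior hM (hU.subset hp))).ne'

theorem contDiffOn_flat {V : VecField} (hV : ContDiffOn ℝ ∞ V U) :
    ContDiffOn ℝ ∞ (flat M a V) U :=
  contDiffOn_pi.2 fun j => ContDiffOn.sum fun i _ =>
    (contDiffOn_metric hM hU i j).mul (contDiffOn_pi.1 hV i)

theorem contDiffOn_proj : ContDiffOn ℝ ∞ (proj M a) U :=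
  have h3 := contDiffOn_e3 hM hU
  have h4 := contDiffOn_e4 hM hU
  contDiffOn_tensor.2 fun i j => contDiffOn_const.add (contDiffOn_const.mul
    (((contDiffOn_pi.1 h3 i).mul (contDiffOn_pi.1 (contDiffOn_flat hM hU h4) j)).add
      ((contDiffOn_pi.1 h4 i).mul (contDiffOn_pi.1 (contDiffOn_flat hM hU h3) j))))

theorem contDiffOn_horiz {ς : OneForm} (hς : ContDiffOn ℝ ∞ ς U) :
    ContDiffOn ℝ ∞ (horiz M a ς) U :=
  contDiffOn_pi.2 fun j => ContDiffOn.sum fun k _ =>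
    (contDiffOn_pi.1 hς k).mul (contDiffOn_tensor.1 (contDiffOn_proj hM hU) k j)

theorem contDiffOn_gradShift {τ : OneForm} {f : Pt → ℝ} (hτ : ContDiffOn ℝ ∞ τ U)
    (hf : ContDiffOn ℝ ∞ f U) : ContDiffOn ℝ ∞ (gradShift M a τ f) U :=
  (contDiffOn_horiz hM hU (contDiffOn_pi.2 (contDiffOn_pd hM hU hf))).add
    ((contDiffOn_const.mul hf).smul hτ)

variable (ha : |a| ≤ M)

include ha

theorem contDiffOn_hInv : ContDiffOn ℝ ∞ (hInv M a) U :=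
  contDiffOn_tensor.2 fun i j =>
    (contDiffOn_of_rad_pos hM hU fun _ hr => contDiffAt_horInv a hr i j).congr fun _ hp =>
      hInv_eq_horInv ha (rad_pos_of_mem_exterior hM (hU.subset hp)) i j

theorem contDiffOn_metricInv (i j : Fin 4) : ContDiffOn ℝ ∞ (fun p => metricInv M a p i j) U :=
  have h3 := contDiffOn_pi.1 (contDiffOn_e3 hM hU)
  have h4 := contDiffOn_pi.1 (contDiffOn_e4 hM hU)
  ((contDiffOn_tensor.1 (contDiffOn_hInv hM hU ha) i j).sub
    (contDiffOn_const.mul (((h3 i).mul (h4 j)).add ((h4 i).mul (h3 j))))).congr fun _ _ =>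
      eq_sub_of_add_eq rfl

theorem contDiffOn_christoffel (k i j : Fin 4) : ContDiffOn ℝ ∞ (christoffel M a k i j) U :=
  have hpd (i j : Fin 4) := contDiffOn_pd hM hU (contDiffOn_metric hM hU i j)
  contDiffOn_const.mul (ContDiffOn.sum fun l _ => (contDiffOn_metricInv hM hU ha k l).mul
    (((hpd j l i).add (hpd i l j)).sub (hpd i j l)))

theorem contDiffOn_covVec {V : VecField} (hV : ContDiffOn ℝ ∞ V U) :
    ContDiffOn ℝ ∞ (covVec M a V) U :=
  contDiffOn_tensor.2 fun i k => (contDiffOn_pd hM hU (contDiffOn_pi.1 hV k) i).add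
    (ContDiffOn.sum fun j _ => (contDiffOn_christoffel hM hU ha k i j).mul (contDiffOn_pi.1 hV j))

theorem contDiffOn_covForm {ς : OneForm} (hς : ContDiffOn ℝ ∞ ς U) :
    ContDiffOn ℝ ∞ (covForm M a ς) U :=
  contDiffOn_tensor.2 fun i j => (contDiffOn_pd hM hU (contDiffOn_pi.1 hς j) i).sub
    (ContDiffOn.sum fun k _ => (contDiffOn_christoffel hM hU ha k i j).mul (contDiffOn_pi.1 hς k))

theorem contDiffOn_epsUp : ContDiffOn ℝ ∞ (epsUp M a) U :=
  have h := contDiffOn_tensor.1 (contDiffOn_hInv hM hU ha)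
  contDiffOn_tensor.2 fun i j => ContDiffOn.sum fun k _ => ContDiffOn.sum fun l _ =>
    ((h i k).mul (h j l)).mul (contDiffOn_tensor.1 (contDiffOn_eps hM hU) k l)

theorem contDiffOn_hStar {ς : OneForm} (hς : ContDiffOn ℝ ∞ ς U) :
    ContDiffOn ℝ ∞ (hStar M a ς) U :=
  contDiffOn_pi.2 fun i => ContDiffOn.sum fun j _ => ContDiffOn.sum fun k _ =>
    ((contDiffOn_tensor.1 (contDiffOn_eps hM hU) i k).mul
      (contDiffOn_tensor.1 (contDiffOn_hInv hM hU ha) j k)).mul (contDiffOn_pi.1 hς j)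

theorem contDiffOn_hTr {θ : TwoTensor} (hθ : ContDiffOn ℝ ∞ θ U) : ContDiffOn ℝ ∞ (hTr M a θ) U :=
  ContDiffOn.sum fun i _ => ContDiffOn.sum fun j _ =>
    (contDiffOn_tensor.1 (contDiffOn_hInv hM hU ha) i j).mul (contDiffOn_tensor.1 hθ i j)

theorem contDiffOn_epsDot {θ : TwoTensor} (hθ : ContDiffOn ℝ ∞ θ U) :
    ContDiffOn ℝ ∞ (epsDot M a θ) U :=
  ContDiffOn.sum fun i _ => ContDiffOn.sum fun j _ =>
    (contDiffOn_tensor.1 (contDiffOn_epsUp hM hU ha) i j).mul (contDiffOn_tensor.1 hθ i j)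

theorem contDiffOn_covAlong {X V : VecField} (hX : ContDiffOn ℝ ∞ X U)
    (hV : ContDiffOn ℝ ∞ V U) : ContDiffOn ℝ ∞ (covAlong M a X V) U :=
  contDiffOn_pi.2 fun k => ContDiffOn.sum fun i _ =>
    (contDiffOn_pi.1 hX i).mul (contDiffOn_tensor.1 (contDiffOn_covVec hM hU ha hV) i k)

theorem contDiffOn_secondFund {V : VecField} (hV : ContDiffOn ℝ ∞ V U) :
    ContDiffOn ℝ ∞ (secondFund M a V) U :=
  have hproj := contDiffOn_tensor.1 (contDiffOn_proj hM hU)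
  contDiffOn_tensor.2 fun i j => ContDiffOn.sum fun k _ => ContDiffOn.sum fun l _ =>
    ContDiffOn.sum fun m _ => (((hproj k i).mul (hproj l j)).mul (contDiffOn_metric hM hU m l)).mul
      (contDiffOn_tensor.1 (contDiffOn_covVec hM hU ha hV) k m)

theorem contDiffOn_eta : ContDiffOn ℝ ∞ (eta M a) U :=
  (contDiffOn_const (c := (1 / 2 : ℝ))).smul (contDiffOn_horiz hM hU (contDiffOn_flat hM hU
    (contDiffOn_covAlong hM hU ha (contDiffOn_e3 hM hU) (contDiffOn_e4 hM hU))))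

theorem contDiffOn_etaBar : ContDiffOn ℝ ∞ (etaBar M a) U :=
  (contDiffOn_const (c := (1 / 2 : ℝ))).smul (contDiffOn_horiz hM hU (contDiffOn_flat hM hU
    (contDiffOn_covAlong hM hU ha (contDiffOn_e4 hM hU) (contDiffOn_e3 hM hU))))

theorem contDiffOn_omegaHat : ContDiffOn ℝ ∞ (omegaHat M a) U :=
  have h4 := contDiffOn_e4 hM hU
  have h := contDiffOn_covAlong hM hU ha h4 (contDiffOn_e3 hM hU)
  contDiffOn_const.mul (ContDiffOn.sum fun i _ => ContDiffOn.sum fun j _ =>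
    ((contDiffOn_metric hM hU i j).mul (contDiffOn_pi.1 h i)).mul (contDiffOn_pi.1 h4 j))

theorem contDiffOn_nab {X : VecField} {ς : OneForm} (hX : ContDiffOn ℝ ∞ X U)
    (hς : ContDiffOn ℝ ∞ ς U) : ContDiffOn ℝ ∞ (nab M a X ς) U :=
  contDiffOn_horiz hM hU (contDiffOn_pi.2 fun j => ContDiffOn.sum fun i _ =>
    (contDiffOn_pi.1 hX i).mul (contDiffOn_tensor.1 (contDiffOn_covForm hM hU ha hς) i j))

theorem contDiffOn_nabTensor {ς : OneForm} (hς : ContDiffOn ℝ ∞ ς U) :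
    ContDiffOn ℝ ∞ (nabTensor M a ς) U :=
  have hproj := contDiffOn_tensor.1 (contDiffOn_proj hM hU)
  contDiffOn_tensor.2 fun i j => ContDiffOn.sum fun k _ => ContDiffOn.sum fun l _ =>
    ((hproj k i).mul (hproj l j)).mul (contDiffOn_tensor.1 (contDiffOn_covForm hM hU ha hς) k l)

theorem contDiffOn_hDiv {ς : OneForm} (hς : ContDiffOn ℝ ∞ ς U) : ContDiffOn ℝ ∞ (hDiv M a ς) U :=
  contDiffOn_hTr hM hU ha (contDiffOn_nabTensor hM hU ha hς)

theorem contDiffOn_hCurl {ς : OneForm} (hς : ContDiffOn ℝ ∞ ς U) :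
    ContDiffOn ℝ ∞ (hCurl M a ς) U :=
  contDiffOn_epsDot hM hU ha (contDiffOn_nabTensor hM hU ha hς)

theorem contDiffOn_op3 (c d : ℝ) {ς : OneForm} (hς : ContDiffOn ℝ ∞ ς U) :
    ContDiffOn ℝ ∞ (op3 M a c d ς) U :=
  have hchi := contDiffOn_secondFund hM hU ha (contDiffOn_e3 hM hU)
  ((contDiffOn_nab hM hU ha (contDiffOn_e3 hM hU) hς).add
    ((contDiffOn_const.mul (contDiffOn_hTr hM hU ha hchi)).smul hς)).add
    ((contDiffOn_const.mul (contDiffOn_epsDot hM hU ha hchi)).smul (contDiffOn_hStar hM hU ha hς))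

theorem contDiffOn_op4 (c d : ℝ) {ς : OneForm} (hς : ContDiffOn ℝ ∞ ς U) :
    ContDiffOn ℝ ∞ (op4 M a c d ς) U :=
  have hchi := contDiffOn_secondFund hM hU ha (contDiffOn_e4 hM hU)
  ((contDiffOn_nab hM hU ha (contDiffOn_e4 hM hU) hς).add
    ((contDiffOn_const.mul (contDiffOn_hTr hM hU ha hchi)).smul hς)).add
    ((contDiffOn_const.mul (contDiffOn_epsDot hM hU ha hchi)).smul (contDiffOn_hStar hM hU ha hς))

theorem contDiffOn_gradShift_hDiv {τ ς : OneForm} (hτ : ContDiffOn ℝ ∞ τ U)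
    (hς : ContDiffOn ℝ ∞ ς U) : ContDiffOn ℝ ∞ (gradShift M a τ (hDiv M a ς)) U :=
  contDiffOn_gradShift hM hU hτ (contDiffOn_hDiv hM hU ha hς)

theorem contDiffOn_hStar_gradShift_hCurl {τ ς : OneForm} (hτ : ContDiffOn ℝ ∞ τ U)
    (hς : ContDiffOn ℝ ∞ ς U) :
    ContDiffOn ℝ ∞ (hStar M a (gradShift M a τ (hCurl M a ς))) U :=
  contDiffOn_hStar hM hU ha
    (contDiffOn_gradShift hM hU hτ (contDiffOn_hCurl hM hU ha hς))

end Smoothness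

/-! ### The Maxwell system -/

/-- The covectors at `p` annihilating `e₃` and `e₄`. -/
def horizontalCovectors (M a : ℝ) (p : Pt) : Submodule ℝ (Fin 4 → ℝ) where
  carrier := {w | w ⬝ᵥ e3 p = 0 ∧ w ⬝ᵥ e4 M a p = 0}
  add_mem' hv hw := by simp [add_dotProduct, hv.1, hv.2, hw.1, hw.2]
  zero_mem' := by simp
  smul_mem' c w hw := by simp [hw.1, hw.2]

section Horizontal

variable {ς : OneForm} {U : Set Pt}

theorem spinComp_injOn (ha : |a| ≤ M) (hp : p ∈ region M a) :
    Set.InjOn (spinComp a p) (horizontalCovectors M a p) := by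
  intro v hv w hw h
  have hz : spinComp a p (v - w) = 0 := by rw [map_sub, h, sub_self]
  have hh : IsHorizontal M a {p} fun _ => v - w := by
    rintro q rfl
    exact sub_mem hv hw
  refine sub_eq_zero.1 (hh.eq_zero ha rfl hp fun A => ?_)
  fin_cases A
  exacts [congrArg Complex.re hz, congrArg Complex.im hz]

theorem horiz_mem (ha : |a| ≤ M) (hp : p ∈ region M a) (ς : OneForm) :
    horiz M a ς p ∈ horizontalCovectors M a p :=
  isHorizontal_horiz ha ς p hp

theorem hStar_mem (ha : |a| ≤ M) (hp : p ∈ region M a) (ς : OneForm) :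
    hStar M a ς p ∈ horizontalCovectors M a p :=
  isHorizontal_hStar ha ς p hp

theorem gradShift_eta_mem (ha : |a| ≤ M) (hp : p ∈ region M a) (f : Pt → ℝ) :
    gradShift M a (eta M a) f p ∈ horizontalCovectors M a p :=
  add_mem (horiz_mem ha hp _) (Submodule.smul_mem _ _
    (Submodule.smul_mem _ (1 / 2 : ℝ) (horiz_mem ha hp _)))

theorem gradShift_etaBar_mem (ha : |a| ≤ M) (hp : p ∈ region M a) (f : Pt → ℝ) :
    gradShift M a (etaBar M a) f p ∈ horizontalCovectors M a p :=
  add_mem (horiz_mem ha hp _) (Submodule.smul_mem _ _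
    (Submodule.smul_mem _ (1 / 2 : ℝ) (horiz_mem ha hp _)))

theorem IsHorizontal.add {τ : OneForm} (hς : IsHorizontal M a U ς) (hτ : IsHorizontal M a U τ) :
    IsHorizontal M a U (ς + τ) :=
  fun p hp => (horizontalCovectors M a p).add_mem (hς p hp) (hτ p hp)

theorem IsHorizontal.scal (hς : IsHorizontal M a U ς) (f : Pt → ℝ) :
    IsHorizontal M a U (scal f ς) :=
  fun p hp => (horizontalCovectors M a p).smul_mem (f p) (hς p hp)

theorem IsHorizontal.op3 (hς : IsHorizontal M a U ς) (ha : |a| ≤ M) (hU : U ⊆ region M a)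
    (c d : ℝ) : IsHorizontal M a U (op3 M a c d ς) := fun p hp =>
  (horizontalCovectors M a p).add_mem ((horizontalCovectors M a p).add_mem
    (horiz_mem ha (hU hp) _) (Submodule.smul_mem _ _ (hς p hp)))
    (Submodule.smul_mem _ _ (hStar_mem ha (hU hp) ς))

theorem IsHorizontal.op4 (hς : IsHorizontal M a U ς) (ha : |a| ≤ M) (hU : U ⊆ region M a)
    (c d : ℝ) : IsHorizontal M a U (op4 M a c d ς) := fun p hp =>
  (horizontalCovectors M a p).add_mem ((horizontalCovectors M a p).add_mem
    (horiz_mem ha (hU hp) _) (Submodule.smul_mem _ _ (hς p hp)))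
    (Submodule.smul_mem _ _ (hStar_mem ha (hU hp) ς))

namespace IsTransverse

variable {X : VecField} {w w' : Pt → ℂ}

theorem sq_mul_spinComp_shift (hX : IsTransverse M a X) (ha : |a| ≤ M)
    (hp : p ∈ region M a) (hpU : p ∈ U) (hς : IsHorizontal M a U ς)
    (hd : ContDiffAt ℝ ∞ ς p) (hw : DifferentiableAt ℝ w p)
    (hwX : w p * (hTr M a (secondFund M a X) p + epsDot M a (secondFund M a X) p * Complex.I)
      = 2 * fderiv ℝ w p (X p)) :
    w p ^ 2 * spinComp a p (nab M a X ς p + (3 / 2 * hTr M a (secondFund M a X) p) • ς p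
        + (-(1 / 2) * epsDot M a (secondFund M a X) p) • hStar M a ς p)
      = fderiv ℝ (fun q => w q ^ 2 * spinComp a q (ς q)) p (X p) := by
  have hc := (contDiffAt_spinComp a (rad_pos_of_mem_region hp) hd).differentiableAt (by simp)
  rw [fderiv_sq_mul hw hc,
    hX.spinComp_shift ha hp hpU hς (hd.differentiableAt (by simp)) (3 / 2) (-(1 / 2))]
  push_cast
  linear_combination w p * spinComp a p (ς p) * hwX

theorem mul_spinComp_shift_scal (hX : IsTransverse M a X) (ha : |a| ≤ M)
    (hp : p ∈ region M a) (hpU : p ∈ U) (hς : IsHorizontal M a U ς)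
    (hd : ContDiffAt ℝ ∞ ς p) (hw : DifferentiableAt ℝ w p) (hw' : DifferentiableAt ℝ w' p)
    (hS : ∀ q, (bigSigma a q : ℂ) = w q * w' q)
    (hwX : w p * (hTr M a (secondFund M a X) p - epsDot M a (secondFund M a X) p * Complex.I)
      = 2 * fderiv ℝ w p (X p))
    (hwX' : w' p * (hTr M a (secondFund M a X) p + epsDot M a (secondFund M a X) p * Complex.I)
      = 2 * fderiv ℝ w' p (X p)) :
    w p * spinComp a p (nab M a X (scal (bigSigma a) ς) p
        + (1 / 2 * hTr M a (secondFund M a X) p) • scal (bigSigma a) ς p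
        + (3 / 2 * epsDot M a (secondFund M a X) p) •
          hStar M a (scal (bigSigma a) ς) p)
      = w' p * fderiv ℝ (fun q => w q ^ 2 * spinComp a q (ς q)) p (X p) := by
  have hr := rad_pos_of_mem_region hp
  have hc := (contDiffAt_spinComp a hr hd).differentiableAt (by simp)
  have hds : DifferentiableAt ℝ (scal (bigSigma a) ς) p :=
    (differentiableAt_bigSigma a hr).smul (hd.differentiableAt (by simp))
  have hsc (q : Pt) : spinComp a q (scal (bigSigma a) ς q)
      = w q * w' q * spinComp a q (ς q) := by
    rw [scal, map_smul, Complex.real_smul, hS]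
  have hprod : HasFDerivAt (fun q => w q * w' q * spinComp a q (ς q)) _ p :=
    (hw.hasFDerivAt.mul hw'.hasFDerivAt).mul hc.hasFDerivAt
  rw [fderiv_sq_mul hw hc, hX.spinComp_shift ha hp hpU (hς.scal _) hds (1 / 2) (3 / 2)]
  simp only [hsc, hprod.fderiv, add_apply, smul_apply, smul_eq_mul,
    Pi.mul_apply]
  push_cast
  linear_combination (w p * w' p * hwX - w p ^ 2 * hwX') * spinComp a p (ς p) / 2

end IsTransverse

end Horizontal

section Commutator

variable {X : VecField} {ψ : Pt → ℂ}

theorem fderiv_spinDeriv_comm (hr : 0 < rad p) (hX : DifferentiableAt ℝ X p)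
    (hXK : ∀ A, lieBracket ℝ X (horField a A) p = 0) (hψ : ContDiffAt ℝ 2 ψ p) :
    fderiv ℝ (spinDeriv a ψ) p (X p) = spinDeriv a (fun q => fderiv ℝ ψ q (X q)) p := by
  have hdψ : DifferentiableAt ℝ (fderiv ℝ ψ) p :=
    (hψ.fderiv_right (m := 1) one_add_one_eq_two.le).differentiableAt one_ne_zero
  have hK := differentiableAt_horField a hr
  have hdK (A : Fin 2) : DifferentiableAt ℝ (fun q => fderiv ℝ ψ q (horField a A q)) p :=
    hdψ.clm_apply (hK A)
  have hcomm (A : Fin 2) : fderiv ℝ (fun q => fderiv ℝ ψ q (horField a A q)) p (X p)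
      = fderiv ℝ (fun q => fderiv ℝ ψ q (X q)) p (horField a A p) := by
    have h := fderiv_apply_lieBracket hψ (by simp) (hK A) hX
    rwa [hXK, map_zero, eq_comm, sub_eq_zero] at h
  have hsum : HasFDerivAt (spinDeriv a ψ) _ p :=
    (hdK 0).hasFDerivAt.add ((hdK 1).hasFDerivAt.mul_const Complex.I)
  rw [hsum.fderiv, spinDeriv, ← hcomm, ← hcomm]
  simp only [add_apply, smul_apply, smul_eq_mul, mul_comm Complex.I]

theorem fderiv_e3_spinDeriv (hr : 0 < rad p) (hψ : ContDiffAt ℝ 2 ψ p) :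
    fderiv ℝ (spinDeriv a ψ) p (e3 p) = spinDeriv a (fun q => fderiv ℝ ψ q (e3 q)) p :=
  fderiv_spinDeriv_comm hr ((contDiffAt_e3 (n := 1) hr).differentiableAt one_ne_zero)
    (lieBracket_e3_horField hr a) hψ

theorem fderiv_scaledE4_spinDeriv (hr : 0 < rad p) (hψ : ContDiffAt ℝ 2 ψ p) :
    fderiv ℝ (spinDeriv a ψ) p (scaledE4 M a p)
      = spinDeriv a (fun q => fderiv ℝ ψ q (scaledE4 M a q)) p :=
  fderiv_spinDeriv_comm hr ((contDiffAt_scaledE4 (n := 1) M a hr).differentiableAt one_ne_zero)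
    (lieBracket_scaledE4_horField M hr a) hψ

end Commutator

theorem contDiffAt_weightedPair {w : Pt → ℂ} {f g : Pt → ℝ} (hw : ContDiffAt ℝ ∞ w p)
    (hf : ContDiffAt ℝ ∞ f p) (hg : ContDiffAt ℝ ∞ g p) (z : ℂ) :
    ContDiffAt ℝ ∞ (weightedPair w z f g) p :=
  have h {k : Pt → ℝ} (hk : ContDiffAt ℝ ∞ k p) : ContDiffAt ℝ ∞ (fun q => (k q : ℂ)) p :=
    Complex.ofRealCLM.contDiff.contDiffAt.comp p hk
  (hw.pow 2).mul ((h hf).add (contDiffAt_const.mul (h hg)))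

theorem fderiv_weightedPair {w : Pt → ℂ} {f g : Pt → ℝ} (hw : DifferentiableAt ℝ w p)
    (hf : DifferentiableAt ℝ f p) (hg : DifferentiableAt ℝ g p) (z : ℂ) {c : ℂ} {v : Fin 4 → ℝ}
    (hc : w p * c = 2 * fderiv ℝ w p v) :
    fderiv ℝ (weightedPair w z f g) p v
      = w p ^ 2 * (fderiv ℝ f p v + z * fderiv ℝ g p v + c * (f p + z * g p)) := by
  have hf' := hasFDerivAt_ofReal hf
  have hg' := hasFDerivAt_ofReal hg
  have hfg : HasFDerivAt (fun q => (f q + z * g q : ℂ)) _ p := hf'.add (hg'.const_mul z)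
  refine (fderiv_sq_mul hw hfg.differentiableAt v).trans ?_
  rw [hfg.fderiv]
  simp only [add_apply, smul_apply, ContinuousLinearMap.comp_apply, Complex.ofRealCLM_apply,
    smul_eq_mul]
  linear_combination -w p * (f p + z * g p) * hc

section Maxwell

variable {U : Set Pt} {α αb : OneForm} {ρ σ : Pt → ℝ}

theorem IsMaxwellSolution.mono {V : Set Pt} (h : IsMaxwellSolution M a U α αb ρ σ) (hV : V ⊆ U) :
    IsMaxwellSolution M a V α αb ρ σ where
  smooth_alpha := h.smooth_alpha.mono hV
  smooth_alphaBar := h.smooth_alphaBar.mono hV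
  smooth_rho := h.smooth_rho.mono hV
  smooth_sigma := h.smooth_sigma.mono hV
  horizontal_alpha p hp := h.horizontal_alpha p (hV hp)
  horizontal_alphaBar p hp := h.horizontal_alphaBar p (hV hp)
  e3_sigma p hp := h.e3_sigma p (hV hp)
  e3_rho p hp := h.e3_rho p (hV hp)
  e4_sigma p hp := h.e4_sigma p (hV hp)
  e4_rho p hp := h.e4_rho p (hV hp)
  e3_alpha p hp := h.e3_alpha p (hV hp)
  e4_alphaBar p hp := h.e4_alphaBar p (hV hp)

namespace IsMaxwellSolution

variable (h : IsMaxwellSolution M a U α αb ρ σ) (hM : 0 < M) (ha : |a| ≤ M) (hU : IsOpen U)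
  (hreg : U ⊆ region M a) (hp : p ∈ U)

include h hU hreg hp

theorem fderiv_e3_weightedPair {w : Pt → ℂ} {z : ℂ} (hw : DifferentiableAt ℝ w p)
    (hz : z ^ 2 = -1)
    (hwz : w p * (trChiBar M a p + z * epsChiBar M a p) = 2 * fderiv ℝ w p (e3 p)) :
    fderiv ℝ (weightedPair w z ρ σ) p (e3 p)
      = -weightedPair w z (hDiv M a αb) (hCurl M a αb) p := by
  have hρ := (h.smooth_rho.contDiffAt (hU.mem_nhds hp)).differentiableAt (by simp)
  have hσ := (h.smooth_sigma.contDiffAt (hU.mem_nhds hp)).differentiableAt (by simp)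
  have eρ := congrArg ((↑) : ℝ → ℂ) (h.e3_rho p hp)
  have eσ := congrArg ((↑) : ℝ → ℂ) (h.e3_sigma p hp)
  rw [dirDeriv, sum_mul_pd (hreg hp)] at eρ eσ
  rw [fderiv_weightedPair hw hρ hσ z hwz, weightedPair]
  push_cast at eρ eσ
  linear_combination w p ^ 2 * (eρ + z * eσ + epsChiBar M a p * σ p * hz)

include ha

theorem fderiv_scaledE4_weightedPair {w : Pt → ℂ} {z : ℂ} (hw : DifferentiableAt ℝ w p)
    (hz : z ^ 2 = -1)
    (hwz : w p * (trChi M a p - z * epsChi M a p) = 2 * fderiv ℝ w p (e4 M a p)) :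
    fderiv ℝ (weightedPair w z ρ σ) p (scaledE4 M a p)
      = weightedPair w (-z) (hDiv M a (scal (bigSigma a) α))
          (hCurl M a (scal (bigSigma a) α)) p := by
  have hρ := (h.smooth_rho.contDiffAt (hU.mem_nhds hp)).differentiableAt (by simp)
  have hσ := (h.smooth_sigma.contDiffAt (hU.mem_nhds hp)).differentiableAt (by simp)
  have hα := (h.smooth_alpha.contDiffAt (hU.mem_nhds hp)).differentiableAt (by simp)
  have eρ := congrArg ((↑) : ℝ → ℂ) (h.e4_rho p hp)
  have eσ := congrArg ((↑) : ℝ → ℂ) (h.e4_sigma p hp)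
  rw [dirDeriv, sum_mul_pd (hreg hp)] at eρ eσ
  rw [fderiv_scaledE4_eq M (rad_pos_of_mem_region (hreg hp)), fderiv_weightedPair hw hρ hσ z hwz,
    weightedPair,
    hDiv_scal_bigSigma ha (hreg hp) hα, hCurl_scal_bigSigma ha (hreg hp) hα]
  push_cast at eρ eσ ⊢
  linear_combination bigSigma a p * w p ^ 2 * (eρ + z * eσ - epsChi M a p * σ p * hz)

theorem sq_mul_spinComp_op3 :
    conj (zeta a p) ^ 2 * spinComp a p (op3 M a (1 / 2) (1 / 2) α p)
      = spinDeriv a (weightedPair (fun q => conj (zeta a q)) (-Complex.I) ρ σ) p := by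
  have hr := rad_pos_of_mem_region (hreg hp)
  have hρ := (h.smooth_rho.contDiffAt (hU.mem_nhds hp)).differentiableAt (by simp)
  have hσ := (h.smooth_sigma.contDiffAt (hU.mem_nhds hp)).differentiableAt (by simp)
  have hop : spinComp a p (op3 M a (1 / 2) (1 / 2) α p)
      = spinComp a p (nab M a e3 α p + sharpDot M a (chiBar M a) α p) :=
    (isTransverse_e3 ha).spinComp_shift_half ha (hreg hp) α
  refine Eq.trans ?_ (sq_mul_spinComp_gradShift ha (hreg hp) (differentiableAt_zeta a hr).star
    (spinDeriv_conj_zeta ha (hreg hp)) hρ hσ (-Complex.I))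
  rw [hop, h.e3_alpha p hp]
  simp only [gradShift, map_add, map_smul, spinComp_hStar ha (hreg hp), Complex.real_smul]
  simp only [starRingEnd_apply]
  ring

theorem sq_mul_spinComp_op4 :
    zeta a p ^ 2 * spinComp a p ((op4 M a (1 / 2) (1 / 2) αb + scal (omegaHat M a) αb) p)
      = -spinDeriv a (weightedPair (zeta a) Complex.I ρ σ) p := by
  have hr := rad_pos_of_mem_region (hreg hp)
  have hρ := (h.smooth_rho.contDiffAt (hU.mem_nhds hp)).differentiableAt (by simp)
  have hσ := (h.smooth_sigma.contDiffAt (hU.mem_nhds hp)).differentiableAt (by simp)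
  have hop : spinComp a p (op4 M a (1 / 2) (1 / 2) αb p)
      = spinComp a p (nab M a (e4 M a) αb p + sharpDot M a (chi M a) αb p) :=
    (isTransverse_e4 ha).spinComp_shift_half ha (hreg hp) αb
  refine Eq.trans ?_ (congrArg Neg.neg (sq_mul_spinComp_gradShift ha (hreg hp)
    (differentiableAt_zeta a hr) (spinDeriv_zeta ha (hreg hp)) hρ hσ Complex.I))
  rw [Pi.add_apply, map_add, hop, ← map_add, scal, h.e4_alphaBar p hp]
  simp only [gradShift, map_add, map_sub, map_neg, map_smul, spinComp_hStar ha (hreg hp),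
    Complex.real_smul]
  ring

include hM

theorem fderiv_e3_spinDeriv_weightedPair {w : Pt → ℂ} {z : ℂ} {τ : OneForm}
    (hw : ∀ q ∈ U, ContDiffAt ℝ ∞ w q) (hz : z ^ 2 = -1)
    (hwz : ∀ q ∈ U, w q * (trChiBar M a q + z * epsChiBar M a q) = 2 * fderiv ℝ w q (e3 q))
    (hτ : spinDeriv a w p = w p * spinComp a p (τ p)) :
    fderiv ℝ (spinDeriv a (weightedPair w z ρ σ)) p (e3 p)
      = -(w p ^ 2 * (spinComp a p (gradShift M a τ (hDiv M a αb) p)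
        + z * spinComp a p (gradShift M a τ (hCurl M a αb) p))) := by
  have hd := (contDiffOn_hDiv hM (.of_isOpen hU hreg) ha h.smooth_alphaBar).contDiffAt
    (hU.mem_nhds hp)
  have hc := (contDiffOn_hCurl hM (.of_isOpen hU hreg) ha h.smooth_alphaBar).contDiffAt
    (hU.mem_nhds hp)
  have hψ := contDiffAt_weightedPair (hw p hp) (h.smooth_rho.contDiffAt (hU.mem_nhds hp))
    (h.smooth_sigma.contDiffAt (hU.mem_nhds hp)) z
  have hev : (fun q => fderiv ℝ (weightedPair w z ρ σ) q (e3 q)) =ᶠ[𝓝 p]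
      fun q => -weightedPair w z (hDiv M a αb) (hCurl M a αb) q := by
    filter_upwards [hU.mem_nhds hp] with q hq
    exact h.fderiv_e3_weightedPair hU hreg hq ((hw q hq).differentiableAt (by simp)) hz (hwz q hq)
  rw [fderiv_e3_spinDeriv (rad_pos_of_mem_region (hreg hp)) (contDiffAt_infty.1 hψ 2),
    spinDeriv_congr hev, spinDeriv_neg, sq_mul_spinComp_gradShift ha (hreg hp)
      ((hw p hp).differentiableAt (by simp)) hτ (hd.differentiableAt (by simp))
      (hc.differentiableAt (by simp))]

theorem fderiv_scaledE4_spinDeriv_weightedPair {w : Pt → ℂ} {z : ℂ} {τ : OneForm}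
    (hw : ∀ q ∈ U, ContDiffAt ℝ ∞ w q) (hz : z ^ 2 = -1)
    (hwz : ∀ q ∈ U, w q * (trChi M a q - z * epsChi M a q) = 2 * fderiv ℝ w q (e4 M a q))
    (hτ : spinDeriv a w p = w p * spinComp a p (τ p)) :
    fderiv ℝ (spinDeriv a (weightedPair w z ρ σ)) p (scaledE4 M a p)
      = w p ^ 2 * (spinComp a p (gradShift M a τ (hDiv M a (scal (bigSigma a) α)) p)
        - z * spinComp a p (gradShift M a τ (hCurl M a (scal (bigSigma a) α)) p)) := by
  have hα := contDiffOn_scal (contDiffOn_bigSigma hM (.of_isOpen hU hreg)) h.smooth_alpha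
  have hd := (contDiffOn_hDiv hM (.of_isOpen hU hreg) ha hα).contDiffAt (hU.mem_nhds hp)
  have hc := (contDiffOn_hCurl hM (.of_isOpen hU hreg) ha hα).contDiffAt (hU.mem_nhds hp)
  have hψ := contDiffAt_weightedPair (hw p hp) (h.smooth_rho.contDiffAt (hU.mem_nhds hp))
    (h.smooth_sigma.contDiffAt (hU.mem_nhds hp)) z
  have hev : (fun q => fderiv ℝ (weightedPair w z ρ σ) q (scaledE4 M a q)) =ᶠ[𝓝 p]
      weightedPair w (-z) (hDiv M a (scal (bigSigma a) α)) (hCurl M a (scal (bigSigma a) α)) := by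
    filter_upwards [hU.mem_nhds hp] with q hq
    exact h.fderiv_scaledE4_weightedPair ha hU hreg hq ((hw q hq).differentiableAt (by simp)) hz
      (hwz q hq)
  rw [fderiv_scaledE4_spinDeriv (rad_pos_of_mem_region (hreg hp)) (contDiffAt_infty.1 hψ 2),
    spinDeriv_congr hev, ← sq_mul_spinComp_gradShift ha (hreg hp)
      ((hw p hp).differentiableAt (by simp)) hτ (hd.differentiableAt (by simp))
      (hc.differentiableAt (by simp)), neg_mul, ← sub_eq_add_neg]

end IsMaxwellSolution

end Maxwell

/-! ### The Teukolsky equations and the Teukolsky–Starobinsky identities -/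

namespace IsMaxwellSolution

variable {U : Set Pt} {α αb : OneForm} {ρ σ : Pt → ℝ}

theorem contDiffOn_op4_alphaBar (h : IsMaxwellSolution M a U α αb ρ σ) (hM : 0 < M) (ha : |a| ≤ M)
    (hU : IsRelOpen M a U) :
    ContDiffOn ℝ ∞ (op4 M a (1 / 2) (1 / 2) αb + scal (omegaHat M a) αb) U :=
  (contDiffOn_op4 hM hU ha _ _ h.smooth_alphaBar).add
    (contDiffOn_scal (contDiffOn_omegaHat hM hU ha) h.smooth_alphaBar)

variable (h : IsMaxwellSolution M a U α αb ρ σ) (hM : 0 < M) (ha : |a| ≤ M) (hU : IsOpen U)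
  (hreg : U ⊆ region M a) (hp : p ∈ U)

include h hM ha hU hreg hp

theorem fderiv_e3_spinComp_op3 :
    fderiv ℝ (fun q => conj (zeta a q) ^ 2 * spinComp a q (op3 M a (1 / 2) (1 / 2) α q)) p (e3 p)
      = -(conj (zeta a p) ^ 2 * (spinComp a p (gradShift M a (eta M a) (hDiv M a αb) p)
        - Complex.I * spinComp a p (gradShift M a (eta M a) (hCurl M a αb) p))) := by
  have hev : (fun q => conj (zeta a q) ^ 2 * spinComp a q (op3 M a (1 / 2) (1 / 2) α q)) =ᶠ[𝓝 p]
      spinDeriv a (weightedPair (fun q => conj (zeta a q)) (-Complex.I) ρ σ) :=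
    Filter.eventually_of_mem (hU.mem_nhds hp) fun q hq => h.sq_mul_spinComp_op3 ha hU hreg hq
  rw [hev.fderiv_eq, h.fderiv_e3_spinDeriv_weightedPair hM ha hU hreg hp
    (fun q hq => contDiffAt_conj_zeta a (rad_pos_of_mem_region (hreg hq))) (by simp)
    (fun q hq => by linear_combination conj_zeta_mul_chiBar ha (hreg hq))
    (spinDeriv_conj_zeta ha (hreg hp))]
  ring

theorem fderiv_scaledE4_spinComp_op3 :
    fderiv ℝ (fun q => conj (zeta a q) ^ 2 * spinComp a q (op3 M a (1 / 2) (1 / 2) α q)) p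
        (scaledE4 M a p)
      = conj (zeta a p) ^ 2
        * (spinComp a p (gradShift M a (eta M a) (hDiv M a (scal (bigSigma a) α)) p) + Complex.I
          * spinComp a p (gradShift M a (eta M a) (hCurl M a (scal (bigSigma a) α)) p)) := by
  have hev : (fun q => conj (zeta a q) ^ 2 * spinComp a q (op3 M a (1 / 2) (1 / 2) α q)) =ᶠ[𝓝 p]
      spinDeriv a (weightedPair (fun q => conj (zeta a q)) (-Complex.I) ρ σ) :=
    Filter.eventually_of_mem (hU.mem_nhds hp) fun q hq => h.sq_mul_spinComp_op3 ha hU hreg hq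
  rw [hev.fderiv_eq, h.fderiv_scaledE4_spinDeriv_weightedPair hM ha hU hreg hp
    (fun q hq => contDiffAt_conj_zeta a (rad_pos_of_mem_region (hreg hq))) (by simp)
    (fun q hq => by linear_combination conj_zeta_mul_chi ha (hreg hq))
    (spinDeriv_conj_zeta ha (hreg hp))]
  ring

theorem fderiv_e3_spinComp_op4 :
    fderiv ℝ (fun q => zeta a q ^ 2
        * spinComp a q ((op4 M a (1 / 2) (1 / 2) αb + scal (omegaHat M a) αb) q)) p (e3 p)
      = zeta a p ^ 2 * (spinComp a p (gradShift M a (etaBar M a) (hDiv M a αb) p)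
        + Complex.I * spinComp a p (gradShift M a (etaBar M a) (hCurl M a αb) p)) := by
  have hev : (fun q => zeta a q ^ 2
        * spinComp a q ((op4 M a (1 / 2) (1 / 2) αb + scal (omegaHat M a) αb) q)) =ᶠ[𝓝 p]
      fun q => -spinDeriv a (weightedPair (zeta a) Complex.I ρ σ) q :=
    Filter.eventually_of_mem (hU.mem_nhds hp) fun q hq => h.sq_mul_spinComp_op4 ha hU hreg hq
  rw [hev.fderiv_eq, fderiv_fun_neg, neg_apply, h.fderiv_e3_spinDeriv_weightedPair hM ha hU hreg hp
    (fun q hq => contDiffAt_zeta a (rad_pos_of_mem_region (hreg hq))) (by simp)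
    (fun q hq => by linear_combination zeta_mul_chiBar ha (hreg hq))
    (spinDeriv_zeta ha (hreg hp)), neg_neg]

theorem fderiv_scaledE4_spinComp_op4 :
    fderiv ℝ (fun q => zeta a q ^ 2
        * spinComp a q ((op4 M a (1 / 2) (1 / 2) αb + scal (omegaHat M a) αb) q)) p (scaledE4 M a p)
      = -(zeta a p ^ 2
        * (spinComp a p (gradShift M a (etaBar M a) (hDiv M a (scal (bigSigma a) α)) p) - Complex.I
          * spinComp a p (gradShift M a (etaBar M a) (hCurl M a (scal (bigSigma a) α)) p))) := by
  have hev : (fun q => zeta a q ^ 2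
        * spinComp a q ((op4 M a (1 / 2) (1 / 2) αb + scal (omegaHat M a) αb) q)) =ᶠ[𝓝 p]
      fun q => -spinDeriv a (weightedPair (zeta a) Complex.I ρ σ) q :=
    Filter.eventually_of_mem (hU.mem_nhds hp) fun q hq => h.sq_mul_spinComp_op4 ha hU hreg hq
  rw [hev.fderiv_eq, fderiv_fun_neg, neg_apply,
    h.fderiv_scaledE4_spinDeriv_weightedPair hM ha hU hreg hp
    (fun q hq => contDiffAt_zeta a (rad_pos_of_mem_region (hreg hq))) (by simp)
    (fun q hq => by linear_combination zeta_mul_chi ha (hreg hq))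
    (spinDeriv_zeta ha (hreg hp))]

theorem teukolsky_alpha_of_mem_region :
    bigSigma a p • op4 M a (3 / 2) (-(1 / 2)) (op3 M a (1 / 2) (1 / 2) α) p
      - gradShift M a (eta M a) (hDiv M a (scal (bigSigma a) α)) p
      + hStar M a (gradShift M a (eta M a) (hCurl M a (scal (bigSigma a) α))) p = 0 := by
  have hrp := hreg hp
  have hr := rad_pos_of_mem_region hrp
  have hhor := h.horizontal_alpha.op3 ha hreg (1 / 2) (1 / 2)
  have hX : conj (zeta a p) ^ 2
      * spinComp a p (op4 M a (3 / 2) (-(1 / 2)) (op3 M a (1 / 2) (1 / 2) α) p) = _ :=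
    (isTransverse_e4 ha).sq_mul_spinComp_shift (w := fun q => conj (zeta a q)) ha hrp hp hhor
      ((contDiffOn_op3 hM (.of_isOpen hU hreg) ha _ _ h.smooth_alpha).contDiffAt (hU.mem_nhds hp))
      ((contDiffAt_conj_zeta (n := 1) a hr).differentiableAt one_ne_zero)
      (conj_zeta_mul_chi ha hrp)
  have hcomm := h.fderiv_scaledE4_spinComp_op3 hM ha hU hreg hp
  rw [fderiv_scaledE4_eq M hr, ← hX] at hcomm
  refine spinComp_injOn ha hrp (add_mem (sub_mem (Submodule.smul_mem _ _
    (hhor.op4 ha hreg _ _ p hp)) (gradShift_eta_mem ha hrp _)) (hStar_mem ha hrp _))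
    (zero_mem _) ?_
  refine mul_left_cancel₀ (pow_ne_zero 2 ((map_ne_zero conj).2 (zeta_ne_zero a hr))) ?_
  rw [map_add, map_sub, map_smul, Complex.real_smul, spinComp_hStar ha hrp, map_zero]
  linear_combination hcomm

theorem teukolsky_alphaBar_of_mem_region :
    op3 M a (3 / 2) (-(1 / 2)) (op4 M a (1 / 2) (1 / 2) αb + scal (omegaHat M a) αb) p
      - gradShift M a (etaBar M a) (hDiv M a αb) p
      + hStar M a (gradShift M a (etaBar M a) (hCurl M a αb)) p = 0 := by
  have hrp := hreg hp
  have hr := rad_pos_of_mem_region hrp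
  have hhor := (h.horizontal_alphaBar.op4 ha hreg (1 / 2) (1 / 2)).add
    (h.horizontal_alphaBar.scal (omegaHat M a))
  have hX : zeta a p ^ 2 * spinComp a p (op3 M a (3 / 2) (-(1 / 2))
      (op4 M a (1 / 2) (1 / 2) αb + scal (omegaHat M a) αb) p) = _ :=
    (isTransverse_e3 ha).sq_mul_spinComp_shift ha hrp hp hhor
      ((h.contDiffOn_op4_alphaBar hM ha (.of_isOpen hU hreg)).contDiffAt (hU.mem_nhds hp))
      (differentiableAt_zeta a hr) (zeta_mul_chiBar ha hrp)
  have hcomm := h.fderiv_e3_spinComp_op4 hM ha hU hreg hp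
  rw [← hX] at hcomm
  refine spinComp_injOn ha hrp (add_mem (sub_mem (hhor.op3 ha hreg _ _ p hp)
    (gradShift_etaBar_mem ha hrp _)) (hStar_mem ha hrp _)) (zero_mem _) ?_
  refine mul_left_cancel₀ (pow_ne_zero 2 (zeta_ne_zero a hr)) ?_
  rw [map_add, map_sub, spinComp_hStar ha hrp, map_zero]
  linear_combination hcomm

theorem teukolskyStarobinsky_alpha_of_mem_region :
    (1 / bigSigma a p) • op3 M a (1 / 2) (3 / 2)
        (scal (bigSigma a) (op3 M a (1 / 2) (1 / 2) α)) p
      = -gradShift M a (eta M a) (hDiv M a αb) p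
        - hStar M a (gradShift M a (eta M a) (hCurl M a αb)) p := by
  have hrp := hreg hp
  have hr := rad_pos_of_mem_region hrp
  have hhor := h.horizontal_alpha.op3 ha hreg (1 / 2) (1 / 2)
  have hX : conj (zeta a p) * spinComp a p (op3 M a (1 / 2) (3 / 2)
      (scal (bigSigma a) (op3 M a (1 / 2) (1 / 2) α)) p) = _ :=
    (isTransverse_e3 ha).mul_spinComp_shift_scal ha hrp hp hhor
      ((contDiffOn_op3 hM (.of_isOpen hU hreg) ha _ _ h.smooth_alpha).contDiffAt (hU.mem_nhds hp))
      ((contDiffAt_conj_zeta (n := 1) a hr).differentiableAt one_ne_zero)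
      (differentiableAt_zeta a hr) (fun q => by rw [mul_comm, zeta_mul_conj])
      (conj_zeta_mul_chiBar ha hrp) (zeta_mul_chiBar ha hrp)
  rw [h.fderiv_e3_spinComp_op3 hM ha hU hreg hp] at hX
  refine spinComp_injOn ha hrp (Submodule.smul_mem _ _ ((hhor.scal _).op3 ha hreg _ _ p hp))
    (sub_mem (neg_mem (gradShift_eta_mem ha hrp _)) (hStar_mem ha hrp _)) ?_
  have hS : (bigSigma a p : ℂ) ≠ 0 := Complex.ofReal_ne_zero.2 (bigSigma_pos a hr).ne'
  refine mul_left_cancel₀ (mul_ne_zero hS ((map_ne_zero conj).2 (zeta_ne_zero a hr))) ?_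
  rw [map_sub, map_neg, map_smul, Complex.real_smul, spinComp_hStar ha hrp, one_div,
    Complex.ofReal_inv, mul_assoc, mul_left_comm (conj _), mul_inv_cancel_left₀ hS, hX,
    ← zeta_mul_conj]
  ring

theorem teukolskyStarobinsky_alphaBar_of_mem_region :
    op4 M a (1 / 2) (3 / 2)
        (scal (bigSigma a) (op4 M a (1 / 2) (1 / 2) αb + scal (omegaHat M a) αb)) p
      = -gradShift M a (etaBar M a) (hDiv M a (scal (bigSigma a) α)) p
        - hStar M a (gradShift M a (etaBar M a) (hCurl M a (scal (bigSigma a) α))) p := by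
  have hrp := hreg hp
  have hr := rad_pos_of_mem_region hrp
  have hhor := (h.horizontal_alphaBar.op4 ha hreg (1 / 2) (1 / 2)).add
    (h.horizontal_alphaBar.scal (omegaHat M a))
  have hX : zeta a p * spinComp a p (op4 M a (1 / 2) (3 / 2)
      (scal (bigSigma a) (op4 M a (1 / 2) (1 / 2) αb + scal (omegaHat M a) αb)) p) = _ :=
    (isTransverse_e4 ha).mul_spinComp_shift_scal ha hrp hp hhor
      ((h.contDiffOn_op4_alphaBar hM ha (.of_isOpen hU hreg)).contDiffAt (hU.mem_nhds hp))
      (differentiableAt_zeta a hr)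
      ((contDiffAt_conj_zeta (n := 1) a hr).differentiableAt one_ne_zero)
      (fun q => (zeta_mul_conj a q).symm) (zeta_mul_chi ha hrp) (conj_zeta_mul_chi ha hrp)
  have hcomm := h.fderiv_scaledE4_spinComp_op4 hM ha hU hreg hp
  rw [fderiv_scaledE4_eq M hr] at hcomm
  refine spinComp_injOn ha hrp ((hhor.scal _).op4 ha hreg _ _ p hp)
    (sub_mem (neg_mem (gradShift_etaBar_mem ha hrp _)) (hStar_mem ha hrp _)) ?_
  have hS : (bigSigma a p : ℂ) ≠ 0 := Complex.ofReal_ne_zero.2 (bigSigma_pos a hr).ne'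
  refine mul_left_cancel₀ (mul_ne_zero hS (zeta_ne_zero a hr)) ?_
  rw [map_sub, map_neg, spinComp_hStar ha hrp, mul_assoc, hX, mul_left_comm, hcomm,
    ← zeta_mul_conj]
  ring

end IsMaxwellSolution

end

end KerrMaxwell

theorem proposition3p1 (M a : ℝ) (hM : 0 < M) (ha : |a| ≤ M)
    (U : Set Pt) (hU : ∃ V : Set Pt, IsOpen V ∧ U = V ∩ exterior M a)
    (α αb : OneForm) (ρ σ : Pt → ℝ) (hsol : IsMaxwellSolution M a U α αb ρ σ) :
    -- the Teukolsky equation of spin `+1`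
    (∀ p ∈ U,
      bigSigma a p • op4 M a (3 / 2) (-(1 / 2)) (op3 M a (1 / 2) (1 / 2) α) p
        - gradShift M a (eta M a) (hDiv M a (scal (bigSigma a) α)) p
        + hStar M a (gradShift M a (eta M a) (hCurl M a (scal (bigSigma a) α))) p = 0) ∧
    -- the Teukolsky equation of spin `-1`
    (∀ p ∈ U,
      op3 M a (3 / 2) (-(1 / 2))
          (op4 M a (1 / 2) (1 / 2) αb + scal (omegaHat M a) αb) p
        - gradShift M a (etaBar M a) (hDiv M a αb) p
        + hStar M a (gradShift M a (etaBar M a) (hCurl M a αb)) p = 0) ∧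
    -- the first Teukolsky–Starobinsky identity
    (∀ p ∈ U,
      (1 / bigSigma a p) •
          op3 M a (1 / 2) (3 / 2) (scal (bigSigma a) (op3 M a (1 / 2) (1 / 2) α)) p
        = -gradShift M a (eta M a) (hDiv M a αb) p
          - hStar M a (gradShift M a (eta M a) (hCurl M a αb)) p) ∧
    -- the second Teukolsky–Starobinsky identity
    (∀ p ∈ U,
      op4 M a (1 / 2) (3 / 2)
          (scal (bigSigma a) (op4 M a (1 / 2) (1 / 2) αb + scal (omegaHat M a) αb)) p
        = -gradShift M a (etaBar M a) (hDiv M a (scal (bigSigma a) α)) p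
          - hStar M a (gradShift M a (etaBar M a) (hCurl M a (scal (bigSigma a) α))) p) := by
  replace hU : IsRelOpen M a U := hU
  have hV := hU.isOpen_inter_region
  have h := hsol.mono (Set.inter_subset_left (t := region M a))
  have hS : ContDiffOn ℝ ∞ (bigSigma a) U := contDiffOn_bigSigma hM hU
  have hη := contDiffOn_eta hM hU ha
  have hηb := contDiffOn_etaBar hM hU ha
  have hα := contDiffOn_scal hS hsol.smooth_alpha
  have hαb := hsol.smooth_alphaBar
  have hop3 := contDiffOn_op3 hM hU ha (1 / 2) (1 / 2) hsol.smooth_alpha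
  have hop4 := hsol.contDiffOn_op4_alphaBar hM ha hU
  have hdiv {τ ς} := contDiffOn_gradShift_hDiv (τ := τ) (ς := ς) hM hU ha
  have hcurl {τ ς} := contDiffOn_hStar_gradShift_hCurl (τ := τ) (ς := ς) hM hU ha
  exact ⟨hU.eqOn_of_eqOn_region (((hS.smul (contDiffOn_op4 hM hU ha _ _ hop3)).sub
      (hdiv hη hα)).add (hcurl hη hα)) contDiffOn_const
      fun p hp => h.teukolsky_alpha_of_mem_region hM ha hV Set.inter_subset_right hp,
    hU.eqOn_of_eqOn_region (((contDiffOn_op3 hM hU ha _ _ hop4).sub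
      (hdiv hηb hαb)).add (hcurl hηb hαb)) contDiffOn_const
      fun p hp => h.teukolsky_alphaBar_of_mem_region hM ha hV Set.inter_subset_right hp,
    hU.eqOn_of_eqOn_region ((contDiffOn_one_div_bigSigma hM hU).smul
      (contDiffOn_op3 hM hU ha _ _ (contDiffOn_scal hS hop3)))
      ((hdiv hη hαb).neg.sub (hcurl hη hαb))
      fun p hp => h.teukolskyStarobinsky_alpha_of_mem_region hM ha hV Set.inter_subset_right hp,
    hU.eqOn_of_eqOn_region (contDiffOn_op4 hM hU ha _ _ (contDiffOn_scal hS hop4))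
      ((hdiv hηb hα).neg.sub (hcurl hηb hα))
      fun p hp => h.teukolskyStarobinsky_alphaBar_of_mem_region hM ha hV Set.inter_subset_right hp⟩
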